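/- Let $N\ge 1$ and let $\Omega\subset\mathbb R^2$ be a bounded open set with Lipschitz boundary. Let $A=(A^{\alpha\beta})_{1\le\alpha,\beta\le2}$, $A^{\alpha\beta}(y)\in M_N(\mathbb R)$, be $C^\infty$ on $\mathbb R^2$, $\mathbb Z^2$-periodic, and elliptic: there is $\lambda>0$ such that for all $\xi=(\xi^1,\xi^2)\in(\mathbb R^N)^2$ and all $y\in\mathbb R^2$ (summation over repeated indices) $$\lambda\,|\xi|^2\le A^{\alpha\beta}_{ij}(y)\,\xi^\beta_j\,\xi^\alpha_i\le\lambda^{-1}|\xi|^2 .$$ No symmetry of $A$ is assumed. Let $\chi=(\chi^\gamma)_{1\le\gamma\le2}$, $\chi^\gamma(y)\in M_N(\mathbb R)$, be the $\mathbb Z^2$-periodic ($C^2$) solution of the cell problem $$-\partial_{y_\alpha}\bigl(A^{\alpha\beta}\partial_{y_\beta}\chi^\gamma\bigr)=\partial_{y_\alpha}A^{\alpha\gamma}\ \text{ in }\mathbb R^2,\qquad \int_{[0,1)^2}\chi^\gamma\,dy=0,$$ and let $A^0$ be the constant homogenized tensor $$A^{0,\alpha\beta}=\int_{[0,1)^2}A^{\alpha\beta}\,dy+\int_{[0,1)^2}A^{\alpha\gamma}\,\partial_{y_\gamma}\chi^\beta\,dy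 .$$ Then there is a constant $C>0$ (depending on $\Omega$, $N$ and $A$ only) such that the following holds for every $\varepsilon>0$, every $f\in H^{-1}(\Omega;\mathbb R^N)$ and every $\varphi_0\in H^{1/2}(\partial\Omega;\mathbb R^N)$. Let $u^\varepsilon,u^0\in H^1(\Omega;\mathbb R^N)$ be the weak solutions of $$-\nabla\cdot A\bigl(\tfrac{x}{\varepsilon}\bigr)\nabla u^\varepsilon=f\ \text{ in }\Omega,\quad u^\varepsilon=\varphi_0\ \text{ on }\partial\Omega,\qquad\qquad -\nabla\cdot A^0\nabla u^0=f\ \text{ in }\Omega,\quad u^0=\varphi_0\ \text{ on }\partial\Omega,$$ where $(\nabla\cdot B\nabla u)_i=\partial_{x_\alpha}(B^{\alpha\beta}_{ij}\partial_{x_\beta}u_j)$ and the boundary condition means that $u^\varepsilon-g$ and $u^0-g$ lie in $H^1_0(\Omega;\mathbb R^N)$, $g\in H^1(\Omega;\mathbb R^N)$ being a function with trace $\varphi_0$. If $u^0\in H^2(\Omega;\mathbb R^N)$, then $$\|u^\varepsilon-u^0\|_{L^2(\Omega)}\le C\,\varepsilon^{1/2}\,\|u^0\|_{H^2(\Omega)}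 .$$ -/

import Mathlib

open MeasureTheory Set TopologicalSpace
open scoped Distributions ContDiff NNReal

noncomputable section

namespace Homog

/-- The plane with its Euclidean norm. -/
abbrev Plane : Type := EuclideanSpace ℝ (Fin 2)

/-- The value space `ℝ^N`. -/
abbrev Vec (N : ℕ) : Type := EuclideanSpace ℝ (Fin N)

/-- A tensor field `A = (A^{αβ}_{ij})` on the plane; `A α β y` is the matrix `A^{αβ}(y)`. -/
abbrev TensorField (N : ℕ) : Type := Fin 2 → Fin 2 → Plane → Matrix (Fin N) (Fin N) ℝ

/-- Coordinate vector `e_α`. -/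
def basisVec (α : Fin 2) : Plane := EuclideanSpace.single α 1

/-- Classical partial derivative `∂_α f`. -/
def partialD {F : Type*} [NormedAddCommGroup F] [NormedSpace ℝ F]
    (α : Fin 2) (f : Plane → F) (y : Plane) : F :=
  fderiv ℝ f y (basisVec α)

/-! ### Sobolev spaces on an open set of the plane -/

section Sobolev

variable {F : Type*} [NormedAddCommGroup F] [NormedSpace ℝ F]

/-- `g` is the weak partial derivative `∂_α u` on `Ω`. -/
def HasWeakPartial (Ω : Opens Plane) (α : Fin 2) (u g : Plane → F) : Prop :=
  LocallyIntegrableOn u (Ω : Set Plane) volume ∧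
  LocallyIntegrableOn g (Ω : Set Plane) volume ∧
  ∀ φ : 𝓓(Ω, ℝ),
    ∫ x in (Ω : Set Plane), partialD α φ x • u x = - ∫ x in (Ω : Set Plane), φ x • g x

open Classical in
/-- A representative of the weak derivative `∂_α u` on `Ω` (zero if there is none);
it is unique up to equality almost everywhere on `Ω`. -/
def weakPartial (Ω : Opens Plane) (α : Fin 2) (u : Plane → F) : Plane → F :=
  if h : ∃ g, HasWeakPartial Ω α u g then h.choose else 0

/-- `u ∈ L²(Ω)`. -/
def MemL2 (Ω : Opens Plane) (u : Plane → F) : Prop :=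
  MemLp u 2 (volume.restrict (Ω : Set Plane))

/-- `‖u‖_{L²(Ω)}`. -/
def l2Norm (Ω : Opens Plane) (u : Plane → F) : ℝ :=
  (eLpNorm u 2 (volume.restrict (Ω : Set Plane))).toReal

/-- `u ∈ H¹(Ω)`: `u` and its weak first derivatives are in `L²(Ω)`. -/
def MemH1 (Ω : Opens Plane) (u : Plane → F) : Prop :=
  MemL2 Ω u ∧ ∀ α, ∃ g, HasWeakPartial Ω α u g ∧ MemL2 Ω g

/-- `u ∈ H²(Ω)`: `u ∈ H¹(Ω)` and its weak first derivatives are in `H¹(Ω)`. -/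
def MemH2 (Ω : Opens Plane) (u : Plane → F) : Prop :=
  MemH1 Ω u ∧ ∀ α, MemH1 Ω (weakPartial Ω α u)

/-- `‖u‖_{H¹(Ω)}`, for `u ∈ H¹(Ω)`. -/
def h1Norm (Ω : Opens Plane) (u : Plane → F) : ℝ :=
  Real.sqrt (l2Norm Ω u ^ 2 + ∑ α, l2Norm Ω (weakPartial Ω α u) ^ 2)

/-- `‖u‖_{H²(Ω)}`, for `u ∈ H²(Ω)`. -/
def h2Norm (Ω : Opens Plane) (u : Plane → F) : ℝ :=
  Real.sqrt (l2Norm Ω u ^ 2 + ∑ α, l2Norm Ω (weakPartial Ω α u) ^ 2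
    + ∑ α, ∑ β, l2Norm Ω (weakPartial Ω β (weakPartial Ω α u)) ^ 2)

/-- `u ∈ H¹₀(Ω)`: `u` is in the closure of the smooth compactly supported functions in
`H¹(Ω)`. -/
def MemH10 (Ω : Opens Plane) (u : Plane → F) : Prop :=
  MemH1 Ω u ∧ ∀ δ > 0, ∃ φ : 𝓓(Ω, F), h1Norm Ω (fun x => u x - φ x) < δ

/-- `f ∈ H⁻¹(Ω)`, the dual of `H¹₀(Ω)`: a linear functional on the test functions that is bounded
for the `H¹` norm (and so extends uniquely to `H¹₀(Ω)`). -/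
def MemHNegOne (Ω : Opens Plane) (f : 𝓓(Ω, F) →ₗ[ℝ] ℝ) : Prop :=
  ∃ K : ℝ, ∀ φ : 𝓓(Ω, F), |f φ| ≤ K * h1Norm Ω (φ : Plane → F)

end Sobolev

/-- Lipschitz boundary: near each boundary point, in suitable orthonormal coordinates, `Ω` is the
region lying strictly above the graph of a Lipschitz function. -/
def HasLipschitzBoundary (Ω : Set Plane) : Prop :=
  ∀ x ∈ frontier Ω, ∃ (e : Plane ≃ₗᵢ[ℝ] Plane) (γ : ℝ → ℝ) (L : ℝ≥0) (r : ℝ),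
    LipschitzWith L γ ∧ 0 < r ∧ ∀ y ∈ Metric.ball x r, (y ∈ Ω ↔ γ (e y 0) < e y 1)

/-! ### Coefficients, cell problem, homogenized tensor -/

section Coefficients

variable {N : ℕ}

/-- The quadratic form `A^{αβ}_{ij}(y) ξ^β_j ξ^α_i` of the operator `-∇·A∇`. -/
def quadForm (A : TensorField N) (y : Plane) (ξ : Fin 2 → Vec N) : ℝ :=
  ∑ α, ∑ β, ∑ i, ∑ j, A α β y i j * ξ β j * ξ α i

/-- Ellipticity. -/
def IsElliptic (A : TensorField N) : Prop :=
  ∃ lam : ℝ, 0 < lam ∧ ∀ (ξ : Fin 2 → Vec N) (y : Plane),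
    lam * ∑ α, ‖ξ α‖ ^ 2 ≤ quadForm A y ξ ∧ quadForm A y ξ ≤ lam⁻¹ * ∑ α, ‖ξ α‖ ^ 2

/-- The vector of the lattice `ℤ²` with coordinates `h`. -/
def latticeVec (h : Fin 2 → ℤ) : Plane := WithLp.toLp 2 (fun i => (h i : ℝ))

/-- Periodicity with respect to `ℤ²`. -/
def IsPeriodic {X : Type*} (f : Plane → X) : Prop :=
  ∀ (y : Plane) (h : Fin 2 → ℤ), f (y + latticeVec h) = f y

/-- The standing assumptions on the coefficients: ellipticity, periodicity, smoothness. -/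
structure IsAdmissible (A : TensorField N) : Prop where
  elliptic : IsElliptic A
  periodic : ∀ α β, IsPeriodic (A α β)
  smooth : ∀ α β i j, ContDiff ℝ ∞ (fun y => A α β y i j)

/-- The unit cell `[0,1)²`, a fundamental domain of the torus `𝕋² = ℝ²/ℤ²`. -/
def unitCell : Set Plane := {y | ∀ i, y i ∈ Ico (0 : ℝ) 1}

/-- `χ = (χ^γ)`, `χ^γ(y) ∈ M_N(ℝ)`, is the (classical) solution of the cell problem
`-∇·A∇χ^γ = ∂_α A^{αγ}` on `𝕋²`, `∫_{𝕋²} χ^γ = 0`. -/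
structure IsCellSolution (A : TensorField N)
    (χ : Fin 2 → Plane → Matrix (Fin N) (Fin N) ℝ) : Prop where
  periodic : ∀ γ, IsPeriodic (χ γ)
  regular : ∀ γ i j, ContDiff ℝ 2 (fun y => χ γ y i j)
  equation : ∀ (γ : Fin 2) (i j : Fin N) (y : Plane),
    - ∑ α, partialD α
        (fun z => ∑ β, ∑ k, A α β z i k * partialD β (fun w => χ γ w k j) z) y
      = ∑ α, partialD α (fun z => A α γ z i j) y
  mean_zero : ∀ γ i j, ∫ y in unitCell, χ γ y i j = 0

/-- The homogenized tensor `A^{0,αβ} = ∫ A^{αβ} + ∫ A^{αγ} ∂_γ χ^β`, as a constant field. -/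
def homogenized (A : TensorField N) (χ : Fin 2 → Plane → Matrix (Fin N) (Fin N) ℝ) :
    TensorField N :=
  fun α β _ => Matrix.of fun i j =>
    (∫ y in unitCell, A α β y i j)
      + ∫ y in unitCell, ∑ γ, ∑ k, A α γ y i k * partialD γ (fun z => χ β z k j) y

/-- The oscillating tensor `A(x/ε)`. -/
def oscillating (A : TensorField N) (ε : ℝ) : TensorField N :=
  fun α β x => A α β (ε⁻¹ • x)

/-- `u ∈ H¹(Ω)` is the weak solution of `-∇·B∇u = f` in `Ω`, `u = φ₀` on `∂Ω`. The boundary datum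
`φ₀ ∈ H^{1/2}(∂Ω)` is given as the trace of `g ∈ H¹(Ω)`, and `u = φ₀` on `∂Ω` means
`u - g ∈ H¹₀(Ω)`. -/
structure IsWeakSolution (Ω : Opens Plane) (B : TensorField N) (f : 𝓓(Ω, Vec N) →ₗ[ℝ] ℝ)
    (g u : Plane → Vec N) : Prop where
  memH1 : MemH1 Ω u
  boundary : MemH10 Ω (fun x => u x - g x)
  weak : ∀ φ : 𝓓(Ω, Vec N),
    ∫ x in (Ω : Set Plane), ∑ α, ∑ β, ∑ i, ∑ j,
        B α β x i j * weakPartial Ω β u x j * partialD α φ x i = f φ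

end Coefficients

end Homog

end

namespace Homog

open Filter Topology
open scoped Convolution ENNReal Pointwise

/-! Compare `uε` with the two-scale expansion u₀ + v, v = ε χ^β(x/ε) q^β, where q = (q^β) is C²,
compactly supported in Ω and close to ∇u₀. The product rule gives the identity (`bil_two_scale`)
A(x/ε)(∇uε − ∇u₀ − ∇v) = [A(x/ε)∇uε − A⁰∇u₀] + (A⁰ − A(x/ε))(∇u₀ − q) + B(x/ε) q − ε A(x/ε) χ(x/ε)
∇q, where B = A⁰ − A − A∇χ is the flux defect. Tested against ∇φ, the bracket disappears, because
both problems have the same right-hand side.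

The defect B is periodic, has mean zero by the definition of A⁰ and is divergence free by the cell
problem. In dimension two it is therefore the rotated gradient of a periodic, hence bounded, stream
function (`exists_stream`, `exists_fluxCorrector`). Integration by parts in B(x/ε) q · ∇φ gains a
factor ε, and since the gradient is rotated the second derivatives of φ cancel, so that only ∇q
remains (`abs_integral_fluxDefect_le`). The residual tested against ∇φ is thus at most C (‖∇u₀ − q‖
+ ε‖∇q‖) ‖∇φ‖. Since v vanishes near ∂Ω, uε − u₀ − v lies in H¹₀ and, up to approximation, may
itself be taken as φ. Coercivity, the Poincaré inequality and ‖v‖ ≤ C ε ‖q‖ then give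
`exists_l2Norm_sub_le`: the error is at most C (‖∇u₀ − q‖ + ε‖∇q‖ + ε‖q‖).

It remains to choose q (`exists_family_le`). Take a smooth approximation of ∇u₀ times a cutoff that
equals 1 at distance at least 5ε from the complement and has slope at most 1/ε. Then ‖∇u₀ − q‖ and
ε‖∇q‖ are controlled by the L² norm of ∇u₀ in a boundary layer of width 5ε, by ε‖D²u₀‖ and by an
arbitrarily small error. On a Lipschitz domain an H¹ function has L² norm at most C δ^{1/2} times
its H¹ norm in the layer of width δ (`exists_eLpNorm_boundaryLayer_le`): the layer is thin in the
vertical direction of a chart, and moving upwards stays inside Ω. Applied to ∇u₀, this is the only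
place where the rate drops from ε to ε^{1/2}. -/

theorem eLpNorm_two_sq {X F : Type*} [MeasurableSpace X] [NormedAddCommGroup F] (μ : Measure X)
    (f : X → F) : eLpNorm f 2 μ ^ 2 = ∫⁻ x, ‖f x‖ₑ ^ 2 ∂μ := by
  have := eLpNorm_nnreal_pow_eq_lintegral (μ := μ) (f := f) (p := 2) (by norm_num)
  simpa using this

/-- Jensen's inequality for the square under a probability density. -/
theorem sq_lintegral_mul_le {X : Type*} [MeasurableSpace X] (μ : Measure X) {ρ h : X → ℝ≥0∞}
    (hρ : AEMeasurable ρ μ) (hh : AEMeasurable h μ) (h1 : ∫⁻ x, ρ x ∂μ = 1) :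
    (∫⁻ x, ρ x * h x ∂μ) ^ 2 ≤ ∫⁻ x, ρ x * h x ^ 2 ∂μ := by
  -- Cauchy–Schwarz is applied to this factorization; the first factor has L² norm one by `h1`.
  have hs : ∀ x, ρ x * h x = (ρ x ^ (1 / 2 : ℝ)) * (ρ x ^ (1 / 2 : ℝ) * h x) := by
    intro x
    rw [← mul_assoc, ← ENNReal.rpow_add_of_nonneg _ _ (by norm_num) (by norm_num)]
    norm_num
  have hq := ENNReal.lintegral_mul_le_Lp_mul_Lq μ (Real.HolderConjugate.two_two)
    (f := fun x => ρ x ^ (1 / 2 : ℝ)) (g := fun x => ρ x ^ (1 / 2 : ℝ) * h x)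
    (hρ.pow_const _) ((hρ.pow_const _).mul hh)
  have e1 : ∀ x, (ρ x ^ (1 / 2 : ℝ)) ^ (2 : ℝ) = ρ x := fun x => by
    rw [← ENNReal.rpow_mul]; norm_num
  have e2 : ∀ x, (ρ x ^ (1 / 2 : ℝ) * h x) ^ (2 : ℝ) = ρ x * h x ^ 2 := fun x => by
    rw [ENNReal.mul_rpow_of_nonneg _ _ (by norm_num), e1]; norm_num
  simp only [Pi.mul_apply, e1, e2, h1, ENNReal.one_rpow, one_mul] at hq
  calc (∫⁻ x, ρ x * h x ∂μ) ^ 2 = (∫⁻ x, ρ x ^ (1 / 2 : ℝ) * (ρ x ^ (1 / 2 : ℝ) * h x) ∂μ) ^ 2 := by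
        simp_rw [← hs]
    _ ≤ ((∫⁻ x, ρ x * h x ^ 2 ∂μ) ^ (1 / 2 : ℝ)) ^ 2 := by gcongr
    _ = _ := by rw [← ENNReal.rpow_natCast, ← ENNReal.rpow_mul]; norm_num

/-! ### Translations and mollifications in L² -/

variable {F : Type*} [NormedAddCommGroup F]

/-- Translations are continuous in `L²`. -/
theorem exists_eLpNorm_translate_sub_le {f : Plane → F} (hf : MemLp f 2 volume) {δ : ℝ≥0∞}
    (hδ : 0 < δ) :
    ∃ r > 0, ∀ t : Plane, ‖t‖ < r → eLpNorm (fun x => f (x - t) - f x) 2 volume ≤ δ := by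
  have : Fact ((2 : ℝ≥0∞) ≠ ⊤) := ⟨by norm_num⟩
  -- Translation acts continuously on `Lp` for a finite exponent; `DomAddAct.mk (-t)` acts by
  -- precomposition with x ↦ -t + x.
  have hc : Continuous fun t : Plane => (DomAddAct.mk (-t) +ᵥ hf.toLp f) :=
    (DomAddAct.continuous_mk.comp continuous_neg).vadd continuous_const
  have h0 := hc.tendsto 0
  have h1 : (DomAddAct.mk (-(0 : Plane)) +ᵥ hf.toLp f) = hf.toLp f := by simp
  rw [h1] at h0
  have h2 := (EMetric.tendsto_nhds.1 h0) δ hδ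
  obtain ⟨r, hr, hr'⟩ := Metric.eventually_nhds_iff.1 h2
  refine ⟨r, hr, fun t ht => ?_⟩
  have h3 := hr' (y := t) (by simpa using ht)
  rw [DomAddAct.mk_vadd_toLp, Lp.edist_toLp_toLp] at h3
  refine le_of_eq_of_le ?_ h3.le
  congr 1
  ext x
  simp [sub_eq_add_neg, add_comm]

variable [NormedSpace ℝ F] [CompleteSpace F]

/-- The difference at `x` is the average of `f (x - t) - f x` in `t` against the probability density
`φ.normed volume`. Jensen's inequality moves the square inside the average, and Tonelli exchanges
the two integrals. -/
theorem eLpNorm_convolution_sub_sq_le {f : Plane → F} (hf : MemLp f 2 volume)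
    (φ : ContDiffBump (0 : Plane)) :
    eLpNorm (fun x => (φ.normed volume ⋆[ContinuousLinearMap.lsmul ℝ ℝ, volume] f) x - f x) 2
        volume ^ 2
      ≤ ∫⁻ t, ENNReal.ofReal (φ.normed volume t)
          * eLpNorm (fun x => f (x - t) - f x) 2 volume ^ 2 := by
  have hρi : ∫⁻ t, ENNReal.ofReal (φ.normed volume t) = 1 := by
    rw [← ofReal_integral_eq_lintegral_ofReal φ.integrable_normed
      (ae_of_all _ φ.nonneg_normed), φ.integral_normed, ENNReal.ofReal_one]
  have hρm : Measurable fun t => ENNReal.ofReal (φ.normed volume t) :=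
    (φ.continuous_normed.measurable).ennreal_ofReal
  have hloc : LocallyIntegrable f volume := hf.locallyIntegrable (by norm_num)
  have hm1 : AEStronglyMeasurable (fun z : Plane × Plane => f (z.1 - z.2) - f z.1)
      (volume.prod volume) :=
    (hf.1.comp_quasiMeasurePreserving
      (quasiMeasurePreserving_sub_of_right_invariant volume volume)).sub hf.1.comp_fst
  have hpt : ∀ᵐ x, ‖(φ.normed volume ⋆[ContinuousLinearMap.lsmul ℝ ℝ, volume] f) x - f x‖ₑ ^ 2
      ≤ ∫⁻ t, ENNReal.ofReal (φ.normed volume t) * ‖f (x - t) - f x‖ₑ ^ 2 := by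
    refine ae_of_all _ fun x => ?_
    have hmx : AEStronglyMeasurable (fun t => f (x - t) - f x) volume :=
      (hf.1.comp_quasiMeasurePreserving
        (quasiMeasurePreserving_sub_left_of_right_invariant volume x)).sub
        aestronglyMeasurable_const
    have hi1 : Integrable (fun t => φ.normed volume t • f (x - t)) :=
      (φ.hasCompactSupport_normed.convolutionExists_left
        (ContinuousLinearMap.lsmul ℝ ℝ) φ.continuous_normed hloc x)
    have hi2 : Integrable (fun t => φ.normed volume t • f x) := φ.integrable_normed.smul_const _
    have : (φ.normed volume ⋆[ContinuousLinearMap.lsmul ℝ ℝ, volume] f) x - f x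
        = ∫ t, φ.normed volume t • (f (x - t) - f x) := by
      simp_rw [smul_sub]
      rw [integral_sub hi1 hi2, φ.integral_normed_smul]
      rfl
    rw [this]
    calc _ ≤ (∫⁻ t, ‖φ.normed volume t • (f (x - t) - f x)‖ₑ) ^ 2 := by
          gcongr; exact enorm_integral_le_lintegral_enorm _
      _ = (∫⁻ t, ENNReal.ofReal (φ.normed volume t) * ‖f (x - t) - f x‖ₑ) ^ 2 := by
          congr 1; refine lintegral_congr fun t => ?_
          rw [enorm_smul, Real.enorm_of_nonneg (φ.nonneg_normed t)]
      _ ≤ _ := sq_lintegral_mul_le _ hρm.aemeasurable hmx.enorm hρi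
  rw [eLpNorm_two_sq]
  calc _ ≤ ∫⁻ x, ∫⁻ t, ENNReal.ofReal (φ.normed volume t) * ‖f (x - t) - f x‖ₑ ^ 2 :=
        lintegral_mono_ae hpt
    _ = ∫⁻ t, ∫⁻ x, ENNReal.ofReal (φ.normed volume t) * ‖f (x - t) - f x‖ₑ ^ 2 := by
        refine lintegral_lintegral_swap ?_
        exact (hρm.comp measurable_snd).aemeasurable.mul (hm1.enorm.pow_const 2)
    _ = _ := by
        refine lintegral_congr fun t => ?_
        rw [lintegral_const_mul' _ _ ENNReal.ofReal_ne_top, eLpNorm_two_sq]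

/-- Mollifications converge in `L²`. -/
theorem exists_eLpNorm_convolution_sub_le {f : Plane → F} (hf : MemLp f 2 volume) {δ : ℝ≥0∞}
    (hδ : 0 < δ) :
    ∃ r > 0, ∀ φ : ContDiffBump (0 : Plane), φ.rOut < r →
      eLpNorm (fun x => (φ.normed volume ⋆[ContinuousLinearMap.lsmul ℝ ℝ, volume] f) x - f x) 2
        volume ≤ δ := by
  obtain ⟨r, hr, h⟩ := exists_eLpNorm_translate_sub_le hf hδ
  refine ⟨r, hr, fun φ hφ => ?_⟩
  have hρi : ∫⁻ t, ENNReal.ofReal (φ.normed volume t) = 1 := by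
    rw [← ofReal_integral_eq_lintegral_ofReal φ.integrable_normed
      (ae_of_all _ φ.nonneg_normed), φ.integral_normed, ENNReal.ofReal_one]
  have h2 := eLpNorm_convolution_sub_sq_le hf φ
  have h3 : ∫⁻ t, ENNReal.ofReal (φ.normed volume t)
          * eLpNorm (fun x => f (x - t) - f x) 2 volume ^ 2 ≤ δ ^ 2 := by
    calc _ ≤ ∫⁻ t, ENNReal.ofReal (φ.normed volume t) * δ ^ 2 := by
          refine lintegral_mono fun t => ?_
          by_cases ht : ‖t‖ < r
          · gcongr; exact h t ht
          · have : φ.normed volume t = 0 := by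
              rw [← Function.notMem_support, φ.support_normed_eq]
              simp only [Metric.mem_ball, dist_zero_right, not_lt] at ht ⊢
              exact hφ.le.trans ht
            simp [this]
      _ ≤ δ ^ 2 := by
          rw [lintegral_mul_const _ (φ.continuous_normed.measurable).ennreal_ofReal, hρi, one_mul]
  exact (ENNReal.pow_le_pow_left_iff two_ne_zero).1 (h2.trans h3)

/-! ### Weak derivatives on an open set -/

section WeakDerivatives

variable {F : Type*} [NormedAddCommGroup F] [NormedSpace ℝ F] {Ω : Opens Plane} {α : Fin 2}

theorem measurableSet_opens (Ω : Opens Plane) : MeasurableSet (Ω : Set Plane) :=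
  Ω.isOpen.measurableSet

/-- Local integrability on Ω is enough because the support of `ρ` is a compact subset of Ω, on which
`u` is integrable and `ρ` bounded. -/
theorem integrable_smul_of_tsupport_subset {ρ : Plane → ℝ} (hρ : Continuous ρ)
    (hc : HasCompactSupport ρ) (hs : tsupport ρ ⊆ Ω) {u : Plane → F}
    (hu : LocallyIntegrableOn u (Ω : Set Plane) volume) :
    Integrable (fun x => ρ x • u x) volume := by
  have hK : IsCompact (tsupport ρ) := hc
  have : (tsupport ρ).indicator (fun x ↦ ρ x • u x) = fun x ↦ ρ x • u x := by
    apply indicator_eq_self.2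
    apply Function.support_subset_iff'.2
    intro x hx
    simp [image_eq_zero_of_notMem_tsupport hx]
  rw [← this, indicator_smul]
  apply Integrable.smul_of_top_right
  · rw [integrable_indicator_iff hK.measurableSet]
    exact hu.integrableOn_compact_subset hs hK
  · exact hρ.memLp_top_of_hasCompactSupport hc volume

theorem setIntegral_smul_of_tsupport_subset {ρ : Plane → ℝ} (hs : tsupport ρ ⊆ Ω)
    (u : Plane → F) : ∫ x in (Ω : Set Plane), ρ x • u x = ∫ x, ρ x • u x := by
  refine setIntegral_eq_integral_of_forall_compl_eq_zero fun x hx => ?_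
  rw [image_eq_zero_of_notMem_tsupport fun h => hx (hs h), zero_smul]

theorem continuous_partialD {f : Plane → F} (hf : ContDiff ℝ 1 f) (α : Fin 2) :
    Continuous (partialD α f) :=
  (hf.continuous_fderiv one_ne_zero).clm_apply continuous_const

theorem tsupport_partialD_subset (f : Plane → F) (α : Fin 2) :
    tsupport (partialD α f) ⊆ tsupport f :=
  tsupport_fderiv_apply_subset ℝ _

theorem hasCompactSupport_partialD {f : Plane → F} (hf : HasCompactSupport f) (α : Fin 2) :
    HasCompactSupport (partialD α f) :=
  hf.mono' ((subset_tsupport _).trans (tsupport_partialD_subset f α))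

theorem HasWeakPartial.integrable_left (φ : 𝓓(Ω, ℝ)) {u : Plane → F}
    (hu : LocallyIntegrableOn u (Ω : Set Plane) volume) :
    Integrable (fun x => φ x • u x) volume :=
  integrable_smul_of_tsupport_subset φ.continuous φ.hasCompactSupport φ.tsupport_subset hu

theorem HasWeakPartial.integrable_partialD (φ : 𝓓(Ω, ℝ)) {u : Plane → F}
    (hu : LocallyIntegrableOn u (Ω : Set Plane) volume) (α : Fin 2) :
    Integrable (fun x => partialD α φ x • u x) volume :=
  integrable_smul_of_tsupport_subset
    (continuous_partialD (φ.contDiff.of_le (by exact_mod_cast le_top)) α)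
    (hasCompactSupport_partialD φ.hasCompactSupport α)
    ((tsupport_partialD_subset _ α).trans φ.tsupport_subset) hu

theorem HasWeakPartial.sub {u v g h : Plane → F} (hu : HasWeakPartial Ω α u g)
    (hv : HasWeakPartial Ω α v h) :
    HasWeakPartial Ω α (fun x => u x - v x) (fun x => g x - h x) := by
  refine ⟨hu.1.sub hv.1, hu.2.1.sub hv.2.1, fun φ => ?_⟩
  simp_rw [smul_sub]
  rw [integral_sub (integrable_partialD φ hu.1 α).integrableOn
      (integrable_partialD φ hv.1 α).integrableOn,
    integral_sub (integrable_left φ hu.2.1).integrableOn (integrable_left φ hv.2.1).integrableOn,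
    hu.2.2, hv.2.2]
  abel

/-- This is the fundamental lemma of the calculus of variations. It allows any known weak derivative
to replace the chosen representative `weakPartial`. -/
theorem HasWeakPartial.ae_eq [CompleteSpace F] {u g h : Plane → F} (hg : HasWeakPartial Ω α u g)
    (hh : HasWeakPartial Ω α u h) : g =ᵐ[volume.restrict (Ω : Set Plane)] h := by
  have h0 : ∀ᵐ x ∂volume, x ∈ (Ω : Set Plane) → (g x - h x) = 0 := by
    refine Ω.isOpen.ae_eq_zero_of_integral_contDiff_smul_eq_zero (hg.2.1.sub hh.2.1) ?_
    intro ρ hρ hc hs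
    let φ : 𝓓(Ω, ℝ) := ⟨ρ, hρ, hc, hs⟩
    have h1 := hg.2.2 φ
    rw [hh.2.2 φ] at h1
    change -∫ x in (Ω : Set Plane), ρ x • h x = -∫ x in (Ω : Set Plane), ρ x • g x at h1
    rw [setIntegral_smul_of_tsupport_subset hs, setIntegral_smul_of_tsupport_subset hs] at h1
    simp_rw [smul_sub]
    have h2 : ∫ x, ρ x • g x - ρ x • h x = _ :=
      integral_sub (integrable_left φ hg.2.1) (integrable_left φ hh.2.1)
    rw [h2]
    rw [neg_inj] at h1
    rw [sub_eq_zero]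
    exact h1.symm
  filter_upwards [(ae_restrict_iff' (measurableSet_opens Ω)).2 h0] with x hx
  exact sub_eq_zero.1 hx

theorem hasWeakPartial_weakPartial {u : Plane → F} (h : ∃ g, HasWeakPartial Ω α u g) :
    HasWeakPartial Ω α u (weakPartial Ω α u) := by
  rw [weakPartial, dif_pos h]
  exact h.choose_spec

theorem MemH1.hasWeakPartial {u : Plane → F} (hu : MemH1 Ω u) (α : Fin 2) :
    HasWeakPartial Ω α u (weakPartial Ω α u) :=
  hasWeakPartial_weakPartial ((hu.2 α).imp fun _ h => h.1)

theorem MemH1.memL2_weakPartial [CompleteSpace F] {u : Plane → F} (hu : MemH1 Ω u) (α : Fin 2) :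
    MemL2 Ω (weakPartial Ω α u) := by
  obtain ⟨g, hg, hg2⟩ := hu.2 α
  exact hg2.ae_eq (hg.ae_eq (hu.hasWeakPartial α))

theorem hasWeakPartial_of_contDiff {u : Plane → F} (hu : ContDiff ℝ 1 u) :
    HasWeakPartial Ω α u (partialD α u) := by
  have hc := continuous_partialD hu α
  refine ⟨hu.continuous.locallyIntegrable.locallyIntegrableOn _,
    hc.locallyIntegrable.locallyIntegrableOn _, fun φ => ?_⟩
  have hl1 := hu.continuous.locallyIntegrable (μ := volume).locallyIntegrableOn (Ω : Set Plane)
  have hl2 := hc.locallyIntegrable (μ := volume).locallyIntegrableOn (Ω : Set Plane)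
  rw [setIntegral_smul_of_tsupport_subset φ.tsupport_subset,
    setIntegral_smul_of_tsupport_subset
      ((tsupport_partialD_subset _ α).trans φ.tsupport_subset)]
  have := integral_smul_fderiv_eq_neg_fderiv_smul_of_integrable (μ := volume) (f := (φ : Plane → ℝ))
    (g := u) (v := basisVec α) (HasWeakPartial.integrable_partialD φ hl1 α)
    (HasWeakPartial.integrable_left φ hl2) (HasWeakPartial.integrable_left φ hl1)
    (fun x _ => (φ.contDiff.differentiable (by simp)) x)
    (fun x _ => (hu.differentiable one_ne_zero) x)
  simp only [partialD]
  rw [this, neg_neg]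

/-- Representatives are chosen for each function separately, so `weakPartial` is additive only
almost everywhere. -/
theorem weakPartial_sub_ae_eq [CompleteSpace F] {u v g h : Plane → F}
    (hu : HasWeakPartial Ω α u g) (hv : HasWeakPartial Ω α v h) :
    weakPartial Ω α (fun x => u x - v x) =ᵐ[volume.restrict (Ω : Set Plane)]
      fun x => g x - h x :=
  (hasWeakPartial_weakPartial ⟨_, hu.sub hv⟩).ae_eq (hu.sub hv)

end WeakDerivatives

/-! ### Smooth approximation inside Ω -/

section Mollification

set_option linter.unusedSectionVars false

variable {F : Type*} [NormedAddCommGroup F] [NormedSpace ℝ F] {Ω : Opens Plane}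

/-- The convolution of `u` with a normalized bump function. -/
noncomputable def mollify (φ : ContDiffBump (0 : Plane)) (u : Plane → F) : Plane → F :=
  φ.normed volume ⋆[ContinuousLinearMap.lsmul ℝ ℝ, volume] u

theorem contDiff_mollify (φ : ContDiffBump (0 : Plane)) {u : Plane → F}
    (hu : LocallyIntegrable u volume) : ContDiff ℝ ∞ (mollify φ u) :=
  φ.hasCompactSupport_normed.contDiff_convolution_left _ φ.contDiff_normed hu

theorem mollify_apply (φ : ContDiffBump (0 : Plane)) (u : Plane → F) (x : Plane) :
    mollify φ u x = ∫ t, φ.normed volume (x - t) • u t := by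
  rw [mollify, convolution_eq_swap]
  rfl

theorem contDiff_normed_one (φ : ContDiffBump (0 : Plane)) :
    ContDiff ℝ 1 (φ.normed (volume : Measure Plane)) := φ.contDiff_normed

/-- The derivative falls on the kernel, so no regularity of `u` is needed beyond local
integrability. -/
theorem partialD_mollify [CompleteSpace F] (φ : ContDiffBump (0 : Plane)) {u : Plane → F}
    (hu : LocallyIntegrable u volume) (α : Fin 2) (x : Plane) :
    partialD α (mollify φ u) x = ∫ t, partialD α (φ.normed volume) (x - t) • u t := by
  have h := φ.hasCompactSupport_normed.hasFDerivAt_convolution_left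
    (ContinuousLinearMap.lsmul ℝ ℝ) (contDiff_normed_one φ) hu x
  rw [partialD, mollify, h.fderiv, convolution_eq_swap]
  have hi : Integrable (fun t => ContinuousLinearMap.precompL Plane
      (ContinuousLinearMap.lsmul ℝ ℝ : ℝ →L[ℝ] F →L[ℝ] F)
      (fderiv ℝ (φ.normed volume) (x - t)) (u t)) volume := by
    have := (φ.hasCompactSupport_normed.fderiv ℝ).convolutionExists_left
      (ContinuousLinearMap.precompL Plane (ContinuousLinearMap.lsmul ℝ ℝ : ℝ →L[ℝ] F →L[ℝ] F))
      ((contDiff_normed_one φ).continuous_fderiv one_ne_zero) hu x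
    exact this.integrable_swap
  rw [ContinuousLinearMap.integral_apply hi]
  rfl

theorem partialD_mollify_right [CompleteSpace F] (φ : ContDiffBump (0 : Plane)) {u : Plane → F}
    (hc : HasCompactSupport u) (hu : ContDiff ℝ 1 u) (α : Fin 2) (x : Plane) :
    partialD α (mollify φ u) x = mollify φ (partialD α u) x := by
  have h := hc.hasFDerivAt_convolution_right
    (ContinuousLinearMap.lsmul ℝ ℝ)
    ((φ.continuous_normed (μ := volume)).locallyIntegrable (μ := volume)) hu x
  rw [partialD, mollify, h.fderiv]
  exact convolution_precompR_apply (μ := volume) _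
    ((φ.continuous_normed (μ := volume)).locallyIntegrable (μ := volume)) (hc.fderiv ℝ) (hu.continuous_fderiv one_ne_zero) _ _

theorem tsupport_mollify_subset (φ : ContDiffBump (0 : Plane)) {u : Plane → F}
    (hc : HasCompactSupport u) :
    tsupport (mollify φ u) ⊆ Metric.closedBall 0 φ.rOut + tsupport u := by
  have hcl : IsClosed (Metric.closedBall (0 : Plane) φ.rOut + tsupport u) :=
    ((isCompact_closedBall _ _).add hc).isClosed
  refine closure_minimal ((support_convolution_subset _).trans ?_) hcl
  refine add_subset_add ?_ (subset_tsupport _)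
  rw [φ.support_normed_eq]
  exact Metric.ball_subset_closedBall

/-- Away from the boundary, mollification commutes with weak differentiation. -/
theorem HasWeakPartial.partialD_mollify [CompleteSpace F] {α : Fin 2} {u g : Plane → F}
    (h : HasWeakPartial Ω α u g)
    (hu : LocallyIntegrable ((Ω : Set Plane).indicator u) volume)
    (φ : ContDiffBump (0 : Plane)) {x : Plane}
    (hx : Metric.closedBall x φ.rOut ⊆ Ω) :
    partialD α (mollify φ ((Ω : Set Plane).indicator u)) x
      = mollify φ ((Ω : Set Plane).indicator g) x := by
  have hsup : tsupport (fun t => φ.normed volume (x - t)) ⊆ Metric.closedBall x φ.rOut := by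
    refine closure_minimal (fun t ht => ?_) Metric.isClosed_closedBall
    have : x - t ∈ Function.support (φ.normed volume) := ht
    rw [φ.support_normed_eq] at this
    rw [Metric.mem_ball, dist_zero_right] at this
    rw [Metric.mem_closedBall, dist_eq_norm, norm_sub_rev]
    exact this.le
  have hsm : ContDiff ℝ ∞ fun t => φ.normed volume (x - t) :=
    φ.contDiff_normed.comp (contDiff_const.sub contDiff_id)
  -- The reflected kernel t ↦ ρ(x − t) is an admissible test function because its support lies in a
  -- ball contained in Ω. Its derivative in `t` has the opposite sign to that in `x`, which
  -- compensates the sign in the definition of the weak derivative.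
  let τ : 𝓓(Ω, ℝ) := ⟨fun t => φ.normed volume (x - t), hsm,
    (isCompact_closedBall x φ.rOut).of_isClosed_subset (isClosed_tsupport _) hsup,
    hsup.trans hx⟩
  have hτ : ∀ t, partialD α τ t = - partialD α (φ.normed volume) (x - t) := by
    intro t
    have h1 : HasFDerivAt (φ.normed (volume : Measure Plane))
        (fderiv ℝ (φ.normed volume) (x - t)) (x - t) :=
      ((contDiff_normed_one φ).differentiable one_ne_zero _).hasFDerivAt
    have h2 : HasFDerivAt (fun t : Plane => x - t) (-ContinuousLinearMap.id ℝ Plane) t :=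
      (hasFDerivAt_id t).const_sub x
    have h3 : HasFDerivAt (fun t => φ.normed (volume : Measure Plane) (x - t)) _ t := h1.comp t h2
    change fderiv ℝ (fun t => φ.normed (volume : Measure Plane) (x - t)) t (basisVec α) = _
    rw [h3.fderiv]
    simp [partialD]
  have key := h.2.2 τ
  simp_rw [hτ, neg_smul] at key
  rw [integral_neg, neg_inj] at key
  rw [Homog.partialD_mollify φ hu, mollify_apply]
  rw [← integral_indicator (measurableSet_opens Ω), ← integral_indicator (measurableSet_opens Ω)]
    at key
  simp_rw [indicator_smul] at key
  exact key

theorem MemL2.memLp_indicator {u : Plane → F} (hu : MemL2 Ω u) :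
    MemLp ((Ω : Set Plane).indicator u) 2 volume :=
  (memLp_indicator_iff_restrict (measurableSet_opens Ω)).2 hu

theorem eLpNorm_restrict_congr_indicator {K : Set Plane} (hK : MeasurableSet K)
    (hKΩ : K ⊆ Ω) (u v : Plane → F) :
    eLpNorm (fun x => u x - v x) 2 (volume.restrict K)
      = eLpNorm (fun x => v x - (Ω : Set Plane).indicator u x) 2 (volume.restrict K) := by
  rw [← eLpNorm_neg]
  refine eLpNorm_congr_ae ?_
  filter_upwards [ae_restrict_mem hK] with x hx
  simp [indicator_of_mem (hKΩ hx)]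

theorem exists_contDiffBump_lt {r : ℝ} (hr : 0 < r) :
    ∃ φ : ContDiffBump (0 : Plane), φ.rOut < r :=
  ⟨⟨r / 4, r / 2, by positivity, by linarith⟩, by simpa using hr⟩

/-- Local approximation of `H¹` functions by smooth functions. -/
theorem MemH1.exists_contDiff_approx [CompleteSpace F] {u : Plane → F} (hu : MemH1 Ω u)
    {K : Set Plane} (hK : IsCompact K) (hKΩ : K ⊆ Ω) {δ : ℝ≥0∞} (hδ : 0 < δ) :
    ∃ ψ : Plane → F, ContDiff ℝ ∞ ψ ∧
      eLpNorm (fun x => u x - ψ x) 2 (volume.restrict K) ≤ δ ∧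
      ∀ α, eLpNorm (fun x => weakPartial Ω α u x - partialD α ψ x) 2 (volume.restrict K) ≤ δ := by
  have hU := MemL2.memLp_indicator hu.1
  have hV := fun α => MemL2.memLp_indicator (hu.memL2_weakPartial α)
  obtain ⟨r₀, hr₀, h0⟩ := exists_eLpNorm_convolution_sub_le hU hδ
  choose r hr h using fun α => exists_eLpNorm_convolution_sub_le (hV α) hδ
  obtain ⟨s, hs, hsK⟩ := hK.exists_cthickening_subset_open Ω.isOpen hKΩ
  -- Radius below `s`: balls around points of `K` stay in Ω, so mollification commutes with the
  -- derivatives on `K`. Radius below the others: the mollifications of `u` and of its two weak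
  -- derivatives, extended by zero, are `δ`-close.
  obtain ⟨φ, hφ⟩ := exists_contDiffBump_lt (r := min (min r₀ s) (min (r 0) (r 1)))
    (by simp [hr₀, hs, hr])
  simp only [lt_min_iff] at hφ
  have hloc := hU.locallyIntegrable (by norm_num)
  refine ⟨mollify φ ((Ω : Set Plane).indicator u), contDiff_mollify φ hloc, ?_, fun α => ?_⟩
  · rw [eLpNorm_restrict_congr_indicator hK.measurableSet hKΩ]
    exact (eLpNorm_mono_measure _ Measure.restrict_le_self).trans (h0 φ hφ.1.1)
  · have hφα : φ.rOut < r α := by fin_cases α; exacts [hφ.2.1, hφ.2.2]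
    rw [eLpNorm_restrict_congr_indicator hK.measurableSet hKΩ]
    refine le_trans ?_ (h α φ hφα)
    refine le_trans (le_of_eq (eLpNorm_congr_ae ?_)) (eLpNorm_mono_measure _
      (Measure.restrict_le_self (s := K)))
    filter_upwards [ae_restrict_mem hK.measurableSet] with x hx
    rw [(hu.hasWeakPartial α).partialD_mollify hloc φ]
    · rfl
    · refine subset_trans ?_ hsK
      exact (Metric.closedBall_subset_closedBall hφ.1.2.le).trans
        (Metric.closedBall_subset_cthickening hx s)

/-- Approximation of compactly supported `C¹` functions by test functions. -/
theorem exists_testFunction_approx [CompleteSpace F] {u : Plane → F} (hu : ContDiff ℝ 1 u)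
    (hc : HasCompactSupport u) (hs : tsupport u ⊆ Ω) {δ : ℝ≥0∞} (hδ : 0 < δ) :
    ∃ ψ : 𝓓(Ω, F), ∀ α, eLpNorm (fun x => partialD α ψ x - partialD α u x) 2 volume ≤ δ := by
  have hV : ∀ α, MemLp (partialD α u) 2 volume := fun α =>
    (continuous_partialD hu α).memLp_of_hasCompactSupport (hasCompactSupport_partialD hc α)
  choose r hr h using fun α => exists_eLpNorm_convolution_sub_le (hV α) hδ
  obtain ⟨s, hs', hsK⟩ := IsCompact.exists_cthickening_subset_open hc Ω.isOpen hs
  obtain ⟨φ, hφ⟩ := exists_contDiffBump_lt (r := min s (min (r 0) (r 1)))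
    (by simp [hs', hr])
  simp only [lt_min_iff] at hφ
  have hsub : tsupport (mollify φ u) ⊆ Ω := by
    refine (tsupport_mollify_subset φ hc).trans (subset_trans ?_ hsK)
    rintro _ ⟨a, ha, b, hb, rfl⟩
    refine Metric.closedBall_subset_cthickening hb s ?_
    simp only [Metric.mem_closedBall, dist_zero_right] at ha ⊢
    rw [dist_eq_norm, add_sub_cancel_right]
    exact ha.trans hφ.1.le
  refine ⟨⟨mollify φ u, contDiff_mollify φ hu.continuous.locallyIntegrable,
    φ.hasCompactSupport_normed.convolution _ hc, hsub⟩, fun α => ?_⟩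
  have hφα : φ.rOut < r α := by fin_cases α; exacts [hφ.2.1, hφ.2.2]
  refine le_of_eq_of_le ?_ (h α φ hφα)
  congr 1
  ext x
  change partialD α (mollify φ u) x - _ = _
  rw [partialD_mollify_right φ hc hu]
  rfl

end Mollification

/-! ### Sets that are thin in one direction -/

section Layer

variable {F : Type*} [NormedAddCommGroup F] [NormedSpace ℝ F] {Ω : Opens Plane}

theorem ennreal_add_sq_le (a b : ℝ≥0∞) : (a + b) ^ 2 ≤ 2 * a ^ 2 + 2 * b ^ 2 := by
  have h := ENNReal.rpow_add_le_mul_rpow_add_rpow a b (p := 2) (by norm_num)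
  norm_num [mul_add] at h
  exact h

theorem sq_setLIntegral_Icc_le {h : ℝ} {g : ℝ → ℝ≥0∞} (hg : Measurable g) :
    (∫⁻ s in Icc 0 h, g s) ^ 2 ≤ ENNReal.ofReal h * ∫⁻ s in Icc 0 h, g s ^ 2 := by
  have hq := ENNReal.lintegral_mul_le_Lp_mul_Lq (volume.restrict (Icc 0 h))
    Real.HolderConjugate.two_two (f := fun _ => 1) (g := g) aemeasurable_const hg.aemeasurable
  simp only [Pi.mul_apply, one_mul, ENNReal.one_rpow, lintegral_const, MeasurableSet.univ,
    Measure.restrict_apply, univ_inter, Real.volume_Icc, sub_zero] at hq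
  calc _ ≤ (ENNReal.ofReal h ^ (1 / 2 : ℝ) * (∫⁻ s in Icc 0 h, g s ^ (2 : ℝ)) ^ (1 / 2 : ℝ)) ^ 2 := by
        gcongr
    _ = _ := by
        rw [mul_pow, ← ENNReal.rpow_natCast, ← ENNReal.rpow_mul, ← ENNReal.rpow_natCast,
          ← ENNReal.rpow_mul]
        norm_num

/-- After Tonelli and the substitution y = x + s n, each `y` is counted with the length of the set
of `s` for which y − s n lies in `S`. The thinness of `S` in the direction `n` enters the whole
argument only here, through `m`. -/
theorem lintegral_translates_le {S K : Set Plane} (hS : MeasurableSet S) (hK : MeasurableSet K)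
    {n : Plane} {h : ℝ} {m : ℝ≥0∞} (hSK : ∀ x ∈ S, ∀ s ∈ Icc 0 h, x + s • n ∈ K)
    (hm : ∀ y, volume {s ∈ Icc 0 h | y - s • n ∈ S} ≤ m) {g : Plane → ℝ≥0∞} (hg : Measurable g) :
    ∫⁻ x in S, ∫⁻ s in Icc 0 h, g (x + s • n) ≤ m * ∫⁻ y in K, g y := by
  have hmeas : Measurable fun z : Plane × ℝ => S.indicator (fun _ => (1 : ℝ≥0∞)) z.1 * g (z.1 + z.2 • n) :=
    ((measurable_const.indicator hS).comp measurable_fst).mul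
      (hg.comp (measurable_fst.add (measurable_snd.smul_const n)))
  have e1 : ∫⁻ x in S, ∫⁻ s in Icc 0 h, g (x + s • n)
      = ∫⁻ x, ∫⁻ s in Icc 0 h, S.indicator (fun _ => (1 : ℝ≥0∞)) x * g (x + s • n) := by
    rw [← lintegral_indicator hS]
    refine lintegral_congr fun x => ?_
    by_cases hx : x ∈ S <;> simp [hx]
  have e2 : ∀ s : ℝ, ∫⁻ x, S.indicator (fun _ => (1 : ℝ≥0∞)) x * g (x + s • n)
      = ∫⁻ y, S.indicator (fun _ => (1 : ℝ≥0∞)) (y - s • n) * g y := by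
    intro s
    rw [← lintegral_sub_right_eq_self (μ := volume)
      (fun x => S.indicator (fun _ => (1 : ℝ≥0∞)) x * g (x + s • n)) (s • n)]
    simp
  have hmeas' : Measurable fun z : ℝ × Plane =>
      S.indicator (fun _ => (1 : ℝ≥0∞)) (z.2 - z.1 • n) * g z.2 :=
    ((measurable_const.indicator hS).comp
      (measurable_snd.sub (measurable_fst.smul_const n))).mul (hg.comp measurable_snd)
  rw [e1, lintegral_lintegral_swap hmeas.aemeasurable]
  simp_rw [e2]
  rw [lintegral_lintegral_swap hmeas'.aemeasurable, ← lintegral_const_mul _ hg,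
    ← lintegral_indicator hK]
  refine lintegral_mono fun y => ?_
  have hind : (fun s : ℝ => S.indicator (fun _ => (1 : ℝ≥0∞)) (y - s • n))
      = {s : ℝ | y - s • n ∈ S}.indicator (fun _ => (1 : ℝ≥0∞)) := by
    ext s; simp [indicator]
  have hms : MeasurableSet {s : ℝ | y - s • n ∈ S} :=
    (measurable_const.sub (measurable_id.smul_const n)) hS
  by_cases hy : y ∈ K
  · rw [indicator_of_mem hy, lintegral_mul_const _ (by rw [hind]; exact measurable_const.indicator hms),
      hind, lintegral_indicator hms]
    gcongr
    simp only [lintegral_const, one_mul, MeasurableSet.univ, Measure.restrict_apply, univ_inter]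
    rw [Measure.restrict_apply hms]
    refine le_trans (measure_mono ?_) (hm y)
    exact fun s hs => ⟨hs.2, hs.1⟩
  · rw [indicator_of_notMem hy, nonpos_iff_eq_zero]
    rw [setLIntegral_congr_fun (g := fun _ => 0) measurableSet_Icc]
    · simp
    · intro s hs
      have : y - s • n ∉ S := fun hc => hy (by simpa using hSK _ hc s hs)
      simp [this]

theorem enorm_le_enorm_add_setLIntegral [CompleteSpace F] {ψ : Plane → F} (hψ : ContDiff ℝ 1 ψ)
    (x n : Plane) {h t : ℝ} (ht : t ∈ Icc 0 h) :
    ‖ψ x‖ₑ ≤ ‖ψ (x + t • n)‖ₑ + ∫⁻ s in Icc 0 h, ‖fderiv ℝ ψ (x + s • n) n‖ₑ := by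
  have hd : ∀ s : ℝ, HasDerivAt (fun s : ℝ => ψ (x + s • n)) (fderiv ℝ ψ (x + s • n) n) s := by
    intro s
    have h1 : HasDerivAt (fun s : ℝ => x + s • n) n s := by
      simpa using ((hasDerivAt_id s).smul_const n).const_add x
    exact ((hψ.differentiable one_ne_zero _).hasFDerivAt).comp_hasDerivAt s h1
  have hc : Continuous fun s : ℝ => fderiv ℝ ψ (x + s • n) n :=
    ((hψ.continuous_fderiv one_ne_zero).comp (by fun_prop)).clm_apply continuous_const
  have hftc := intervalIntegral.integral_eq_sub_of_hasDerivAt (fun s _ => hd s)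
    (hc.intervalIntegrable 0 t)
  have e : ψ x = ψ (x + t • n) - ∫ s in (0 : ℝ)..t, fderiv ℝ ψ (x + s • n) n := by
    rw [hftc]; simp
  rw [e]
  refine (enorm_sub_le).trans ?_
  gcongr
  rw [intervalIntegral.integral_of_le ht.1]
  refine (enorm_integral_le_lintegral_enorm _).trans (lintegral_mono_set ?_)
  exact fun s hs => ⟨hs.1.le, hs.2.trans ht.2⟩

/-- The fundamental theorem of calculus bounds ψ(x) by ψ(x + t n) plus the integral of the
derivative along the segment. Squaring costs the factors 2, averaging over `t` in [0, h] gives 1/h,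
and Cauchy–Schwarz on the derivative term gives `h`. -/
theorem sq_enorm_le_lintegral [CompleteSpace F] {ψ : Plane → F} (hψ : ContDiff ℝ 1 ψ)
    (x n : Plane) {h : ℝ} (hh : 0 < h) :
    ‖ψ x‖ₑ ^ 2 ≤ ENNReal.ofReal (2 / h) * (∫⁻ s in Icc 0 h, ‖ψ (x + s • n)‖ₑ ^ 2)
      + ENNReal.ofReal (2 * h) * ∫⁻ s in Icc 0 h, ‖fderiv ℝ ψ (x + s • n) n‖ₑ ^ 2 := by
  have hc : Continuous fun s : ℝ => fderiv ℝ ψ (x + s • n) n :=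
    ((hψ.continuous_fderiv one_ne_zero).comp (by fun_prop)).clm_apply continuous_const
  have hc0 : Continuous fun s : ℝ => ψ (x + s • n) := hψ.continuous.comp (by fun_prop)
  set D := ∫⁻ s in Icc 0 h, ‖fderiv ℝ ψ (x + s • n) n‖ₑ with hD
  have hDle : D ^ 2 ≤ ENNReal.ofReal h * ∫⁻ s in Icc 0 h, ‖fderiv ℝ ψ (x + s • n) n‖ₑ ^ 2 :=
    sq_setLIntegral_Icc_le hc.enorm.measurable
  have h1 : ∀ t ∈ Icc 0 h, ‖ψ x‖ₑ ^ 2 ≤ 2 * ‖ψ (x + t • n)‖ₑ ^ 2 + 2 * D ^ 2 := fun t ht =>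
    (pow_le_pow_left' (enorm_le_enorm_add_setLIntegral hψ x n ht) 2).trans (ennreal_add_sq_le _ _)
  have h2 : ∫⁻ t in Icc 0 h, ‖ψ x‖ₑ ^ 2
      ≤ ∫⁻ t in Icc 0 h, (2 * ‖ψ (x + t • n)‖ₑ ^ 2 + 2 * D ^ 2) :=
    setLIntegral_mono' measurableSet_Icc h1
  rw [lintegral_add_right _ measurable_const, lintegral_const_mul _ (hc0.enorm.measurable.pow_const 2)]
    at h2
  simp only [lintegral_const, MeasurableSet.univ, Measure.restrict_apply, univ_inter,
    Real.volume_Icc, sub_zero] at h2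
  have hh0 : ENNReal.ofReal h ≠ 0 := by simpa using hh
  have hh1 : ENNReal.ofReal h ≠ ⊤ := ENNReal.ofReal_ne_top
  have h3 := mul_le_mul_left h2 (ENNReal.ofReal h)⁻¹
  rw [mul_assoc, ENNReal.mul_inv_cancel hh0 hh1, mul_one, add_mul, mul_assoc (2 * D ^ 2),
    ENNReal.mul_inv_cancel hh0 hh1, mul_one] at h3
  refine h3.trans (add_le_add ?_ ?_)
  · rw [ENNReal.ofReal_div_of_pos hh, div_eq_mul_inv, ENNReal.ofReal_ofNat]
    exact le_of_eq (by ring)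
  · rw [ENNReal.ofReal_mul (by norm_num), ENNReal.ofReal_ofNat, mul_assoc]
    gcongr

/-- Integrating the pointwise bound over `S` and using `lintegral_translates_le` on both terms gains
the width `m` while `h` stays of order one. -/
theorem eLpNorm_sq_le_of_translates [CompleteSpace F] {S K : Set Plane} (hS : MeasurableSet S)
    (hK : MeasurableSet K)
    {n : Plane} {h : ℝ} (hh : 0 < h) {m : ℝ≥0∞} (hSK : ∀ x ∈ S, ∀ s ∈ Icc 0 h, x + s • n ∈ K)
    (hm : ∀ y, volume {s ∈ Icc 0 h | y - s • n ∈ S} ≤ m) {ψ : Plane → F} (hψ : ContDiff ℝ 1 ψ) :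
    eLpNorm ψ 2 (volume.restrict S) ^ 2
      ≤ m * (ENNReal.ofReal (2 / h) * eLpNorm ψ 2 (volume.restrict K) ^ 2
        + ENNReal.ofReal (2 * h) * eLpNorm (fun x => fderiv ℝ ψ x n) 2 (volume.restrict K) ^ 2) := by
  have hc : Continuous fun x => fderiv ℝ ψ x n :=
    (hψ.continuous_fderiv one_ne_zero).clm_apply continuous_const
  have m1 : Measurable fun x => ‖ψ x‖ₑ ^ 2 := hψ.continuous.enorm.measurable.pow_const 2
  have m2 : Measurable fun x => ‖fderiv ℝ ψ x n‖ₑ ^ 2 := hc.enorm.measurable.pow_const 2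
  have mm : ∀ {g : Plane → ℝ≥0∞}, Measurable g →
      Measurable fun x => ∫⁻ s in Icc 0 h, g (x + s • n) := fun {g} hg =>
    Measurable.lintegral_prod_right' (f := fun z : Plane × ℝ => g (z.1 + z.2 • n))
      (hg.comp (measurable_fst.add (measurable_snd.smul_const n)))
  simp_rw [eLpNorm_two_sq]
  calc _ ≤ ∫⁻ x in S, (ENNReal.ofReal (2 / h) * (∫⁻ s in Icc 0 h, ‖ψ (x + s • n)‖ₑ ^ 2)
      + ENNReal.ofReal (2 * h) * ∫⁻ s in Icc 0 h, ‖fderiv ℝ ψ (x + s • n) n‖ₑ ^ 2) :=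
        lintegral_mono fun x => sq_enorm_le_lintegral hψ x n hh
    _ = ENNReal.ofReal (2 / h) * (∫⁻ x in S, ∫⁻ s in Icc 0 h, ‖ψ (x + s • n)‖ₑ ^ 2)
      + ENNReal.ofReal (2 * h) *
        ∫⁻ x in S, ∫⁻ s in Icc 0 h, ‖fderiv ℝ ψ (x + s • n) n‖ₑ ^ 2 := by
        rw [lintegral_add_left ((mm m1).const_mul _), lintegral_const_mul _ (mm m1),
          lintegral_const_mul _ (mm m2)]
    _ ≤ ENNReal.ofReal (2 / h) * (m * ∫⁻ y in K, ‖ψ y‖ₑ ^ 2)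
      + ENNReal.ofReal (2 * h) * (m * ∫⁻ y in K, ‖fderiv ℝ ψ y n‖ₑ ^ 2) := by
        gcongr
        · exact lintegral_translates_le hS hK hSK hm m1
        · exact lintegral_translates_le hS hK hSK hm m2
    _ = _ := by ring

end Layer

/-! ### The boundary layer of a Lipschitz domain -/

section BoundaryLayer

set_option linter.unusedSectionVars false

variable {F : Type*} [NormedAddCommGroup F] [NormedSpace ℝ F] {Ω : Opens Plane}

/-- Since c a² + d b² ≤ (c + d)(a + b)², it suffices to take square roots. -/
theorem ennreal_add_le_of_sq {a b c d x : ℝ≥0∞} (m : ℝ≥0∞)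
    (h : x ^ 2 ≤ m * (c * a ^ 2 + d * b ^ 2)) :
    x ≤ (m * (c + d)) ^ (1 / 2 : ℝ) * (a + b) := by
  have h1 : x ^ 2 ≤ ((m * (c + d)) ^ (1 / 2 : ℝ) * (a + b)) ^ 2 := by
    rw [mul_pow, ← ENNReal.rpow_natCast (_ ^ _), ← ENNReal.rpow_mul]
    norm_num
    refine h.trans ?_
    rw [mul_assoc, add_mul]
    gcongr
    · exact le_self_add
    · exact le_add_self
  exact (ENNReal.pow_le_pow_left_iff two_ne_zero).1 h1

theorem fderiv_apply_eq_sum (f : Plane → F) (x n : Plane) :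
    fderiv ℝ f x n = ∑ α, n α • partialD α f x := by
  have : n = ∑ α, n α • basisVec α := by
    ext i
    fin_cases i <;> simp [basisVec]
  conv_lhs => rw [this]
  simp [partialD]

theorem eLpNorm_fderiv_apply_le {ψ : Plane → F} (hψ : ContDiff ℝ 1 ψ) {n : Plane} (hn : ‖n‖ ≤ 1)
    (μ : Measure Plane) :
    eLpNorm (fun x => fderiv ℝ ψ x n) 2 μ ≤ ∑ α, eLpNorm (partialD α ψ) 2 μ := by
  have e : (fun x => fderiv ℝ ψ x n) = ∑ α, fun x => n α • partialD α ψ x := by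
    ext x
    rw [fderiv_apply_eq_sum, Finset.sum_apply]
  rw [e]
  refine (eLpNorm_sum_le (fun α _ => ?_) (by norm_num)).trans (Finset.sum_le_sum fun α _ => ?_)
  · exact ((continuous_partialD hψ α).const_smul _).aestronglyMeasurable
  · refine eLpNorm_mono fun x => ?_
    rw [norm_smul]
    exact mul_le_of_le_one_left (norm_nonneg _) ((PiLp.norm_apply_le n α).trans hn)

/-- The `H¹` size, as the sum of the `L²` norms of the function and its weak derivatives. -/
noncomputable def h1Sum (Ω : Opens Plane) (u : Plane → F) : ℝ≥0∞ :=
  eLpNorm u 2 (volume.restrict (Ω : Set Plane))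
    + ∑ α, eLpNorm (weakPartial Ω α u) 2 (volume.restrict (Ω : Set Plane))

theorem MemH1.h1Sum_ne_top [CompleteSpace F] {u : Plane → F} (hu : MemH1 Ω u) :
    h1Sum Ω u ≠ ⊤ :=
  ENNReal.add_ne_top.2 ⟨hu.1.2.ne,
    ENNReal.sum_ne_top.2 fun α _ => (hu.memL2_weakPartial α).2.ne⟩

theorem aestronglyMeasurable_restrict_of_subset {K : Set Plane} (hK : K ⊆ Ω) {u : Plane → F}
    (hu : MemL2 Ω u) : AEStronglyMeasurable u (volume.restrict K) :=
  hu.1.mono_measure (Measure.restrict_mono hK le_rfl)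

/-- The bound for smooth functions passes to H¹ by approximation on the compact set `K`, where
mollification is available. The constant does not depend on the approximation, so the error can be
sent to zero. -/
theorem MemH1.eLpNorm_le_of_translates [CompleteSpace F] {u : Plane → F} (hu : MemH1 Ω u)
    {S K : Set Plane} (hS : MeasurableSet S) (hK : IsCompact K) (hKΩ : K ⊆ Ω)
    {n : Plane} (hn : ‖n‖ ≤ 1) {h : ℝ} (hh : 0 < h) {m : ℝ≥0∞} (hmt : m ≠ ⊤)
    (hSK : ∀ x ∈ S, ∀ s ∈ Icc 0 h, x + s • n ∈ K)
    (hm : ∀ y, volume {s ∈ Icc 0 h | y - s • n ∈ S} ≤ m) :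
    eLpNorm u 2 (volume.restrict S)
      ≤ (m * (ENNReal.ofReal (2 / h) + ENNReal.ofReal (2 * h))) ^ (1 / 2 : ℝ) * h1Sum Ω u := by
  set D := (m * (ENNReal.ofReal (2 / h) + ENNReal.ofReal (2 * h))) ^ (1 / 2 : ℝ) with hD
  have hDt : D ≠ ⊤ := by
    refine ENNReal.rpow_ne_top_of_nonneg (by norm_num) (ENNReal.mul_ne_top hmt ?_)
    exact ENNReal.add_ne_top.2 ⟨ENNReal.ofReal_ne_top, ENNReal.ofReal_ne_top⟩
  have hSsub : S ⊆ K := fun x hx => by simpa using hSK x hx 0 ⟨le_rfl, hh.le⟩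
  have key : ∀ δ : ℝ≥0∞, 0 < δ → eLpNorm u 2 (volume.restrict S)
      ≤ D * h1Sum Ω u + (3 * D + 1) * δ := by
    intro δ hδ
    obtain ⟨ψ, hψ, h0, h1⟩ := hu.exists_contDiff_approx hK hKΩ hδ
    have hψ1 : ContDiff ℝ 1 ψ := hψ.of_le (by simp)
    have hmS : AEStronglyMeasurable ψ (volume.restrict S) := hψ1.continuous.aestronglyMeasurable
    have hmK : AEStronglyMeasurable ψ (volume.restrict K) := hψ1.continuous.aestronglyMeasurable
    have muK := aestronglyMeasurable_restrict_of_subset hKΩ hu.1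
    have b1 : eLpNorm u 2 (volume.restrict S) ≤ δ + eLpNorm ψ 2 (volume.restrict S) := by
      have : u = fun x => (u x - ψ x) + ψ x := by ext; simp
      conv_lhs => rw [this]
      refine (eLpNorm_add_le ((muK.mono_measure (Measure.restrict_mono hSsub le_rfl)).sub hmS) hmS
        (by norm_num)).trans ?_
      gcongr
      exact (eLpNorm_mono_measure _ (Measure.restrict_mono hSsub le_rfl)).trans h0
    have b2 : eLpNorm ψ 2 (volume.restrict K) ≤ δ + eLpNorm u 2 (volume.restrict (Ω : Set Plane)) := by
      have : ψ = fun x => u x - (u x - ψ x) := by ext; simp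
      conv_lhs => rw [this]
      refine (eLpNorm_sub_le muK (muK.sub hmK) (by norm_num)).trans ?_
      rw [add_comm]
      exact add_le_add h0 (eLpNorm_mono_measure _ (Measure.restrict_mono hKΩ le_rfl))
    have b3 : ∀ α, eLpNorm (partialD α ψ) 2 (volume.restrict K)
        ≤ δ + eLpNorm (weakPartial Ω α u) 2 (volume.restrict (Ω : Set Plane)) := by
      intro α
      have mv := aestronglyMeasurable_restrict_of_subset hKΩ (hu.memL2_weakPartial α)
      have mp : AEStronglyMeasurable (partialD α ψ) (volume.restrict K) :=
        (continuous_partialD hψ1 α).aestronglyMeasurable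
      have : partialD α ψ = fun x => weakPartial Ω α u x - (weakPartial Ω α u x - partialD α ψ x) := by
        ext; simp
      conv_lhs => rw [this]
      refine (eLpNorm_sub_le mv (mv.sub mp) (by norm_num)).trans ?_
      rw [add_comm]
      exact add_le_add (h1 α) (eLpNorm_mono_measure _ (Measure.restrict_mono hKΩ le_rfl))
    have b4 := ennreal_add_le_of_sq m
      (eLpNorm_sq_le_of_translates hS hK.measurableSet hh hSK hm hψ1)
    calc _ ≤ δ + D * (eLpNorm ψ 2 (volume.restrict K)
          + eLpNorm (fun x => fderiv ℝ ψ x n) 2 (volume.restrict K)) := b1.trans (by gcongr)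
      _ ≤ δ + D * ((δ + eLpNorm u 2 (volume.restrict (Ω : Set Plane)))
          + ∑ α, (δ + eLpNorm (weakPartial Ω α u) 2 (volume.restrict (Ω : Set Plane)))) := by
        gcongr
        exact (eLpNorm_fderiv_apply_le hψ1 hn _).trans (Finset.sum_le_sum fun α _ => b3 α)
      _ = _ := by
        rw [h1Sum, Finset.sum_add_distrib]
        simp
        ring
  have hE : (3 * D + 1) ≠ ⊤ :=
    ENNReal.add_ne_top.2 ⟨ENNReal.mul_ne_top (by norm_num) hDt, by norm_num⟩
  have hE0 : (3 * D + 1) ≠ 0 := by simp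
  refine ENNReal.le_of_forall_pos_le_add fun e he _ => ?_
  -- One δ comes from replacing `u` by ψ on `S`, and 3Dδ from ψ and its two partial derivatives on
  -- `K`.
  have := key (e / (3 * D + 1)) (ENNReal.div_pos (by simpa using he.ne') hE)
  rwa [ENNReal.mul_div_cancel hE0 hE] at this

/-- Monotone convergence. It reaches the whole boundary layer, which lies in no compact subset of Ω,
from pieces that do. -/
theorem eLpNorm_restrict_le_of_iUnion {S : Set Plane} {T : ℕ → Set Plane} (hT : Monotone T)
    (hST : S ⊆ ⋃ k, T k) {u : Plane → F} {B : ℝ≥0∞}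
    (h : ∀ k, eLpNorm u 2 (volume.restrict (T k)) ≤ B) :
    eLpNorm u 2 (volume.restrict S) ≤ B := by
  refine (ENNReal.pow_le_pow_left_iff two_ne_zero).1 ?_
  refine (pow_le_pow_left' (eLpNorm_mono_measure _ (Measure.restrict_mono hST le_rfl)) 2).trans ?_
  rw [eLpNorm_two_sq, setLIntegral_iUnion_of_directed _ hT.directed_le]
  refine iSup_le fun k => ?_
  rw [← eLpNorm_two_sq]
  exact pow_le_pow_left' (h k) 2

theorem eLpNorm_restrict_union_le (u : Plane → F) (S T : Set Plane) :
    eLpNorm u 2 (volume.restrict (S ∪ T))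
      ≤ eLpNorm u 2 (volume.restrict S) + eLpNorm u 2 (volume.restrict T) := by
  refine (ENNReal.pow_le_pow_left_iff two_ne_zero).1 ?_
  rw [add_sq', eLpNorm_two_sq, eLpNorm_two_sq, eLpNorm_two_sq]
  exact (lintegral_union_le _ _ _).trans le_self_add

/-- The part of `Ω` at distance less than `δ` from the complement. -/
def boundaryLayer (Ω : Opens Plane) (δ : ℝ) : Set Plane :=
  {x | x ∈ Ω ∧ Metric.infDist x (Ω : Set Plane)ᶜ < δ}

theorem boundaryLayer_subset (Ω : Opens Plane) (δ : ℝ) : boundaryLayer Ω δ ⊆ Ω := fun _ h => h.1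

theorem measurableSet_boundaryLayer (Ω : Opens Plane) (δ : ℝ) :
    MeasurableSet (boundaryLayer Ω δ) :=
  (measurableSet_opens Ω).inter
    (measurableSet_lt (Metric.continuous_infDist_pt _).measurable measurable_const)

/-- Let the height of a point be its vertical distance to the graph. Moving along the vertical
direction `n` of the chart increases the height, hence stays in Ω, while points of the layer have
height less than (L + 1)δ. So every vertical line meets the layer in length at most (L + 1)δ, and
the square root of this length is the gain. -/
theorem exists_eLpNorm_ball_inter_boundaryLayer_le [CompleteSpace F]
    (hb : Bornology.IsBounded (Ω : Set Plane))
    {x₀ : Plane} {e : Plane ≃ₗᵢ[ℝ] Plane} {γ : ℝ → ℝ} {L : ℝ≥0} {r : ℝ}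
    (hγ : LipschitzWith L γ) (hr : 0 < r)
    (hchart : ∀ y ∈ Metric.ball x₀ r, (y ∈ (Ω : Set Plane) ↔ γ (e y 0) < e y 1)) :
    ∃ C : ℝ≥0, ∀ u : Plane → F, MemH1 Ω u → ∀ δ : ℝ, 0 < δ → δ ≤ r / 2 →
      eLpNorm u 2 (volume.restrict (boundaryLayer Ω δ ∩ Metric.ball x₀ (r / 4)))
        ≤ C * ENNReal.ofReal δ ^ (1 / 2 : ℝ) * h1Sum Ω u := by
  -- With a quarter of the radius, a point of the small ball moved up by at most `h` stays in the
  -- chart; so does its nearest boundary point, because `δ ≤ r / 2`.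
  set h : ℝ := r / 4 with hh
  have hh0 : 0 < h := by positivity
  set n : Plane := e.symm (EuclideanSpace.single 1 1) with hn
  have hn1 : ‖n‖ = 1 := by simp [hn]
  have he0 : ∀ (x : Plane) (s : ℝ), e (x + s • n) 0 = e x 0 := by intro x s; simp [hn]
  have he1 : ∀ (x : Plane) (s : ℝ), e (x + s • n) 1 = e x 1 + s := by intro x s; simp [hn]
  have hcoord : ∀ (x z : Plane) (i : Fin 2), |e x i - e z i| ≤ dist x z := by
    intro x z i
    have := PiLp.norm_apply_le (e x - e z) i
    rwa [← map_sub, e.norm_map, map_sub, ← dist_eq_norm] at this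
  have hne : (Ω : Set Plane) ≠ univ := fun hc => by
    rw [hc] at hb
    exact NormedSpace.unbounded_univ ℝ Plane hb
  have hnec : ((Ω : Set Plane)ᶜ).Nonempty := nonempty_compl.2 hne
  set D : ℝ≥0∞ := (ENNReal.ofReal (L + 1) * (ENNReal.ofReal (2 / h) + ENNReal.ofReal (2 * h)))
    ^ (1 / 2 : ℝ) with hD
  have hDt : D ≠ ⊤ := by
    refine ENNReal.rpow_ne_top_of_nonneg (by norm_num)
      (ENNReal.mul_ne_top ENNReal.ofReal_ne_top ?_)
    exact ENNReal.add_ne_top.2 ⟨ENNReal.ofReal_ne_top, ENNReal.ofReal_ne_top⟩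
  refine ⟨D.toNNReal, fun u hu δ hδ hδr => ?_⟩
  rw [ENNReal.coe_toNNReal hDt]
  set S := boundaryLayer Ω δ ∩ Metric.ball x₀ h
  have hSM : MeasurableSet S := (measurableSet_boundaryLayer Ω δ).inter measurableSet_ball
  have hball : ∀ x ∈ Metric.closedBall x₀ h, ∀ s ∈ Icc 0 h, x + s • n ∈ Metric.ball x₀ r := by
    intro x hx s hs
    rw [Metric.mem_closedBall, dist_eq_norm] at hx
    rw [Metric.mem_ball, dist_eq_norm]
    calc ‖x + s • n - x₀‖ = ‖(x - x₀) + s • n‖ := by congr 1; abel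
      _ ≤ ‖x - x₀‖ + ‖s • n‖ := norm_add_le _ _
      _ ≤ h + h := by
        gcongr
        rw [norm_smul, hn1, mul_one, Real.norm_of_nonneg hs.1]; exact hs.2
      _ < r := by rw [hh]; linarith
  -- The nearest boundary point `z` is at distance less than δ and has height at most zero, being
  -- outside Ω. The height is (L + 1)-Lipschitz, as the coordinates of the chart are 1-Lipschitz.
  have hheight : ∀ x ∈ S, 0 < e x 1 - γ (e x 0) ∧ e x 1 - γ (e x 0) < (L + 1) * δ := by
    intro x hx
    obtain ⟨⟨hxΩ, hxδ⟩, hxb⟩ := hx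
    have hxr : x ∈ Metric.ball x₀ r := Metric.ball_subset_ball (by rw [hh]; linarith) hxb
    refine ⟨sub_pos.2 ((hchart x hxr).1 hxΩ), ?_⟩
    obtain ⟨z, hz, hzd⟩ := exists_mem_frontier_infDist_compl_eq_dist (s := (Ω : Set Plane)) hxΩ hne
    rw [hzd] at hxδ
    have hzr : z ∈ Metric.ball x₀ r := by
      rw [Metric.mem_ball] at hxb ⊢
      calc dist z x₀ ≤ dist z x + dist x x₀ := dist_triangle _ _ _
        _ < r / 2 + h := by rw [dist_comm z x]; linarith
        _ ≤ r := by rw [hh]; linarith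
    have hzΩ : z ∉ (Ω : Set Plane) := by
      rw [Ω.isOpen.frontier_eq] at hz
      exact hz.2
    have hzγ : e z 1 ≤ γ (e z 0) := not_lt.1 fun hc => hzΩ ((hchart z hzr).2 hc)
    have hL := hγ.dist_le_mul (e z 0) (e x 0)
    rw [Real.dist_eq, Real.dist_eq, abs_sub_comm (e z 0)] at hL
    have h0 := hcoord x z 0
    have h1 := (abs_le.1 (hcoord x z 1)).2
    have h2 := (abs_le.1 hL).2
    have h3 : (L : ℝ) * |e x 0 - e z 0| ≤ L * dist x z := by gcongr
    have h4 : (L + 1 : ℝ) * dist x z < (L + 1) * δ := by gcongr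
    linarith
  -- If `a` is the height of `y`, then y − s n has height a − s, which must lie between 0 and (L +
  -- 1)δ.
  have hmeas : ∀ y, volume {s ∈ Icc 0 h | y - s • n ∈ S} ≤ ENNReal.ofReal ((L + 1) * δ) := by
    intro y
    set a := e y 1 - γ (e y 0)
    have : {s ∈ Icc 0 h | y - s • n ∈ S} ⊆ Icc (a - (L + 1) * δ) a := by
      rintro s ⟨-, hs⟩
      have := hheight _ hs
      have e0 := he0 y (-s)
      have e1 := he1 y (-s)
      rw [neg_smul, ← sub_eq_add_neg] at e0 e1
      rw [e0, e1] at this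
      constructor <;> simp only [a] <;> linarith
    refine (measure_mono this).trans ?_
    rw [Real.volume_Icc]
    apply le_of_eq; congr 1; ring
  -- `S` may reach ∂Ω; its points at distance at least 1/(k + 1) from the complement do not.
  set T : ℕ → Set Plane := fun k =>
    S ∩ {x | 1 / ((k : ℝ) + 1) ≤ Metric.infDist x (Ω : Set Plane)ᶜ} with hT
  have hcl : ∀ c : ℝ, IsClosed {x | c ≤ Metric.infDist x (Ω : Set Plane)ᶜ} := fun c =>
    isClosed_le continuous_const (Metric.continuous_infDist_pt _)
  refine eLpNorm_restrict_le_of_iUnion (T := T) ?_ ?_ fun k => ?_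
  · intro j k hjk x hx
    have hx2 : 1 / ((j : ℝ) + 1) ≤ Metric.infDist x (Ω : Set Plane)ᶜ := hx.2
    refine ⟨hx.1, ?_⟩
    rw [mem_ofPred_eq]
    refine le_trans ?_ hx2
    have : (j : ℝ) ≤ k := by exact_mod_cast hjk
    gcongr
  · intro x hx
    have hpos : 0 < Metric.infDist x (Ω : Set Plane)ᶜ :=
      (Ω.isOpen.isClosed_compl.notMem_iff_infDist_pos hnec).1 fun hc => hc hx.1.1
    obtain ⟨k, hk⟩ := exists_nat_one_div_lt hpos
    exact mem_iUnion.2 ⟨k, hx, hk.le⟩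
  · have hkp : 0 < 1 / ((k : ℝ) + 1) := by positivity
    set Q := Metric.closedBall x₀ h ∩ {x | 1 / ((k : ℝ) + 1) ≤ Metric.infDist x (Ω : Set Plane)ᶜ}
    have hQ : IsCompact Q := (isCompact_closedBall _ _).inter_right (hcl _)
    -- The upward sweep of `Q` is compact, and contained in Ω because heights only increase.
    set K := (fun z : Plane × ℝ => z.1 + z.2 • n) '' (Q ×ˢ Icc 0 h)
    have hK : IsCompact K := (hQ.prod isCompact_Icc).image (by fun_prop)
    have hKΩ : K ⊆ Ω := by
      rintro _ ⟨⟨x, s⟩, ⟨hx, hs⟩, rfl⟩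
      have hxΩ : x ∈ (Ω : Set Plane) := by
        by_contra hc
        have := Metric.infDist_zero_of_mem (s := (Ω : Set Plane)ᶜ) hc
        have h2 := hx.2
        rw [mem_ofPred_eq, this] at h2
        linarith
      have hxr : x ∈ Metric.ball x₀ r := by
        simpa using hball x hx.1 0 ⟨le_rfl, hh0.le⟩
      refine (hchart _ (hball x hx.1 s hs)).2 ?_
      simp only
      rw [he0, he1]
      have := (hchart x hxr).1 hxΩ
      have := hs.1
      linarith
    have hTK : ∀ x ∈ T k, ∀ s ∈ Icc 0 h, x + s • n ∈ K := by
      intro x hx s hs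
      have hxQ : x ∈ Q := ⟨Metric.ball_subset_closedBall hx.1.2, hx.2⟩
      exact ⟨(x, s), mk_mem_prod hxQ hs, rfl⟩
    have := hu.eLpNorm_le_of_translates (hSM.inter (hcl _).measurableSet) hK hKΩ hn1.le
      hh0 ENNReal.ofReal_ne_top hTK
      (fun y => (measure_mono (t := {s ∈ Icc 0 h | y - s • n ∈ S})
        fun s hs => ⟨hs.1, hs.2.1⟩).trans (hmeas y))
    refine this.trans (le_of_eq ?_)
    rw [hD, ← ENNReal.mul_rpow_of_nonneg _ _ (by norm_num), ENNReal.ofReal_mul (by positivity)]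
    congr 2
    ring

/-- The boundary layer estimate `‖u‖_{L²(Ω_δ)} ≤ C δ^{1/2} ‖u‖_{H¹(Ω)}` on a Lipschitz domain. -/
theorem exists_eLpNorm_boundaryLayer_le [CompleteSpace F]
    (hb : Bornology.IsBounded (Ω : Set Plane)) (hL : HasLipschitzBoundary (Ω : Set Plane)) :
    ∃ C : ℝ≥0, ∀ u : Plane → F, MemH1 Ω u → ∀ δ : ℝ, 0 < δ →
      eLpNorm u 2 (volume.restrict (boundaryLayer Ω δ))
        ≤ C * ENNReal.ofReal δ ^ (1 / 2 : ℝ) * h1Sum Ω u := by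
  have hne : (Ω : Set Plane) ≠ univ := fun hc => by
    rw [hc] at hb
    exact NormedSpace.unbounded_univ ℝ Plane hb
  have hloc : ∀ x ∈ frontier (Ω : Set Plane), ∃ r > 0, ∃ C : ℝ≥0, ∀ u : Plane → F, MemH1 Ω u →
      ∀ δ : ℝ, 0 < δ → δ ≤ r →
      eLpNorm u 2 (volume.restrict (boundaryLayer Ω δ ∩ Metric.ball x r))
        ≤ C * ENNReal.ofReal δ ^ (1 / 2 : ℝ) * h1Sum Ω u := by
    intro x hx
    obtain ⟨e, γ, L, r, hγ, hr, hc⟩ := hL x hx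
    obtain ⟨C, hC⟩ := exists_eLpNorm_ball_inter_boundaryLayer_le (F := F) hb hγ hr hc
    exact ⟨r / 4, by positivity, C, fun u hu δ hδ hδr => hC u hu δ hδ (by linarith)⟩
  choose! r hr C hC using hloc
  have hcomp : IsCompact (frontier (Ω : Set Plane)) :=
    Metric.isCompact_of_isClosed_isBounded isClosed_frontier
      (hb.closure.subset frontier_subset_closure)
  -- The cover uses half radii so that a point of the layer, being within `δ₀ ≤ r x / 2` of its
  -- nearest boundary point, falls in the full ball.
  obtain ⟨t, ht, hcov⟩ := hcomp.elim_nhds_subcover (fun x => Metric.ball x (r x / 2))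
    fun x hx => Metric.ball_mem_nhds _ (half_pos (hr x hx))
  obtain ⟨δ₀, hδ₀, hδt⟩ : ∃ δ₀ : ℝ, 0 < δ₀ ∧ ∀ x ∈ t, δ₀ ≤ r x / 2 := by
    rcases t.eq_empty_or_nonempty with rfl | hne
    · exact ⟨1, one_pos, by simp⟩
    · exact ⟨t.inf' hne fun x => r x / 2,
        (Finset.lt_inf'_iff _).2 fun x hx => half_pos (hr x (ht x hx)),
        fun x hx => Finset.inf'_le _ hx⟩
  -- The sum serves layers of width at most δ₀. For wider ones the second term makes the bound
  -- trivial, since δ₀^{-1/2} δ^{1/2} ≥ 1.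
  refine ⟨∑ x ∈ t, C x + (ENNReal.ofReal δ₀ ^ (-(1 / 2) : ℝ)).toNNReal, fun u hu δ hδ => ?_⟩
  have hδ0' : ENNReal.ofReal δ₀ ≠ 0 := by simpa using hδ₀
  have htop : ENNReal.ofReal δ₀ ^ (-(1 / 2) : ℝ) ≠ ⊤ := by simp [hδ₀]
  rw [ENNReal.coe_add, ENNReal.coe_toNNReal htop]
  rcases le_or_gt δ δ₀ with hle | hgt
  · have hsub : boundaryLayer Ω δ ⊆ ⋃ x ∈ t, boundaryLayer Ω δ ∩ Metric.ball x (r x) := by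
      intro y hy
      obtain ⟨z, hz, hzd⟩ :=
        exists_mem_frontier_infDist_compl_eq_dist (s := (Ω : Set Plane)) hy.1 hne
      obtain ⟨x, hx, hzx⟩ := mem_iUnion₂.1 (hcov hz)
      refine mem_iUnion₂.2 ⟨x, hx, hy, ?_⟩
      have h1 := hy.2
      rw [hzd] at h1
      rw [Metric.mem_ball] at hzx ⊢
      have := hδt x hx
      have := dist_triangle y z x
      linarith
    have hsum : ∀ s : Finset Plane, eLpNorm u 2
        (volume.restrict (⋃ x ∈ s, boundaryLayer Ω δ ∩ Metric.ball x (r x)))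
        ≤ ∑ x ∈ s, eLpNorm u 2 (volume.restrict (boundaryLayer Ω δ ∩ Metric.ball x (r x))) := by
      classical
      intro s
      induction s using Finset.induction_on with
      | empty => simp
      | insert a s ha ih =>
        rw [Finset.set_biUnion_insert, Finset.sum_insert ha]
        exact (eLpNorm_restrict_union_le _ _ _).trans (by gcongr)
    calc _ ≤ _ := eLpNorm_mono_measure _ (Measure.restrict_mono hsub le_rfl)
      _ ≤ _ := hsum t
      _ ≤ ∑ x ∈ t, (C x : ℝ≥0∞) * ENNReal.ofReal δ ^ (1 / 2 : ℝ) * h1Sum Ω u := by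
        refine Finset.sum_le_sum fun x hx => hC x (ht x hx) u hu δ hδ ?_
        have := hδt x hx
        have := hr x (ht x hx)
        linarith
      _ = (∑ x ∈ t, C x : ℝ≥0) * ENNReal.ofReal δ ^ (1 / 2 : ℝ) * h1Sum Ω u := by
        rw [ENNReal.ofNNReal_finsetSum, Finset.sum_mul, Finset.sum_mul]
      _ ≤ _ := by gcongr; exact le_self_add
  · calc _ ≤ eLpNorm u 2 (volume.restrict (Ω : Set Plane)) :=
          eLpNorm_mono_measure _ (Measure.restrict_mono (boundaryLayer_subset Ω δ) le_rfl)
      _ ≤ 1 * h1Sum Ω u := by rw [one_mul]; exact le_self_add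
      _ ≤ _ := by
        gcongr
        calc (1 : ℝ≥0∞) = ENNReal.ofReal δ₀ ^ (-(1 / 2) : ℝ) * ENNReal.ofReal δ₀ ^ (1 / 2 : ℝ) := by
              rw [← ENNReal.rpow_add _ _ hδ0' ENNReal.ofReal_ne_top]; norm_num
          _ ≤ _ := by
              gcongr
              exact le_add_self

end BoundaryLayer

/-! ### Gradients and the Poincaré inequality -/

section Gradient

variable {F : Type*} [NormedAddCommGroup F] [NormedSpace ℝ F] {Ω : Opens Plane}

/-- The classical gradient. -/
noncomputable def grad (u : Plane → F) (x : Plane) : Fin 2 → F := fun α => partialD α u x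

/-- The weak gradient. -/
noncomputable def weakGrad (Ω : Opens Plane) (u : Plane → F) (x : Plane) : Fin 2 → F :=
  fun α => weakPartial Ω α u x

theorem continuous_grad {u : Plane → F} (hu : ContDiff ℝ 1 u) : Continuous (grad u) :=
  continuous_pi fun α => continuous_partialD hu α

theorem hasCompactSupport_grad {u : Plane → F} (hu : HasCompactSupport u) :
    HasCompactSupport (grad u) :=
  hu.mono' fun x hx => by
    by_contra h
    refine hx ?_
    ext1 α
    exact image_eq_zero_of_notMem_tsupport (f := partialD α u) fun hc => h (tsupport_partialD_subset u α hc)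

/-- The factor 2 appears because `Fin 2 → F` carries the supremum norm. -/
theorem norm_fderiv_le_two_mul_norm_grad (u : Plane → F) (x : Plane) :
    ‖fderiv ℝ u x‖ ≤ 2 * ‖grad u x‖ := by
  refine ContinuousLinearMap.opNorm_le_bound _ (by positivity) fun n => ?_
  rw [fderiv_apply_eq_sum]
  calc _ ≤ ∑ α, ‖n α • partialD α u x‖ := norm_sum_le _ _
    _ ≤ ∑ _α : Fin 2, ‖n‖ * ‖grad u x‖ := by
      refine Finset.sum_le_sum fun α _ => ?_
      rw [norm_smul]
      gcongr
      · exact PiLp.norm_apply_le n α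
      · exact norm_le_pi_norm (grad u x) α
    _ = _ := by simp; ring

/-- This is the Gagliardo–Nirenberg–Sobolev inequality at the exponent 1: in dimension two the
Sobolev exponent of 1 is 2. -/
theorem exists_eLpNorm_two_le_eLpNorm_fderiv_one (F : Type*) [NormedAddCommGroup F]
    [NormedSpace ℝ F] :
    ∃ C : ℝ≥0, ∀ u : Plane → F, ContDiff ℝ 1 u → HasCompactSupport u →
      eLpNorm u 2 volume ≤ C * eLpNorm (fderiv ℝ u) 1 volume := by
  have hconj : NNReal.HolderConjugate (Module.finrank ℝ Plane) (2 : ℝ≥0) := by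
    rw [finrank_euclideanSpace, Fintype.card_fin, Nat.cast_ofNat]
    rw [NNReal.holderConjugate_iff]
    norm_num
  refine ⟨eLpNormLESNormFDerivOneConst (volume : Measure Plane) (2 : ℝ≥0), fun u hu hc => ?_⟩
  have h := eLpNorm_le_eLpNorm_fderiv_one (volume : Measure Plane) hu hc hconj
  rwa [ENNReal.coe_ofNat] at h

theorem eLpNorm_one_le_eLpNorm_two {X G : Type*} [MeasurableSpace X] [NormedAddCommGroup G]
    {μ : Measure X} {f : X → G} (hf : AEStronglyMeasurable f μ) :
    eLpNorm f 1 μ ≤ eLpNorm f 2 μ * μ univ ^ (1 / 2 : ℝ) := by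
  have h := eLpNorm_le_eLpNorm_mul_rpow_measure_univ (p := 1) (q := 2) (μ := μ) (by norm_num) hf
  have hexp : (1 / (1 : ℝ≥0∞).toReal - 1 / (2 : ℝ≥0∞).toReal) = (1 / 2 : ℝ) := by norm_num
  rwa [hexp] at h

theorem eLpNorm_fderiv_le_two_mul (u : Plane → F) (μ : Measure Plane) :
    eLpNorm (fderiv ℝ u) 2 μ ≤ 2 * eLpNorm (grad u) 2 μ := by
  have h := eLpNorm_le_nnreal_smul_eLpNorm_of_ae_le_mul (μ := μ) (c := (2 : ℝ≥0))
    (f := fderiv ℝ u) (g := grad u)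
    (ae_of_all _ fun x => norm_fderiv_le_two_mul_norm_grad u x) 2
  rwa [ENNReal.smul_def, smul_eq_mul, ENNReal.coe_ofNat] at h

/-- The Poincaré inequality for compactly supported functions. -/
theorem exists_eLpNorm_le_eLpNorm_grad (F : Type*) [NormedAddCommGroup F] [NormedSpace ℝ F]
    (hb : Bornology.IsBounded (Ω : Set Plane)) :
    ∃ C : ℝ≥0, ∀ u : Plane → F, ContDiff ℝ 1 u → HasCompactSupport u → tsupport u ⊆ Ω →
      eLpNorm u 2 (volume.restrict (Ω : Set Plane))
        ≤ C * eLpNorm (grad u) 2 (volume.restrict (Ω : Set Plane)) := by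
  obtain ⟨c, hcu⟩ := exists_eLpNorm_two_le_eLpNorm_fderiv_one F
  have hV : volume (Ω : Set Plane) ^ (1 / 2 : ℝ) ≠ ⊤ :=
    ENNReal.rpow_ne_top_of_nonneg (by norm_num) hb.measure_lt_top.ne
  -- The 2 compares the operator norm of the derivative with `grad`; the root of the area of Ω is
  -- Hölder's inequality from L² to L¹.
  refine ⟨c * 2 * (volume (Ω : Set Plane) ^ (1 / 2 : ℝ)).toNNReal, fun u hu hc hs => ?_⟩
  rw [ENNReal.coe_mul, ENNReal.coe_mul, ENNReal.coe_toNNReal hV, ENNReal.coe_ofNat]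
  have hcont : Continuous (fderiv ℝ u) := hu.continuous_fderiv one_ne_zero
  have hsupp : Function.support (fderiv ℝ u) ⊆ Ω := (support_fderiv_subset ℝ).trans hs
  have h2 : eLpNorm (fderiv ℝ u) 1 volume
      = eLpNorm (fderiv ℝ u) 1 (volume.restrict (Ω : Set Plane)) :=
    (eLpNorm_restrict_eq_of_support_subset (μ := volume) (p := 1) (f := fderiv ℝ u) hsupp).symm
  have h3 := eLpNorm_one_le_eLpNorm_two
    (hcont.aestronglyMeasurable (μ := volume.restrict (Ω : Set Plane)))
  rw [Measure.restrict_apply_univ] at h3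
  generalize volume (Ω : Set Plane) ^ (1 / 2 : ℝ) = V at hV h3
  calc _ ≤ eLpNorm u 2 volume := eLpNorm_mono_measure _ Measure.restrict_le_self
    _ ≤ c * eLpNorm (fderiv ℝ u) 1 volume := hcu u hu hc
    _ = c * eLpNorm (fderiv ℝ u) 1 (volume.restrict (Ω : Set Plane)) := by
      rw [h2]
    _ ≤ c * (2 * eLpNorm (grad u) 2 (volume.restrict (Ω : Set Plane)) * V) := by
      gcongr
      exact h3.trans (mul_le_mul_left (eLpNorm_fderiv_le_two_mul u _) V)
    _ = _ := by ring

end Gradient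

/-! ### Cutoff functions at scale ε -/

section Cutoff

variable {Ω : Opens Plane}

/-- A mollification is an average of translates, all with the same Lipschitz constant. Hence
smoothing the cutoff does not steepen it. -/
theorem lipschitzWith_mollify (φ : ContDiffBump (0 : Plane)) {g : Plane → ℝ} {c : ℝ≥0}
    (hg : LipschitzWith c g) : LipschitzWith c (mollify φ g) := by
  have hi : ∀ x, Integrable (fun t => φ.normed volume t • g (x - t)) volume := fun x =>
    φ.hasCompactSupport_normed.convolutionExists_left
        (ContinuousLinearMap.lsmul ℝ ℝ) φ.continuous_normed hg.continuous.locallyIntegrable x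
  refine LipschitzWith.of_dist_le_mul fun x y => ?_
  have e : mollify φ g x - mollify φ g y
      = ∫ t, φ.normed volume t • (g (x - t) - g (y - t)) := by
    simp_rw [smul_sub]
    rw [integral_sub (hi x) (hi y)]
    rfl
  rw [Real.dist_eq, e, ← Real.norm_eq_abs]
  have : ∫ t, φ.normed (volume : Measure Plane) t * (c * dist x y) = c * dist x y := by
    rw [integral_mul_const, φ.integral_normed, one_mul]
  rw [← this]
  refine norm_integral_le_of_norm_le (φ.integrable_normed.mul_const _) (ae_of_all _ fun t => ?_)
  rw [norm_smul, Real.norm_of_nonneg (φ.nonneg_normed t)]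
  refine mul_le_mul_of_nonneg_left ?_ (φ.nonneg_normed t)
  have := hg.dist_le_mul (x - t) (y - t)
  rwa [Real.dist_eq, dist_sub_right, ← Real.norm_eq_abs] at this

theorem mollify_nonneg (φ : ContDiffBump (0 : Plane)) {g : Plane → ℝ} (hg : ∀ x, 0 ≤ g x)
    (x : Plane) : 0 ≤ mollify φ g x := by
  rw [mollify_apply]
  exact integral_nonneg fun t => mul_nonneg (φ.nonneg_normed _) (hg t)

theorem mollify_le_one (φ : ContDiffBump (0 : Plane)) {g : Plane → ℝ} (hgc : Continuous g)
    (hg : ∀ x, g x ≤ 1) (x : Plane) : mollify φ g x ≤ 1 := by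
  have hi : Integrable (fun t => φ.normed volume t • g (x - t)) volume :=
    φ.hasCompactSupport_normed.convolutionExists_left
        (ContinuousLinearMap.lsmul ℝ ℝ) φ.continuous_normed hgc.locallyIntegrable x
  calc mollify φ g x = ∫ t, φ.normed volume t • g (x - t) := rfl
    _ ≤ ∫ t, φ.normed (volume : Measure Plane) t := by
      refine integral_mono hi φ.integrable_normed fun t => ?_
      exact mul_le_of_le_one_right (φ.nonneg_normed t) (hg _)
    _ = 1 := φ.integral_normed

/-- A smooth cutoff function with transition region of width `ε` near the boundary. -/
theorem exists_cutoff (hb : Bornology.IsBounded (Ω : Set Plane)) {ε : ℝ} (hε : 0 < ε) :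
    ∃ η : Plane → ℝ, ContDiff ℝ ∞ η ∧ HasCompactSupport η ∧ tsupport η ⊆ Ω ∧
      (∀ x, 0 ≤ η x) ∧ (∀ x, η x ≤ 1) ∧ (∀ α x, |partialD α η x| ≤ ε⁻¹) ∧
      ∀ x ∈ Ω, x ∉ boundaryLayer Ω (5 * ε) → η x = 1 ∧ ∀ α, partialD α η x = 0 := by
  set d : Plane → ℝ := fun x => Metric.infDist x (Ω : Set Plane)ᶜ with hd
  have hdL : LipschitzWith 1 d := Metric.lipschitz_infDist_pt _
  have hdd : ∀ x y, d y ≤ d x + dist y x := fun x y => Metric.infDist_le_infDist_add_dist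
  -- This profile is 0 where d ≤ 2ε, 1 where d ≥ 3ε, and has slope ε⁻¹ in between. Mollifying at
  -- radius ε leaves 0 where d < ε and 1 where d ≥ 4ε.
  set g : Plane → ℝ := fun x => min 1 (max 0 (ε⁻¹ * d x - 2)) with hg
  have hgL : LipschitzWith ⟨ε⁻¹, by positivity⟩ g := by
    have h1 : LipschitzWith ⟨ε⁻¹, by positivity⟩ fun x => ε⁻¹ * d x - 2 := by
      refine LipschitzWith.of_dist_le_mul fun x y => ?_
      have := hdL.dist_le_mul x y
      rw [Real.dist_eq] at this ⊢
      have e : ε⁻¹ * d x - 2 - (ε⁻¹ * d y - 2) = ε⁻¹ * (d x - d y) := by ring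
      rw [e, abs_mul, abs_of_pos (by positivity : 0 < ε⁻¹)]
      simp only [NNReal.coe_one, one_mul] at this
      exact mul_le_mul_of_nonneg_left this (by positivity)
    exact (h1.const_max 0).const_min 1
  have hg0 : ∀ x, 0 ≤ g x := fun x => le_min zero_le_one (le_max_left _ _)
  have hg1 : ∀ x, g x ≤ 1 := fun x => min_le_left _ _
  let φ : ContDiffBump (0 : Plane) := ⟨ε / 2, ε, by positivity, by linarith⟩
  have hsm : ContDiff ℝ ∞ (mollify φ g) := contDiff_mollify φ hgL.continuous.locallyIntegrable
  have hzero : ∀ x, d x < ε → mollify φ g x = 0 := by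
    intro x hx
    have hz : ∀ y ∈ Metric.ball x φ.rOut, g y = 0 := by
      intro y hy
      have h1 : dist y x < ε := hy
      have h2 := hdd x y
      have h3 : ε⁻¹ * d y - 2 ≤ 0 := by
        rw [sub_nonpos, inv_mul_le_iff₀ hε]; linarith
      simp only [hg]
      rw [max_eq_left h3]; simp
    have hx0 := hz x (Metric.mem_ball_self φ.rOut_pos)
    rw [mollify, φ.normed_convolution_eq_right fun y hy => (hz y hy).trans hx0.symm, hx0]
  have hone : ∀ x, 4 * ε ≤ d x → mollify φ g x = 1 := by
    intro x hx
    have hz : ∀ y ∈ Metric.ball x φ.rOut, g y = 1 := by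
      intro y hy
      have h1 : dist x y < ε := by rw [dist_comm]; exact hy
      have h2 := hdd y x
      have h3 : 1 ≤ ε⁻¹ * d y - 2 := by
        rw [le_sub_iff_add_le, le_inv_mul_iff₀ hε]; linarith
      simp only [hg]
      rw [max_eq_right (by linarith), min_eq_left h3]
    have hx0 := hz x (Metric.mem_ball_self φ.rOut_pos)
    rw [mollify, φ.normed_convolution_eq_right fun y hy => (hz y hy).trans hx0.symm, hx0]
  have hsup : tsupport (mollify φ g) ⊆ {x | ε ≤ d x} := by
    refine closure_minimal (fun x hx => ?_) (isClosed_le continuous_const hdL.continuous)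
    by_contra hc
    exact hx (hzero x (not_le.1 hc))
  have hsub : {x | ε ≤ d x} ⊆ (Ω : Set Plane) := by
    intro x hx
    by_contra hc
    have h1 : ε ≤ d x := hx
    have h2 : d x = 0 := Metric.infDist_zero_of_mem hc
    linarith
  refine ⟨mollify φ g, hsm, ?_, hsup.trans hsub, mollify_nonneg φ hg0,
    mollify_le_one φ hgL.continuous hg1, fun α x => ?_, fun x hx hxl => ?_⟩
  · exact Metric.isCompact_of_isClosed_isBounded (isClosed_tsupport _)
      (hb.subset (hsup.trans hsub))
  · have h1 : ‖fderiv ℝ (mollify φ g) x‖ ≤ ε⁻¹ :=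
      norm_fderiv_le_of_lipschitz ℝ (lipschitzWith_mollify φ hgL)
    rw [← Real.norm_eq_abs, partialD]
    refine ((fderiv ℝ (mollify φ g) x).le_opNorm _).trans ?_
    simpa [basisVec] using h1
  -- With 5ε instead of 4ε the point has a whole neighbourhood on which the cutoff is 1, so its
  -- derivative vanishes there.
  · have h5 : 5 * ε ≤ d x := by
      by_contra hc
      exact hxl ⟨hx, not_le.1 hc⟩
    refine ⟨hone x (by linarith), fun α => ?_⟩
    have hev : mollify φ g =ᶠ[𝓝 x] fun _ => 1 := by
      have : ∀ᶠ y in 𝓝 x, 4 * ε < d y :=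
        hdL.continuous.continuousAt.eventually_const_lt (by linarith)
      filter_upwards [this] with y hy using hone y hy.le
    rw [partialD, hev.fderiv_eq]
    simp

end Cutoff

/-! ### Integration over the unit cell -/

section UnitCell

/-- The point with the given coordinates. -/
noncomputable def planePoint (s t : ℝ) : Plane := WithLp.toLp 2 ![s, t]

theorem continuous_planePoint : Continuous fun z : ℝ × ℝ => planePoint z.1 z.2 := by
  unfold planePoint
  fun_prop

theorem integral_unitCell (f : Plane → ℝ) :
    ∫ y in unitCell, f y
      = ∫ z in Ico (0 : ℝ) 1 ×ˢ Ico (0 : ℝ) 1, f (planePoint z.1 z.2) := by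
  have h1 := (EuclideanSpace.volume_preserving_symm_measurableEquiv_toLp (Fin 2)).symm
  have h2 := (volume_preserving_finTwoArrow ℝ).symm
  have h3 := h1.comp h2
  have e : (fun z : ℝ × ℝ => planePoint z.1 z.2)
      = (MeasurableEquiv.toLp 2 (Fin 2 → ℝ)) ∘ (MeasurableEquiv.finTwoArrow (α := ℝ)).symm := by
    ext z i
    fin_cases i <;> rfl
  have hme : MeasurableEmbedding fun z : ℝ × ℝ => planePoint z.1 z.2 := by
    rw [e]
    exact (MeasurableEquiv.measurableEmbedding _).comp (MeasurableEquiv.measurableEmbedding _)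
  have hmp : MeasurePreserving (fun z : ℝ × ℝ => planePoint z.1 z.2) volume volume := by
    rw [e]; exact h3
  have hpre : (fun z : ℝ × ℝ => planePoint z.1 z.2) ⁻¹' unitCell
      = Ico (0 : ℝ) 1 ×ˢ Ico (0 : ℝ) 1 := by
    ext z
    simp [unitCell, planePoint, Fin.forall_fin_two]
  rw [← hpre]
  exact (hmp.setIntegral_preimage_emb hme _ _).symm

theorem integrableOn_prod_planePoint {f : Plane → ℝ} (hf : Continuous f) :
    IntegrableOn (fun z : ℝ × ℝ => f (planePoint z.1 z.2)) (Ico (0 : ℝ) 1 ×ˢ Ico (0 : ℝ) 1)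
      (volume.prod volume) :=
  ((hf.comp continuous_planePoint).continuousOn.integrableOn_compact
    (isCompact_Icc.prod isCompact_Icc)).mono_set
    (prod_mono Ico_subset_Icc_self Ico_subset_Icc_self)

theorem integral_Ico_eq_intervalIntegral (f : ℝ → ℝ) :
    ∫ t in Ico (0 : ℝ) 1, f t = ∫ t in (0 : ℝ)..1, f t := by
  rw [integral_Ico_eq_integral_Ioc, intervalIntegral.integral_of_le zero_le_one]

theorem integral_unitCell_eq {f : Plane → ℝ} (hf : Continuous f) :
    ∫ y in unitCell, f y = ∫ s in (0 : ℝ)..1, ∫ t in (0 : ℝ)..1, f (planePoint s t) := by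
  rw [integral_unitCell]
  have := setIntegral_prod _ (integrableOn_prod_planePoint hf)
  refine Eq.trans this ?_
  simp_rw [integral_Ico_eq_intervalIntegral]

theorem integral_unitCell_eq_symm {f : Plane → ℝ} (hf : Continuous f) :
    ∫ y in unitCell, f y = ∫ t in (0 : ℝ)..1, ∫ s in (0 : ℝ)..1, f (planePoint s t) := by
  rw [integral_unitCell_eq hf]
  simp_rw [← integral_Ico_eq_intervalIntegral]
  refine integral_integral_swap ?_
  have := integrableOn_prod_planePoint hf
  rwa [IntegrableOn, ← Measure.prod_restrict] at this

theorem integral_unitCell_const (c : ℝ) : ∫ _y in unitCell, c = c := by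
  rw [integral_unitCell_eq continuous_const]; simp

theorem unitCell_subset_closedBall : unitCell ⊆ Metric.closedBall (0 : Plane) 2 := by
  intro y hy
  rw [mem_closedBall_zero_iff, EuclideanSpace.norm_eq]
  have h0 := hy 0
  have h1 := hy 1
  rw [Real.sqrt_le_left (by norm_num)]
  simp only [Fin.sum_univ_two, Real.norm_eq_abs, sq_abs]
  nlinarith [h0.1, h0.2, h1.1, h1.2]

theorem integrableOn_unitCell {f : Plane → ℝ} (hf : Continuous f) : IntegrableOn f unitCell :=
  (hf.continuousOn.integrableOn_compact (isCompact_closedBall _ _)).mono_set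
    unitCell_subset_closedBall

end UnitCell

/-! ### Periodic functions and stream functions -/

section Periodic

/-- Subtracting the integer parts of the coordinates moves any point into the unit cell, which lies
in a compact ball. -/
theorem IsPeriodic.exists_bound {f : Plane → ℝ} (hp : IsPeriodic f) (hf : Continuous f) :
    ∃ M : ℝ, 0 ≤ M ∧ ∀ y, |f y| ≤ M := by
  obtain ⟨M, hM⟩ := (isCompact_closedBall (0 : Plane) 2).exists_bound_of_continuousOn
    hf.continuousOn
  refine ⟨M, (abs_nonneg _).trans (hM 0 (by simp)), fun y => ?_⟩
  have hy : y - latticeVec (fun i => ⌊y i⌋) ∈ unitCell := fun i =>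
    ⟨by simp [latticeVec], by simp [latticeVec, Int.fract_lt_one]⟩
  have h1 := hp (y - latticeVec (fun i => ⌊y i⌋)) (fun i => ⌊y i⌋)
  rw [sub_add_cancel] at h1
  rw [h1]
  exact hM _ (unitCell_subset_closedBall hy)

theorem IsPeriodic.partialD {f : Plane → ℝ} (hp : IsPeriodic f) (α : Fin 2) :
    IsPeriodic (partialD α f) := by
  intro y h
  have e : (fun z => f (z + latticeVec h)) = f := funext fun z => hp z h
  unfold Homog.partialD
  conv_rhs => rw [← e, fderiv_comp_add_right]

theorem isPeriodic_of_basisVec {f : Plane → ℝ}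
    (h : ∀ α y, f (y + basisVec α) = f y) : IsPeriodic f := by
  intro y k
  have hper : ∀ α, Function.Periodic f (basisVec α) := fun α y => h α y
  have e : latticeVec k = k 0 • basisVec 0 + k 1 • basisVec 1 := by
    ext i
    fin_cases i <;> simp [latticeVec, basisVec]
  rw [e, ← add_assoc, ((hper 1).zsmul (k 1)), ((hper 0).zsmul (k 0))]

theorem latticeVec_single (α : Fin 2) : latticeVec (Pi.single α 1) = basisVec α := by
  ext i
  by_cases h : i = α <;> simp [latticeVec, basisVec, h]

theorem planePoint_add_smul_basisVec_zero (s t : ℝ) :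
    planePoint 0 t + s • basisVec 0 = planePoint s t := by
  ext i
  fin_cases i <;> simp [planePoint, basisVec]

theorem planePoint_add_smul_basisVec_one (s t : ℝ) :
    planePoint s 0 + t • basisVec 1 = planePoint s t := by
  ext i
  fin_cases i <;> simp [planePoint, basisVec]

theorem partialD_smul_basisVec {f : Plane → ℝ} (hf : Differentiable ℝ f) (α : Fin 2) (y : Plane)
    (s : ℝ) : HasDerivAt (fun s : ℝ => f (y + s • basisVec α))
      (partialD α f (y + s • basisVec α)) s := by
  have h1 : HasDerivAt (fun s : ℝ => y + s • basisVec α) (basisVec α) s := by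
    simpa using ((hasDerivAt_id s).smul_const (basisVec α)).const_add y
  exact (hf _).hasFDerivAt.comp_hasDerivAt s h1

/-- A `C¹` periodic divergence-free field with mean zero has a periodic stream function. -/
theorem exists_stream {b : Fin 2 → Plane → ℝ} (hb : ∀ α, ContDiff ℝ 1 (b α))
    (hp : ∀ α, IsPeriodic (b α)) (hdiv : ∀ y, ∑ α, partialD α (b α) y = 0)
    (hmean : ∀ α, ∫ y in unitCell, b α y = 0) :
    ∃ ψ : Plane → ℝ, ContDiff ℝ 1 ψ ∧ (∃ M : ℝ, 0 ≤ M ∧ ∀ y, |ψ y| ≤ M) ∧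
      (∀ y, partialD 1 ψ y = b 0 y) ∧ ∀ y, partialD 0 ψ y = - b 1 y := by
  let pr : Fin 2 → Plane →L[ℝ] ℝ := fun i => EuclideanSpace.proj i
  -- This is the 1-form b₀ dy₁ − b₁ dy₀. It is closed precisely because `b` is divergence free, so
  -- it has a primitive on the plane by the Poincaré lemma.
  set w : Plane → Plane →L[ℝ] ℝ := fun y => b 0 y • pr 1 - b 1 y • pr 0 with hw
  have hd : ∀ α y, HasFDerivAt (b α) (fderiv ℝ (b α) y) y := fun α y =>
    ((hb α).differentiable one_ne_zero y).hasFDerivAt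
  have hdw : ∀ y, HasFDerivAt w ((fderiv ℝ (b 0) y).smulRight (pr 1)
      - (fderiv ℝ (b 1) y).smulRight (pr 0)) y := fun y =>
    ((hd 0 y).smul_const (pr 1)).sub ((hd 1 y).smul_const (pr 0))
  obtain ⟨ψ, hψ⟩ := convex_univ.exists_forall_hasFDerivAt_of_fderiv_symmetric isOpen_univ
    (fun y _ => (hdw y).differentiableAt.differentiableWithinAt) (by
      intro y _ v u
      rw [(hdw y).fderiv]
      have h0 := fderiv_apply_eq_sum (b 0) y
      have h1 := fderiv_apply_eq_sum (b 1) y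
      have h2 := hdiv y
      simp only [Fin.sum_univ_two, smul_eq_mul] at h0 h1 h2
      have hpr : ∀ (i : Fin 2) (x : Plane), pr i x = x i := fun _ _ => rfl
      simp only [sub_apply, ContinuousLinearMap.smulRight_apply, smul_apply, smul_eq_mul, hpr,
        h0, h1]
      linear_combination (v 0 * u 1 - v 1 * u 0) * h2)
  have hψ' : ∀ y, HasFDerivAt ψ (w y) y := fun y => hψ y (mem_univ y)
  have hdiff : Differentiable ℝ ψ := fun y => (hψ' y).differentiableAt
  have hf : fderiv ℝ ψ = w := funext fun y => (hψ' y).fderiv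
  have hwc : Continuous w := by
    have h0 := (hb 0).continuous
    have h1 := (hb 1).continuous
    fun_prop
  have hψ1 : ContDiff ℝ 1 ψ := contDiff_one_iff_fderiv.2 ⟨hdiff, by rw [hf]; exact hwc⟩
  have hp1 : ∀ y, partialD 1 ψ y = b 0 y := by
    intro y; simp [Homog.partialD, hf, hw, pr, basisVec]
  have hp0 : ∀ y, partialD 0 ψ y = - b 1 y := by
    intro y; simp [Homog.partialD, hf, hw, pr, basisVec]
  have hwp : ∀ α y, w (y + basisVec α) = w y := by
    intro α y
    simp only [hw]
    rw [← latticeVec_single, hp 0, hp 1]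
  -- The differential of ψ is periodic, so the increment of ψ along a lattice vector is a constant.
  have hconst : ∀ α, ∃ c : ℝ, ∀ y, ψ (y + basisVec α) - ψ y = c := by
    intro α
    have h0 : ∀ y, HasFDerivAt (fun y => ψ (y + basisVec α) - ψ y) (0 : Plane →L[ℝ] ℝ) y := by
      intro y
      have h1 : HasFDerivAt (fun y => ψ (y + basisVec α)) (w (y + basisVec α)) y :=
        (hasFDerivAt_comp_add_right (basisVec α)).2 (hψ' _)
      have := h1.sub (hψ' y)
      rwa [hwp, sub_self] at this
    exact ⟨_, fun y => is_const_of_fderiv_eq_zero (fun y => (h0 y).differentiableAt)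
      (fun y => (h0 y).fderiv) y 0⟩
  have hint : ∀ α y, ∫ s in (0 : ℝ)..1, partialD α ψ (y + s • basisVec α)
      = ψ (y + basisVec α) - ψ y := by
    intro α y
    have hc : Continuous fun s : ℝ => partialD α ψ (y + s • basisVec α) :=
      (continuous_partialD hψ1 α).comp (by fun_prop)
    have := intervalIntegral.integral_eq_sub_of_hasDerivAt
      (fun s _ => partialD_smul_basisVec hdiff α y s) (hc.intervalIntegrable 0 1)
    simpa using this
  have hper : ∀ α y, ψ (y + basisVec α) = ψ y := by
    intro α
    obtain ⟨c, hc⟩ := hconst α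
    -- The increment is the line integral of ±b over a unit segment. Averaged over the transverse
    -- coordinate it becomes the mean of a component of `b`, which is zero.
    suffices c = 0 from fun y => by have := hc y; linarith
    fin_cases α
    · have h1 : ∀ t : ℝ, ∫ s in (0 : ℝ)..1, b 1 (planePoint s t) = -c := by
        intro t
        have := hint 0 (planePoint 0 t)
        simp_rw [hp0, planePoint_add_smul_basisVec_zero] at this
        rw [intervalIntegral.integral_neg] at this
        have h2 := hc (planePoint 0 t)
        simp only [Fin.zero_eta] at h2
        linarith
      have h3 := hmean 1
      rw [integral_unitCell_eq_symm (hb 1).continuous] at h3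
      simp_rw [h1] at h3
      simpa using h3
    · have h1 : ∀ s : ℝ, ∫ t in (0 : ℝ)..1, b 0 (planePoint s t) = c := by
        intro s
        have := hint 1 (planePoint s 0)
        simp_rw [hp1, planePoint_add_smul_basisVec_one] at this
        exact this.trans (hc _)
      have h3 := hmean 0
      rw [integral_unitCell_eq (hb 0).continuous] at h3
      simp_rw [h1] at h3
      simpa using h3
  exact ⟨ψ, hψ1, (isPeriodic_of_basisVec hper).exists_bound hψ1.continuous, hp1, hp0⟩

end Periodic

/-! ### The flux defect and its stream functions -/

section FluxCorrector

variable {N : ℕ}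

/-- The defect `A⁰ - A - A∇χ` of the fluxes. -/
noncomputable def fluxDefect (A : TensorField N) (χ : Fin 2 → Plane → Matrix (Fin N) (Fin N) ℝ)
    (α β : Fin 2) (i j : Fin N) (y : Plane) : ℝ :=
  homogenized A χ α β y i j - A α β y i j
    - ∑ γ, ∑ k, A α γ y i k * partialD γ (fun z => χ β z k j) y

variable {A : TensorField N} {χ : Fin 2 → Plane → Matrix (Fin N) (Fin N) ℝ}

theorem IsCellSolution.contDiff_partialD (hχ : IsCellSolution A χ) (γ β : Fin 2) (k j : Fin N) :
    ContDiff ℝ 1 (partialD γ fun z => χ β z k j) :=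
  ((hχ.regular β k j).fderiv_right (m := 1) (by norm_num)).clm_apply contDiff_const

theorem IsAdmissible.contDiff_one (hA : IsAdmissible A) (α β : Fin 2) (i j : Fin N) :
    ContDiff ℝ 1 (fun y => A α β y i j) := (hA.smooth α β i j).of_le (by simp)

theorem IsAdmissible.isPeriodic_entry (hA : IsAdmissible A) (α β : Fin 2) (i j : Fin N) :
    IsPeriodic (fun y => A α β y i j) := fun y h => by simp only [hA.periodic α β y h]

theorem IsCellSolution.isPeriodic_entry (hχ : IsCellSolution A χ) (β : Fin 2) (i j : Fin N) :
    IsPeriodic (fun y => χ β y i j) := fun y h => by simp only [hχ.periodic β y h]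

theorem contDiff_flux (hA : IsAdmissible A) (hχ : IsCellSolution A χ) (α β : Fin 2)
    (i j : Fin N) :
    ContDiff ℝ 1 fun y => ∑ γ, ∑ k, A α γ y i k * partialD γ (fun z => χ β z k j) y :=
  ContDiff.sum fun γ _ => ContDiff.sum fun k _ =>
    (hA.contDiff_one α γ i k).mul (hχ.contDiff_partialD γ β k j)

theorem contDiff_fluxDefect (hA : IsAdmissible A) (hχ : IsCellSolution A χ) (α β : Fin 2)
    (i j : Fin N) : ContDiff ℝ 1 (fluxDefect A χ α β i j) :=
  (contDiff_const.sub (hA.contDiff_one α β i j)).sub (contDiff_flux hA hχ α β i j)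

theorem isPeriodic_fluxDefect (hA : IsAdmissible A) (hχ : IsCellSolution A χ) (α β : Fin 2)
    (i j : Fin N) : IsPeriodic (fluxDefect A χ α β i j) := by
  intro y h
  have hAp := fun γ k => hA.isPeriodic_entry α γ i k y h
  have hχp := fun γ k => (hχ.isPeriodic_entry β k j).partialD γ y h
  simp only at hAp
  simp only [fluxDefect, hAp, hχp]
  rfl

/-- The homogenized tensor is the mean of A + A∇χ over a cell of area one. -/
theorem integral_fluxDefect (hA : IsAdmissible A) (hχ : IsCellSolution A χ) (α β : Fin 2)
    (i j : Fin N) : ∫ y in unitCell, fluxDefect A χ α β i j y = 0 := by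
  have i1 := integrableOn_unitCell (hA.contDiff_one α β i j).continuous
  have i2 := integrableOn_unitCell (contDiff_flux hA hχ α β i j).continuous
  have i0 : IntegrableOn (fun y => homogenized A χ α β y i j) unitCell :=
    integrableOn_unitCell continuous_const
  have h0 : ∫ y in unitCell, homogenized A χ α β y i j
      = (∫ y in unitCell, A α β y i j)
      + ∫ y in unitCell, ∑ γ, ∑ k, A α γ y i k * partialD γ (fun z => χ β z k j) y :=
    integral_unitCell_const _
  refine (integral_sub (i0.sub i1) i2).trans ?_
  rw [integral_sub' i0 i1, h0]
  ring

/-- The constant A⁰ has no divergence, and the cell problem says that A + A∇χ has none either. -/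
theorem sum_partialD_fluxDefect (hA : IsAdmissible A) (hχ : IsCellSolution A χ) (β : Fin 2)
    (i j : Fin N) (y : Plane) : ∑ α, partialD α (fluxDefect A χ α β i j) y = 0 := by
  have h : ∀ α, partialD α (fluxDefect A χ α β i j) y
      = - partialD α (fun z => A α β z i j) y
        - partialD α (fun y => ∑ γ, ∑ k, A α γ y i k * partialD γ (fun z => χ β z k j) y) y := by
    intro α
    have d1 := ((hA.contDiff_one α β i j).differentiable one_ne_zero y).hasFDerivAt
    have d2 := ((contDiff_flux hA hχ α β i j).differentiable one_ne_zero y).hasFDerivAt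
    have d3 : HasFDerivAt (fluxDefect A χ α β i j) _ y := (d1.const_sub _).sub d2
    unfold partialD
    rw [d3.fderiv]
    rfl
  simp_rw [h, Finset.sum_sub_distrib]
  have := hχ.equation β i j y
  rw [Finset.sum_neg_distrib, ← this]
  ring

/-- The flux corrector in two dimensions is given by stream functions. -/
theorem exists_fluxCorrector (hA : IsAdmissible A) (hχ : IsCellSolution A χ) :
    ∃ E : Fin 2 → Fin N → Fin N → Plane → ℝ, ∃ M : ℝ, 0 ≤ M ∧
      (∀ β i j, ContDiff ℝ 1 (E β i j)) ∧ (∀ β i j y, |E β i j y| ≤ M) ∧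
      (∀ β i j y, partialD 1 (E β i j) y = fluxDefect A χ 0 β i j y) ∧
      ∀ β i j y, partialD 0 (E β i j) y = - fluxDefect A χ 1 β i j y := by
  choose E h1 h2 h3 h4 using fun β i j =>
    exists_stream (b := fun α => fluxDefect A χ α β i j)
      (fun α => contDiff_fluxDefect hA hχ α β i j) (fun α => isPeriodic_fluxDefect hA hχ α β i j)
      (fun y => sum_partialD_fluxDefect hA hχ β i j y)
      (fun α => integral_fluxDefect hA hχ α β i j)
  choose M hM0 hM using h2
  refine ⟨E, ∑ β, ∑ i, ∑ j, M β i j, ?_, h1, fun β i j y => ?_, h3, h4⟩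
  · exact Finset.sum_nonneg fun β _ => Finset.sum_nonneg fun i _ => Finset.sum_nonneg fun j _ =>
      hM0 β i j
  · refine (hM β i j y).trans ?_
    have a1 := Finset.single_le_sum (f := fun j => M β i j) (fun j _ => hM0 β i j)
      (Finset.mem_univ j)
    have a2 := Finset.single_le_sum (f := fun i => ∑ j, M β i j)
      (fun i _ => Finset.sum_nonneg fun j _ => hM0 β i j) (Finset.mem_univ i)
    have a3 := Finset.single_le_sum (f := fun β => ∑ i, ∑ j, M β i j)
      (fun β _ => Finset.sum_nonneg fun i _ => Finset.sum_nonneg fun j _ => hM0 β i j)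
      (Finset.mem_univ β)
    exact a1.trans (a2.trans a3)

end FluxCorrector

/-! ### Calculus with the real-valued L² norm -/

section L2

variable {G H : Type*} [NormedAddCommGroup G] [NormedAddCommGroup H] {Ω : Opens Plane}

theorem l2Norm_nonneg (Ω : Opens Plane) (u : Plane → G) : 0 ≤ l2Norm Ω u := ENNReal.toReal_nonneg

theorem l2Norm_congr_ae {u v : Plane → G} (h : u =ᵐ[volume.restrict (Ω : Set Plane)] v) :
    l2Norm Ω u = l2Norm Ω v := by rw [l2Norm, l2Norm, eLpNorm_congr_ae h]

theorem l2Norm_norm (u : Plane → G) : l2Norm Ω (fun x => ‖u x‖) = l2Norm Ω u := by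
  rw [l2Norm, l2Norm, eLpNorm_norm]

theorem MemL2.norm {u : Plane → G} (hu : MemL2 Ω u) : MemL2 Ω fun x => ‖u x‖ := MemLp.norm hu

theorem MemL2.sub {u v : Plane → G} (hu : MemL2 Ω u) (hv : MemL2 Ω v) :
    MemL2 Ω fun x => u x - v x := MemLp.sub hu hv

theorem MemL2.add {u v : Plane → G} (hu : MemL2 Ω u) (hv : MemL2 Ω v) :
    MemL2 Ω fun x => u x + v x := MemLp.add hu hv

/-- Only the dominating function must be in L²: finiteness of its norm is what makes `toReal`
monotone here. -/
theorem l2Norm_le_of_norm_le {u : Plane → G} {v : Plane → H} (hv : MemL2 Ω v) {c : ℝ}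
    (hc : 0 ≤ c) (h : ∀ x ∈ Ω, ‖u x‖ ≤ c * ‖v x‖) : l2Norm Ω u ≤ c * l2Norm Ω v := by
  have h1 : ∀ᵐ x ∂volume.restrict (Ω : Set Plane), ‖u x‖ ≤ c * ‖v x‖ :=
    (ae_restrict_mem (measurableSet_opens Ω)).mono h
  have h2 := eLpNorm_le_mul_eLpNorm_of_ae_le_mul h1 2
  have h3 := ENNReal.toReal_mono (ENNReal.mul_ne_top ENNReal.ofReal_ne_top hv.2.ne) h2
  rwa [ENNReal.toReal_mul, ENNReal.toReal_ofReal hc] at h3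

theorem l2Norm_add_le {u v : Plane → G} (hu : MemL2 Ω u) (hv : MemL2 Ω v) :
    l2Norm Ω (fun x => u x + v x) ≤ l2Norm Ω u + l2Norm Ω v := by
  have h := eLpNorm_add_le hu.1 hv.1 (p := 2) (by norm_num)
  have h3 := ENNReal.toReal_mono (ENNReal.add_ne_top.2 ⟨hu.2.ne, hv.2.ne⟩) h
  rwa [ENNReal.toReal_add hu.2.ne hv.2.ne] at h3

theorem l2Norm_le_add {K : Type*} [NormedAddCommGroup K] {u : Plane → G} {v : Plane → H}
    {w : Plane → K} (hv : MemL2 Ω v) (hw : MemL2 Ω w)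
    (h : ∀ x ∈ Ω, ‖u x‖ ≤ ‖v x‖ + ‖w x‖) : l2Norm Ω u ≤ l2Norm Ω v + l2Norm Ω w := by
  rw [← l2Norm_norm v, ← l2Norm_norm w]
  refine le_trans ?_ (l2Norm_add_le hv.norm hw.norm)
  rw [← one_mul (l2Norm Ω fun x => ‖v x‖ + ‖w x‖)]
  refine l2Norm_le_of_norm_le (hv.norm.add hw.norm) zero_le_one fun x hx => ?_
  rw [one_mul, Real.norm_of_nonneg (by positivity)]
  exact h x hx

theorem l2Norm_sub_le {u v : Plane → G} (hu : MemL2 Ω u) (hv : MemL2 Ω v) :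
    l2Norm Ω (fun x => u x - v x) ≤ l2Norm Ω u + l2Norm Ω v :=
  l2Norm_le_add hu hv fun _ _ => norm_sub_le _ _

theorem l2Norm_pi_le {ι : Type*} [Fintype ι] {u : Plane → ι → G}
    (hu : ∀ i, MemL2 Ω fun x => u x i) :
    l2Norm Ω u ≤ ∑ i, l2Norm Ω fun x => u x i := by
  have h1 : eLpNorm u 2 (volume.restrict (Ω : Set Plane))
      ≤ ∑ i, eLpNorm (fun x => u x i) 2 (volume.restrict (Ω : Set Plane)) := by
    calc _ ≤ eLpNorm (∑ i, fun x => ‖u x i‖) 2 (volume.restrict (Ω : Set Plane)) := by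
          refine eLpNorm_mono_real fun x => ?_
          rw [Finset.sum_apply]
          refine (pi_norm_le_iff_of_nonneg (Finset.sum_nonneg fun i _ => norm_nonneg _)).2 fun i => ?_
          exact Finset.single_le_sum (f := fun i => ‖u x i‖) (fun i _ => norm_nonneg _)
            (Finset.mem_univ i)
      _ ≤ ∑ i, eLpNorm (fun x => ‖u x i‖) 2 (volume.restrict (Ω : Set Plane)) :=
        eLpNorm_sum_le (fun i _ => (hu i).norm.1) (by norm_num)
      _ = _ := by simp_rw [eLpNorm_norm]
  have h2 := ENNReal.toReal_mono (ENNReal.sum_ne_top.2 fun i _ => (hu i).2.ne) h1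
  rwa [ENNReal.toReal_sum fun i _ => (hu i).2.ne] at h2

theorem memL2_pi {ι : Type*} [Fintype ι] {u : Plane → ι → G}
    (hu : ∀ i, MemL2 Ω fun x => u x i) : MemL2 Ω u := memLp_pi_iff.2 hu

theorem memL2_of_hasCompactSupport {u : Plane → G} (hu : Continuous u)
    (hc : HasCompactSupport u) : MemL2 Ω u :=
  (hu.memLp_of_hasCompactSupport hc).restrict _

theorem sq_l2Norm {u : Plane → G} (hu : MemL2 Ω u) :
    l2Norm Ω u ^ 2 = ∫ x in (Ω : Set Plane), ‖u x‖ ^ 2 := by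
  rw [l2Norm, ← ENNReal.toReal_pow, eLpNorm_two_sq,
    integral_eq_lintegral_of_nonneg_ae (f := fun x => ‖u x‖ ^ 2) (ae_of_all _ fun x => by positivity)
      (hu.1.norm.pow 2)]
  congr 1
  refine lintegral_congr fun x => ?_
  rw [ENNReal.ofReal_pow (norm_nonneg _), ofReal_norm]

theorem integrable_and_abs_integral_le {T : Plane → ℝ} {u : Plane → G} {v : Plane → H}
    (hT : AEStronglyMeasurable T (volume.restrict (Ω : Set Plane))) (hu : MemL2 Ω u)
    (hv : MemL2 Ω v) {c : ℝ} (hc : 0 ≤ c) (h : ∀ x ∈ Ω, |T x| ≤ c * (‖u x‖ * ‖v x‖)) :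
    IntegrableOn T (Ω : Set Plane) ∧
      |∫ x in (Ω : Set Plane), T x| ≤ c * (l2Norm Ω u * l2Norm Ω v) := by
  have hm : Integrable (fun x => ‖u x‖ * ‖v x‖) (volume.restrict (Ω : Set Plane)) :=
    MemLp.integrable_mul hu.norm hv.norm
  have hcs : ∫ x in (Ω : Set Plane), ‖u x‖ * ‖v x‖ ≤ l2Norm Ω u * l2Norm Ω v := by
    have h0 := integral_mul_le_Lp_mul_Lq_of_nonneg Real.HolderConjugate.two_two
      (μ := volume.restrict (Ω : Set Plane)) (f := fun x => ‖u x‖) (g := fun x => ‖v x‖)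
      (ae_of_all _ fun x => norm_nonneg _) (ae_of_all _ fun x => norm_nonneg _)
      (by rw [ENNReal.ofReal_ofNat]; exact hu.norm)
      (by rw [ENNReal.ofReal_ofNat]; exact hv.norm)
    simp only [Real.rpow_two] at h0
    rwa [← sq_l2Norm hu, ← sq_l2Norm hv, ← Real.sqrt_eq_rpow, ← Real.sqrt_eq_rpow,
      Real.sqrt_sq (l2Norm_nonneg _ _), Real.sqrt_sq (l2Norm_nonneg _ _)] at h0
  have hae : ∀ᵐ x ∂volume.restrict (Ω : Set Plane), ‖T x‖ ≤ c * (‖u x‖ * ‖v x‖) :=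
    (ae_restrict_mem (measurableSet_opens Ω)).mono h
  refine ⟨(hm.const_mul c).mono' hT hae, ?_⟩
  calc _ ≤ ∫ x in (Ω : Set Plane), c * (‖u x‖ * ‖v x‖) :=
        norm_integral_le_of_norm_le (hm.const_mul c) hae
    _ ≤ _ := by
      rw [integral_const_mul]
      gcongr

end L2

/-! ### The bilinear form of the coefficients -/

section Bilinear

variable {N : ℕ} {Ω : Opens Plane}

/-- The values of a tensor field at a point. -/
abbrev Tensor (N : ℕ) : Type := Fin 2 → Fin 2 → Matrix (Fin N) (Fin N) ℝ

/-- The bilinear form `B^{αβ}_{ij} ξ^β_j η^α_i`. -/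
def bil (B : Tensor N) (ξ η : Fin 2 → Vec N) : ℝ :=
  ∑ α, ∑ β, ∑ i, ∑ j, B α β i j * ξ β j * η α i

theorem bil_sub_tensor (B C : Tensor N) (ξ η : Fin 2 → Vec N) :
    bil (B - C) ξ η = bil B ξ η - bil C ξ η := by
  simp only [bil, ← Finset.sum_sub_distrib, Pi.sub_apply, Matrix.sub_apply, sub_mul]

theorem bil_sub_left (B : Tensor N) (ξ ζ η : Fin 2 → Vec N) :
    bil B (ξ - ζ) η = bil B ξ η - bil B ζ η := by
  simp only [bil, ← Finset.sum_sub_distrib, Pi.sub_apply, PiLp.sub_apply, mul_sub, sub_mul]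

theorem bil_sub_right (B : Tensor N) (ξ ζ η : Fin 2 → Vec N) :
    bil B η (ξ - ζ) = bil B η ξ - bil B η ζ := by
  simp only [bil, ← Finset.sum_sub_distrib, Pi.sub_apply, PiLp.sub_apply, mul_sub]

theorem abs_entry_le (ξ : Fin 2 → Vec N) (α : Fin 2) (i : Fin N) : |ξ α i| ≤ ‖ξ‖ :=
  (PiLp.norm_apply_le (ξ α) i).trans (norm_le_pi_norm ξ α)

/-- The sum has 4N² terms, each at most M‖ξ‖‖η‖. -/
theorem abs_bil_le {B : Tensor N} {M : ℝ} (hB : ∀ α β i j, |B α β i j| ≤ M)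
    (ξ η : Fin 2 → Vec N) : |bil B ξ η| ≤ 4 * N ^ 2 * M * (‖ξ‖ * ‖η‖) := by
  have h : ∀ α β i j, |B α β i j * ξ β j * η α i| ≤ M * (‖ξ‖ * ‖η‖) := by
    intro α β i j
    rw [abs_mul, abs_mul, mul_assoc]
    have hM : 0 ≤ M := (abs_nonneg _).trans (hB α β i j)
    gcongr
    · exact hB α β i j
    · exact abs_entry_le ξ β j
    · exact abs_entry_le η α i
  calc |bil B ξ η| ≤ ∑ α, ∑ β, ∑ i, ∑ j, |B α β i j * ξ β j * η α i| := by
        refine (Finset.abs_sum_le_sum_abs _ _).trans (Finset.sum_le_sum fun α _ => ?_)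
        refine (Finset.abs_sum_le_sum_abs _ _).trans (Finset.sum_le_sum fun β _ => ?_)
        refine (Finset.abs_sum_le_sum_abs _ _).trans (Finset.sum_le_sum fun i _ => ?_)
        exact Finset.abs_sum_le_sum_abs _ _
    _ ≤ ∑ _α : Fin 2, ∑ _β : Fin 2, ∑ _i : Fin N, ∑ _j : Fin N, M * (‖ξ‖ * ‖η‖) := by
        gcongr; exact h _ _ _ _
    _ = _ := by simp; ring

theorem aestronglyMeasurable_bil {μ : Measure Plane} {B : Plane → Tensor N}
    (hB : ∀ α β i j, Continuous fun x => B x α β i j) {ξ η : Plane → Fin 2 → Vec N}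
    (hξ : AEStronglyMeasurable ξ μ) (hη : AEStronglyMeasurable η μ) :
    AEStronglyMeasurable (fun x => bil (B x) (ξ x) (η x)) μ := by
  have hc : ∀ (β : Fin 2) (j : Fin N), Continuous fun z : Fin 2 → Vec N => z β j := fun β j => by
    fun_prop
  unfold bil
  refine Finset.aestronglyMeasurable_fun_sum _ fun α _ => ?_
  refine Finset.aestronglyMeasurable_fun_sum _ fun β _ => ?_
  refine Finset.aestronglyMeasurable_fun_sum _ fun i _ => ?_
  refine Finset.aestronglyMeasurable_fun_sum _ fun j _ => ?_
  exact ((hB α β i j).aestronglyMeasurable.mul ((hc β j).comp_aestronglyMeasurable hξ)).mul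
    ((hc α i).comp_aestronglyMeasurable hη)

theorem bil_integrable_and_le {B : Plane → Tensor N} {M : ℝ} (hM : 0 ≤ M)
    (hBc : ∀ α β i j, Continuous fun x => B x α β i j) (hB : ∀ x α β i j, |B x α β i j| ≤ M)
    {ξ η : Plane → Fin 2 → Vec N} (hξ : MemL2 Ω ξ) (hη : MemL2 Ω η) :
    IntegrableOn (fun x => bil (B x) (ξ x) (η x)) (Ω : Set Plane) ∧
      |∫ x in (Ω : Set Plane), bil (B x) (ξ x) (η x)|
        ≤ 4 * N ^ 2 * M * (l2Norm Ω ξ * l2Norm Ω η) :=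
  integrable_and_abs_integral_le (aestronglyMeasurable_bil hBc hξ.1 hη.1) hξ hη (by positivity)
    fun x _ => abs_bil_le (hB x) _ _

theorem MemH1.memL2_weakGrad {u : Plane → Vec N} (hu : MemH1 Ω u) : MemL2 Ω (weakGrad Ω u) :=
  memL2_pi fun α => hu.memL2_weakPartial α

theorem memL2_grad {F : Type*} [NormedAddCommGroup F] [NormedSpace ℝ F] {u : Plane → F}
    (hu : ContDiff ℝ 1 u) (hc : HasCompactSupport u) : MemL2 Ω (grad u) :=
  memL2_of_hasCompactSupport (continuous_grad hu) (hasCompactSupport_grad hc)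

/-- A variational identity valid for test functions extends to `C¹` functions with compact
support. -/
theorem integral_bil_eq_of_testFunction {B C : Plane → Tensor N} {M : ℝ} (hM : 0 ≤ M)
    (hBc : ∀ α β i j, Continuous fun x => B x α β i j) (hB : ∀ x α β i j, |B x α β i j| ≤ M)
    (hCc : ∀ α β i j, Continuous fun x => C x α β i j) (hC : ∀ x α β i j, |C x α β i j| ≤ M)
    {ξ ζ : Plane → Fin 2 → Vec N} (hξ : MemL2 Ω ξ) (hζ : MemL2 Ω ζ)
    (h : ∀ φ : 𝓓(Ω, Vec N), ∫ x in (Ω : Set Plane), bil (B x) (ξ x) (grad φ x)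
      = ∫ x in (Ω : Set Plane), bil (C x) (ζ x) (grad φ x))
    {φ : Plane → Vec N} (hφ : ContDiff ℝ 1 φ) (hc : HasCompactSupport φ) (hs : tsupport φ ⊆ Ω) :
    ∫ x in (Ω : Set Plane), bil (B x) (ξ x) (grad φ x)
      = ∫ x in (Ω : Set Plane), bil (C x) (ζ x) (grad φ x) := by
  set K := 4 * N ^ 2 * M * ((l2Norm Ω ξ + l2Norm Ω ζ) * 2)
  have hK : 0 ≤ K := by
    have := l2Norm_nonneg Ω ξ
    have := l2Norm_nonneg Ω ζ
    positivity
  refine eq_of_abs_sub_nonpos (le_of_forall_pos_le_add fun e he => ?_)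
  rw [zero_add]
  -- Replacing ∇φ by ∇ψ changes the two sides by at most K e/(K + 1) ≤ e in total. The last factor 2
  -- in `K` counts the two components of the gradient.
  obtain ⟨ψ, hψ⟩ := exists_testFunction_approx hφ hc hs (δ := ENNReal.ofReal (e / (K + 1)))
    (by simp only [ENNReal.ofReal_pos]; positivity)
  have hψ1 : ContDiff ℝ 1 ψ := ψ.contDiff.of_le (by exact_mod_cast le_top)
  have m1 : MemL2 Ω (grad φ) := memL2_grad hφ hc
  have m2 : MemL2 Ω (grad (ψ : Plane → Vec N)) := memL2_grad hψ1 ψ.hasCompactSupport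
  have m3 : MemL2 Ω fun x => grad ψ x - grad φ x := m2.sub m1
  have hsm : l2Norm Ω (fun x => grad ψ x - grad φ x) ≤ 2 * (e / (K + 1)) := by
    refine (l2Norm_pi_le fun α => ?_).trans ?_
    · exact (m3.eval α)
    · calc _ ≤ ∑ _α : Fin 2, e / (K + 1) := by
            refine Finset.sum_le_sum fun α _ => ?_
            refine ENNReal.toReal_le_of_le_ofReal (by positivity) ?_
            exact (eLpNorm_mono_measure _ Measure.restrict_le_self).trans (hψ α)
        _ = _ := by simp
  have d : ∀ {B : Plane → Tensor N} {ξ : Plane → Fin 2 → Vec N},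
      (∀ α β i j, Continuous fun x => B x α β i j) → (∀ x α β i j, |B x α β i j| ≤ M) →
      MemL2 Ω ξ → ∫ x in (Ω : Set Plane), bil (B x) (ξ x) (grad φ x)
        = (∫ x in (Ω : Set Plane), bil (B x) (ξ x) (grad ψ x))
          - ∫ x in (Ω : Set Plane), bil (B x) (ξ x) (grad ψ x - grad φ x) := by
    intro B ξ hBc hB hξ
    rw [← integral_sub (bil_integrable_and_le hM hBc hB hξ m2).1
      (bil_integrable_and_le hM hBc hB hξ m3).1]
    refine integral_congr_ae (ae_of_all _ fun x => ?_)
    simp only [bil_sub_right]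
    ring
  rw [d hBc hB hξ, d hCc hC hζ, h ψ]
  have b1 := (bil_integrable_and_le hM hBc hB hξ m3).2
  have b2 := (bil_integrable_and_le hM hCc hC hζ m3).2
  set I := ∫ x in (Ω : Set Plane), bil (B x) (ξ x) (grad ψ x - grad φ x)
  set J := ∫ x in (Ω : Set Plane), bil (C x) (ζ x) (grad ψ x - grad φ x)
  set t := l2Norm Ω fun x => grad ψ x - grad φ x
  set X := ∫ x in (Ω : Set Plane), bil (C x) (ζ x) (grad ψ x)
  calc |X - I - (X - J)| = |J - I| := by congr 1; ring
    _ ≤ |J| + |I| := abs_sub _ _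
    _ ≤ 4 * N ^ 2 * M * (l2Norm Ω ζ * t) + 4 * N ^ 2 * M * (l2Norm Ω ξ * t) := add_le_add b2 b1
    _ = 4 * N ^ 2 * M * (l2Norm Ω ξ + l2Norm Ω ζ) * t := by ring
    _ ≤ 4 * N ^ 2 * M * (l2Norm Ω ξ + l2Norm Ω ζ) * (2 * (e / (K + 1))) := by
      have := l2Norm_nonneg Ω ξ
      have := l2Norm_nonneg Ω ζ
      gcongr
    _ = K / (K + 1) * e := by simp only [K]; ring
    _ ≤ 1 * e := by
      gcongr
      rw [div_le_one (by positivity)]; linarith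
    _ = e := one_mul e

end Bilinear

/-! ### Product rules and integration by parts -/

section Calculus

variable {N : ℕ} {Ω : Opens Plane}

theorem partialD_mul {f g : Plane → ℝ} {x : Plane} (hf : DifferentiableAt ℝ f x)
    (hg : DifferentiableAt ℝ g x) (α : Fin 2) :
    partialD α (fun y => f y * g y) x = partialD α f x * g x + f x * partialD α g x := by
  have h := hf.hasFDerivAt.mul hg.hasFDerivAt
  have e : fderiv ℝ (fun y => f y * g y) x = f x • fderiv ℝ g x + g x • fderiv ℝ f x := h.fderiv
  rw [partialD, e]
  simp [partialD]
  ring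

theorem partialD_const_mul {f : Plane → ℝ} {x : Plane} (hf : DifferentiableAt ℝ f x) (c : ℝ)
    (α : Fin 2) : partialD α (fun y => c * f y) x = c * partialD α f x := by
  rw [partialD, fderiv_const_mul hf]
  rfl

theorem partialD_sum {ι : Type*} (s : Finset ι) {f : ι → Plane → ℝ} {x : Plane}
    (hf : ∀ i ∈ s, DifferentiableAt ℝ (f i) x) (α : Fin 2) :
    partialD α (fun y => ∑ i ∈ s, f i y) x = ∑ i ∈ s, partialD α (f i) x := by
  rw [partialD, fderiv_fun_sum hf, sum_apply]
  rfl

theorem partialD_comp_smul {f : Plane → ℝ} (hf : Differentiable ℝ f) (c : ℝ) (α : Fin 2)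
    (x : Plane) : partialD α (fun y => f (c • y)) x = c * partialD α f (c • x) := by
  have h1 : HasFDerivAt (fun y : Plane => c • y) (c • ContinuousLinearMap.id ℝ Plane) x :=
    (hasFDerivAt_id x).const_smul c
  have h2 : HasFDerivAt (fun y => f (c • y)) _ x := (hf (c • x)).hasFDerivAt.comp x h1
  rw [partialD, h2.fderiv]
  simp [partialD]

theorem partialD_apply {u : Plane → Vec N} {x : Plane} (hu : DifferentiableAt ℝ u x) (α : Fin 2)
    (j : Fin N) : partialD α u x j = partialD α (fun y => u y j) x := by
  have h : HasFDerivAt (fun y => u y j) ((EuclideanSpace.proj j).comp (fderiv ℝ u x)) x :=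
    (EuclideanSpace.proj j : Vec N →L[ℝ] ℝ).hasFDerivAt.comp x hu.hasFDerivAt
  rw [partialD, partialD, h.fderiv]
  rfl

theorem contDiff_partialD {f : Plane → ℝ} (hf : ContDiff ℝ 2 f) (α : Fin 2) :
    ContDiff ℝ 1 (partialD α f) :=
  (hf.fderiv_right (m := 1) (by norm_num)).clm_apply contDiff_const

theorem partialD_comm {f : Plane → ℝ} (hf : ContDiff ℝ 2 f) (α β : Fin 2) (x : Plane) :
    partialD α (partialD β f) x = partialD β (partialD α f) x := by
  have hs : IsSymmSndFDerivAt ℝ f x := hf.contDiffAt.isSymmSndFDerivAt (by simp)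
  have hd : DifferentiableAt ℝ (fderiv ℝ f) x :=
    (hf.fderiv_right (m := 1) (by norm_num)).differentiable one_ne_zero x
  have h : ∀ a b : Fin 2, partialD a (partialD b f) x
      = fderiv ℝ (fderiv ℝ f) x (basisVec a) (basisVec b) := by
    intro a b
    have h1 : HasFDerivAt (partialD b f) _ x := hd.hasFDerivAt.clm_apply (hasFDerivAt_const _ _)
    rw [partialD, h1.fderiv]
    simp
  rw [h, h]
  exact hs _ _

theorem integral_mul_partialD {Ψ G : Plane → ℝ} (hΨ : ContDiff ℝ 1 Ψ) (hG : ContDiff ℝ 1 G)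
    (hc : HasCompactSupport G) (α : Fin 2) :
    ∫ x, partialD α Ψ x * G x = - ∫ x, Ψ x * partialD α G x := by
  have i1 : Integrable (fun x => fderiv ℝ Ψ x (basisVec α) * G x) volume :=
    ((continuous_partialD hΨ α).mul hG.continuous).integrable_of_hasCompactSupport hc.mul_left
  have i2 : Integrable (fun x => Ψ x * fderiv ℝ G x (basisVec α)) volume :=
    (hΨ.continuous.mul (continuous_partialD hG α)).integrable_of_hasCompactSupport
      (hasCompactSupport_partialD hc α).mul_left
  have i3 : Integrable (fun x => Ψ x * G x) volume :=
    (hΨ.continuous.mul hG.continuous).integrable_of_hasCompactSupport hc.mul_left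
  have := integral_mul_fderiv_eq_neg_fderiv_mul_of_integrable (v := basisVec α) i1 i2 i3
    (fun x _ => hΨ.differentiable one_ne_zero x) (fun x _ => hG.differentiable one_ne_zero x)
  simp only [partialD]
  rw [this, neg_neg]

/-- Integration by parts against a rotated gradient: the second derivatives of `φ` cancel. -/
theorem integral_rotated_gradient {Ψ q φ : Plane → ℝ} (hΨ : ContDiff ℝ 1 Ψ) (hq : ContDiff ℝ 1 q)
    (hc : HasCompactSupport q) (hφ : ContDiff ℝ 2 φ) :
    ∫ x, (partialD 1 Ψ x * (q x * partialD 0 φ x) - partialD 0 Ψ x * (q x * partialD 1 φ x))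
      = - ∫ x, Ψ x * (partialD 1 q x * partialD 0 φ x - partialD 0 q x * partialD 1 φ x) := by
  have hG : ∀ α, ContDiff ℝ 1 fun x => q x * partialD α φ x := fun α =>
    hq.mul (contDiff_partialD hφ α)
  have hGc : ∀ α, HasCompactSupport fun x => q x * partialD α φ x := fun α => hc.mul_right
  have i1 : ∀ α β, Integrable (fun x => partialD α Ψ x * (q x * partialD β φ x)) volume :=
    fun α β => ((continuous_partialD hΨ α).mul (hG β).continuous).integrable_of_hasCompactSupport
      (hGc β).mul_left
  have i2 : ∀ α β, Integrable (fun x => Ψ x * partialD α (fun y => q y * partialD β φ y) x)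
      volume := fun α β =>
    (hΨ.continuous.mul (continuous_partialD (hG β) α)).integrable_of_hasCompactSupport
      (hasCompactSupport_partialD (hGc β) α).mul_left
  rw [integral_sub (i1 1 0) (i1 0 1), integral_mul_partialD hΨ (hG 0) (hGc 0),
    integral_mul_partialD hΨ (hG 1) (hGc 1), ← neg_sub', neg_inj, ← integral_sub (i2 1 0) (i2 0 1)]
  refine integral_congr_ae (ae_of_all _ fun x => ?_)
  have hd := fun α => (contDiff_partialD hφ α).differentiable one_ne_zero x
  simp only
  rw [partialD_mul (hq.differentiable one_ne_zero x) (hd 0),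
    partialD_mul (hq.differentiable one_ne_zero x) (hd 1), partialD_comm hφ 1 0]
  ring

end Calculus

/-! ### The corrector and the two-scale identity -/

section Corrector

variable {N : ℕ} {Ω : Opens Plane} {A : TensorField N}
  {χ : Fin 2 → Plane → Matrix (Fin N) (Fin N) ℝ}

/-- The correction term `ε χ^β(x/ε) q^β(x)`. -/
noncomputable def corrector (χ : Fin 2 → Plane → Matrix (Fin N) (Fin N) ℝ) (ε : ℝ)
    (q : Fin 2 → Plane → Vec N) (x : Plane) : Vec N :=
  WithLp.toLp 2 fun j => ε * ∑ β, ∑ k, χ β (ε⁻¹ • x) j k * q β x k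

/-- The field `χ^β(x/ε) ∂_γ q^β(x)`. -/
noncomputable def correctorRemainder (χ : Fin 2 → Plane → Matrix (Fin N) (Fin N) ℝ) (ε : ℝ)
    (q : Fin 2 → Plane → Vec N) (x : Plane) : Fin 2 → Vec N :=
  fun γ => WithLp.toLp 2 fun j => ∑ β, ∑ k, χ β (ε⁻¹ • x) j k * partialD γ (q β) x k

/-- The flux `A ∇χ` of the corrector. -/
noncomputable def correctorFlux (A : TensorField N)
    (χ : Fin 2 → Plane → Matrix (Fin N) (Fin N) ℝ) (y : Plane) : Tensor N :=
  fun α β => Matrix.of fun i j => ∑ γ, ∑ k, A α γ y i k * partialD γ (fun z => χ β z k j) y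

theorem contDiff_entry {n : WithTop ℕ∞} {u : Plane → Vec N} (hu : ContDiff ℝ n u) (j : Fin N) :
    ContDiff ℝ n fun x => u x j :=
  contDiff_euclidean.1 hu j

theorem contDiff_corrector (hχ : IsCellSolution A χ) (ε : ℝ) {q : Fin 2 → Plane → Vec N}
    (hq : ∀ β, ContDiff ℝ 2 (q β)) : ContDiff ℝ 2 (corrector χ ε q) := by
  refine contDiff_euclidean.2 fun j => contDiff_const.mul ?_
  refine ContDiff.sum fun β _ => ContDiff.sum fun k _ => ?_
  exact ((hχ.regular β j k).comp (contDiff_const_smul _)).mul (contDiff_entry (hq β) k)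

theorem tsupport_corrector_subset (ε : ℝ) (q : Fin 2 → Plane → Vec N) :
    tsupport (corrector χ ε q) ⊆ ⋃ β, tsupport (q β) := by
  refine closure_minimal (fun x hx => ?_) (isClosed_iUnion_of_finite fun β => isClosed_tsupport _)
  by_contra hc
  refine hx ?_
  have h0 : ∀ β, q β x = 0 := fun β =>
    image_eq_zero_of_notMem_tsupport fun h => hc (mem_iUnion.2 ⟨β, h⟩)
  ext j
  simp [corrector, h0]

theorem hasCompactSupport_corrector (ε : ℝ) {q : Fin 2 → Plane → Vec N}
    (hq : ∀ β, HasCompactSupport (q β)) : HasCompactSupport (corrector χ ε q) :=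
  (isCompact_iUnion hq).of_isClosed_subset (isClosed_tsupport _) (tsupport_corrector_subset ε q)

/-- The chain rule factor ε⁻¹ from χ(x/ε) cancels the prefactor ε, leaving (∇χ)(x/ε) q of order one;
only the derivative falling on `q` keeps the factor ε. -/
theorem grad_corrector (hχ : IsCellSolution A χ) {ε : ℝ} (hε : ε ≠ 0) {q : Fin 2 → Plane → Vec N}
    (hq : ∀ β, ContDiff ℝ 2 (q β)) (x : Plane) (γ : Fin 2) (j : Fin N) :
    grad (corrector χ ε q) x γ j
      = (∑ β, ∑ k, partialD γ (fun z => χ β z j k) (ε⁻¹ • x) * q β x k)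
        + ε * correctorRemainder χ ε q x γ j := by
  have hd : DifferentiableAt ℝ (corrector χ ε q) x :=
    (contDiff_corrector hχ ε hq).differentiable two_ne_zero x
  have dχ : ∀ β k, Differentiable ℝ fun z => χ β z j k := fun β k =>
    (hχ.regular β j k).differentiable two_ne_zero
  have dχε : ∀ β k, DifferentiableAt ℝ (fun z => χ β (ε⁻¹ • z) j k) x := fun β k =>
    ((hχ.regular β j k).comp (contDiff_const_smul _)).differentiable two_ne_zero x
  have dq : ∀ β k, DifferentiableAt ℝ (fun z => q β z k) x := fun β k =>
    (contDiff_entry (hq β) k).differentiable two_ne_zero x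
  have dm : ∀ β k, DifferentiableAt ℝ (fun z => χ β (ε⁻¹ • z) j k * q β z k) x := fun β k =>
    (dχε β k).mul (dq β k)
  have ds : ∀ β, DifferentiableAt ℝ (fun z => ∑ k, χ β (ε⁻¹ • z) j k * q β z k) x := fun β =>
    DifferentiableAt.fun_sum fun k _ => dm β k
  have e1 : grad (corrector χ ε q) x γ j
      = partialD γ (fun z => ε * ∑ β, ∑ k, χ β (ε⁻¹ • z) j k * q β z k) x := partialD_apply hd γ j
  rw [e1, partialD_const_mul (DifferentiableAt.fun_sum fun β _ => ds β),
    partialD_sum _ fun β _ => ds β]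
  simp only [correctorRemainder]
  rw [← mul_inv_cancel_left₀ hε (∑ β, ∑ k, _), ← mul_add]
  congr 1
  rw [Finset.mul_sum, ← Finset.sum_add_distrib]
  refine Finset.sum_congr rfl fun β _ => ?_
  rw [partialD_sum _ fun k _ => dm β k, Finset.mul_sum, ← Finset.sum_add_distrib]
  refine Finset.sum_congr rfl fun k _ => ?_
  rw [partialD_mul (dχε β k) (dq β k), partialD_comp_smul (dχ β k),
    partialD_apply ((hq β).differentiable two_ne_zero x)]
  ring

theorem sum_comm_four {ι κ : Type*} [Fintype ι] [Fintype κ] (f : ι → κ → ι → κ → ℝ) :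
    ∑ a, ∑ b, ∑ c, ∑ d, f a b c d = ∑ c, ∑ d, ∑ a, ∑ b, f a b c d := by
  have h := Finset.sum_comm (s := (Finset.univ : Finset (ι × κ)))
    (t := (Finset.univ : Finset (ι × κ))) (f := fun p r => f p.1 p.2 r.1 r.2)
  simpa only [Fintype.sum_prod_type] using h

/-- Associativity of the contractions: A applied to (∇χ) p equals (A∇χ) applied to `p`. -/
theorem bil_correctorFlux (y : Plane) (p η : Fin 2 → Vec N) (z : Fin 2 → Vec N)
    (hz : ∀ γ k, z γ k = ∑ β, ∑ j, partialD γ (fun w => χ β w k j) y * p β j) :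
    bil (fun α β => A α β y) z η = bil (correctorFlux A χ y) p η := by
  unfold bil
  refine Finset.sum_congr rfl fun α _ => ?_
  rw [Finset.sum_comm, Finset.sum_comm (s := Finset.univ (α := Fin 2))]
  refine Finset.sum_congr rfl fun i _ => ?_
  simp only [correctorFlux, Matrix.of_apply, hz, Finset.mul_sum, Finset.sum_mul]
  rw [sum_comm_four]
  simp only [mul_assoc]

theorem bil_add_smul (B : Tensor N) (ξ ζ η : Fin 2 → Vec N) (c : ℝ) :
    bil B (fun γ => ξ γ + c • ζ γ) η = bil B ξ η + c * bil B ζ η := by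
  simp only [bil, Finset.mul_sum, ← Finset.sum_add_distrib, PiLp.add_apply, PiLp.smul_apply,
    smul_eq_mul]
  refine Finset.sum_congr rfl fun α _ => Finset.sum_congr rfl fun β _ =>
    Finset.sum_congr rfl fun i _ => Finset.sum_congr rfl fun j _ => ?_
  ring

theorem bil_grad_corrector (hχ : IsCellSolution A χ) {ε : ℝ} (hε : ε ≠ 0)
    {q : Fin 2 → Plane → Vec N} (hq : ∀ β, ContDiff ℝ 2 (q β)) (x : Plane) (η : Fin 2 → Vec N) :
    bil (fun α β => oscillating A ε α β x) (grad (corrector χ ε q) x) η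
      = bil (correctorFlux A χ (ε⁻¹ • x)) (fun β => q β x) η
        + ε * bil (fun α β => oscillating A ε α β x) (correctorRemainder χ ε q x) η := by
  set z : Fin 2 → Vec N := fun γ => WithLp.toLp 2 fun k =>
    ∑ β, ∑ j, partialD γ (fun w => χ β w k j) (ε⁻¹ • x) * q β x j with hz
  have e : grad (corrector χ ε q) x = fun γ => z γ + ε • correctorRemainder χ ε q x γ := by
    funext γ
    ext j
    rw [grad_corrector hχ hε hq]
    simp [hz]
  rw [e, bil_add_smul]
  congr 1
  exact bil_correctorFlux (A := A) (ε⁻¹ • x) (fun β => q β x) η z fun γ k => rfl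

/-- The algebraic identity behind the two-scale expansion. -/
theorem bil_two_scale (hχ : IsCellSolution A χ) {ε : ℝ} (hε : ε ≠ 0)
    {q : Fin 2 → Plane → Vec N} (hq : ∀ β, ContDiff ℝ 2 (q β)) (x : Plane)
    (ξ ζ η : Fin 2 → Vec N) :
    bil (fun α β => oscillating A ε α β x) (ξ - ζ - grad (corrector χ ε q) x) η
      = (bil (fun α β => oscillating A ε α β x) ξ η - bil (fun α β => homogenized A χ α β x) ζ η)
        + bil ((fun α β => homogenized A χ α β x) - fun α β => oscillating A ε α β x)
            (ζ - fun β => q β x) η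
        + bil (fun α β => Matrix.of fun i j => fluxDefect A χ α β i j (ε⁻¹ • x))
            (fun β => q β x) η
        - ε * bil (fun α β => oscillating A ε α β x) (correctorRemainder χ ε q x) η := by
  have e : (fun α β => Matrix.of fun i j => fluxDefect A χ α β i j (ε⁻¹ • x) : Tensor N)
      = (fun α β => homogenized A χ α β x) - (fun α β => oscillating A ε α β x)
        - correctorFlux A χ (ε⁻¹ • x) := by
    funext α β
    ext i j
    rfl
  rw [e, bil_sub_left, bil_sub_left, bil_grad_corrector hχ hε hq]
  simp only [bil_sub_tensor, bil_sub_left]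
  ring

end Corrector

/-! ### Bounds on the corrector terms -/

section Estimates

variable {N : ℕ} {Ω : Opens Plane} {A : TensorField N}
  {χ : Fin 2 → Plane → Matrix (Fin N) (Fin N) ℝ}

/-- The gradients of a family of vector fields. -/
noncomputable def gradFamily (q : Fin 2 → Plane → Vec N) (x : Plane) : Fin 2 → Fin 2 → Vec N :=
  fun β => grad (q β) x

theorem abs_entry_gradFamily_le (q : Fin 2 → Plane → Vec N) (x : Plane) (β γ : Fin 2)
    (j : Fin N) : |partialD γ (q β) x j| ≤ ‖gradFamily q x‖ :=
  (abs_entry_le (grad (q β) x) γ j).trans (norm_le_pi_norm (gradFamily q x) β)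

theorem memL2_gradFamily {q : Fin 2 → Plane → Vec N} (hq : ∀ β, ContDiff ℝ 1 (q β))
    (hc : ∀ β, HasCompactSupport (q β)) : MemL2 Ω (gradFamily q) :=
  memL2_pi fun β => memL2_grad (hq β) (hc β)

theorem memL2_family {q : Fin 2 → Plane → Vec N} (hq : ∀ β, ContDiff ℝ 1 (q β))
    (hc : ∀ β, HasCompactSupport (q β)) : MemL2 Ω (fun x β => q β x) :=
  memL2_pi fun β => memL2_of_hasCompactSupport (hq β).continuous (hc β)

theorem norm_vec_le {v : Vec N} {c : ℝ} (h : ∀ j, |v j| ≤ c) : ‖v‖ ≤ N * c := by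
  have e : v = ∑ j, EuclideanSpace.single j (v j) := by
    ext i
    simp [Finset.sum_apply]
  rw [e]
  refine (norm_sum_le _ _).trans ?_
  calc _ ≤ ∑ _j : Fin N, c := Finset.sum_le_sum fun j _ => by simpa using h j
    _ = _ := by simp

theorem abs_sum_mul_le {m : Fin 2 → Fin N → ℝ} {v : Fin 2 → Fin N → ℝ} {M c : ℝ}
    (hm : ∀ β k, |m β k| ≤ M) (hv : ∀ β k, |v β k| ≤ c) :
    |∑ β, ∑ k, m β k * v β k| ≤ 2 * N * (M * c) := by
  calc _ ≤ ∑ β, ∑ k, |m β k * v β k| :=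
        (Finset.abs_sum_le_sum_abs _ _).trans
          (Finset.sum_le_sum fun β _ => Finset.abs_sum_le_sum_abs _ _)
    _ ≤ ∑ _β : Fin 2, ∑ _k : Fin N, M * c := by
        refine Finset.sum_le_sum fun β _ => Finset.sum_le_sum fun k _ => ?_
        rw [abs_mul]
        exact mul_le_mul (hm β k) (hv β k) (abs_nonneg _) ((abs_nonneg _).trans (hm β k))
    _ = _ := by simp; ring

/-- Each entry is a sum of 2N products, and passing from entries to the Euclidean norm costs another
N. -/
theorem norm_correctorRemainder_le {M : ℝ} (hM : 0 ≤ M) (hχM : ∀ β j k y, |χ β y j k| ≤ M) (ε : ℝ)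
    (q : Fin 2 → Plane → Vec N) (x : Plane) :
    ‖correctorRemainder χ ε q x‖ ≤ 2 * N ^ 2 * M * ‖gradFamily q x‖ := by
  refine (pi_norm_le_iff_of_nonneg (by positivity)).2 fun γ => ?_
  refine (norm_vec_le fun j => abs_sum_mul_le (fun β k => hχM β j k (ε⁻¹ • x))
    fun β k => abs_entry_gradFamily_le q x β γ k).trans (le_of_eq ?_)
  ring

theorem norm_corrector_le {M : ℝ} (hχM : ∀ β j k y, |χ β y j k| ≤ M) {ε : ℝ}
    (hε : 0 < ε) (q : Fin 2 → Plane → Vec N) (x : Plane) :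
    ‖corrector χ ε q x‖ ≤ 2 * N ^ 2 * M * ε * ‖fun β => q β x‖ := by
  have h : ∀ j, |corrector χ ε q x j| ≤ ε * (2 * N * (M * ‖fun β => q β x‖)) := by
    intro j
    change |ε * ∑ β, ∑ k, χ β (ε⁻¹ • x) j k * q β x k| ≤ _
    rw [abs_mul, abs_of_pos hε]
    gcongr
    exact abs_sum_mul_le (fun β k => hχM β j k (ε⁻¹ • x))
      fun β k => abs_entry_le (fun β => q β x) β k
  exact (norm_vec_le h).trans (le_of_eq (by ring))

theorem continuous_correctorRemainder (hχ : IsCellSolution A χ) (ε : ℝ)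
    {q : Fin 2 → Plane → Vec N} (hq : ∀ β, ContDiff ℝ 1 (q β)) :
    Continuous (correctorRemainder χ ε q) := by
  refine continuous_pi fun γ => ?_
  refine (PiLp.continuous_toLp 2 _).comp (continuous_pi fun j => ?_)
  refine continuous_finsetSum _ fun β _ => continuous_finsetSum _ fun k _ => ?_
  have h1 := (hχ.regular β j k).continuous
  have h2 := continuous_partialD (hq β) γ
  fun_prop

theorem memL2_correctorRemainder (hχ : IsCellSolution A χ) {M : ℝ} (hM : 0 ≤ M)
    (hχM : ∀ β j k y, |χ β y j k| ≤ M) (ε : ℝ)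
    {q : Fin 2 → Plane → Vec N} (hq : ∀ β, ContDiff ℝ 1 (q β))
    (hc : ∀ β, HasCompactSupport (q β)) : MemL2 Ω (correctorRemainder χ ε q) :=
  MemLp.of_le_mul (c := 2 * N ^ 2 * M) (memL2_gradFamily hq hc)
    (continuous_correctorRemainder hχ ε hq).aestronglyMeasurable
    (ae_of_all _ fun x => norm_correctorRemainder_le hM hχM ε q x)

theorem grad_eq_zero_of_notMem {F : Type*} [NormedAddCommGroup F] [NormedSpace ℝ F] {u : Plane → F}
    {x : Plane} (hx : x ∉ tsupport u) (α : Fin 2) : partialD α u x = 0 :=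
  image_eq_zero_of_notMem_tsupport fun h => hx (tsupport_partialD_subset u α h)

/-- The oscillating flux defect is small in the dual sense. -/
theorem abs_integral_fluxDefect_le {E : Fin 2 → Fin N → Fin N → Plane → ℝ} {M : ℝ} (hM : 0 ≤ M)
    (hE : ∀ β i j, ContDiff ℝ 1 (E β i j)) (hEM : ∀ β i j y, |E β i j y| ≤ M)
    (hE1 : ∀ β i j y, partialD 1 (E β i j) y = fluxDefect A χ 0 β i j y)
    (hE0 : ∀ β i j y, partialD 0 (E β i j) y = - fluxDefect A χ 1 β i j y)
    {ε : ℝ} (hε : 0 < ε) {q : Fin 2 → Plane → Vec N} (hq : ∀ β, ContDiff ℝ 1 (q β))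
    (hqc : ∀ β, HasCompactSupport (q β)) {φ : Plane → Vec N} (hφ : ContDiff ℝ 2 φ)
    (hφc : HasCompactSupport φ) (hφs : tsupport φ ⊆ Ω) :
    |∫ x in (Ω : Set Plane), bil (fun α β => Matrix.of fun i j => fluxDefect A χ α β i j (ε⁻¹ • x))
        (fun β => q β x) (grad φ x)|
      ≤ 4 * N ^ 2 * M * ε * (l2Norm Ω (gradFamily q) * l2Norm Ω (grad φ)) := by
  have hφ1 : ContDiff ℝ 1 φ := hφ.of_le (by norm_num)
  -- Differentiating the rescaled stream function produces ε⁻¹ times the defect at x/ε. So the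
  -- defect is ε times a rotated gradient, with Ψ still bounded by `M`: this is where the factor ε
  -- is gained.
  set Ψ : Fin 2 → Fin N → Fin N → Plane → ℝ := fun β i j x => E β i j (ε⁻¹ • x) with hΨ
  have hΨ1 : ∀ β i j, ContDiff ℝ 1 (Ψ β i j) := fun β i j =>
    (hE β i j).comp (contDiff_const_smul _)
  have dΨ : ∀ α β i j x, partialD α (Ψ β i j) x = ε⁻¹ * partialD α (E β i j) (ε⁻¹ • x) :=
    fun α β i j x => partialD_comp_smul ((hE β i j).differentiable one_ne_zero) _ α x
  have dq : ∀ α β j x, partialD α (fun y => q β y j) x = partialD α (q β) x j := fun α β j x =>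
    (partialD_apply ((hq β).differentiable one_ne_zero x) α j).symm
  have dφ : ∀ α i x, partialD α (fun y => φ y i) x = partialD α φ x i := fun α i x =>
    (partialD_apply (hφ1.differentiable one_ne_zero x) α i).symm
  set T : Fin 2 → Fin N → Fin N → Plane → ℝ := fun β i j x =>
    partialD 1 (Ψ β i j) x * (q β x j * partialD 0 (fun y => φ y i) x)
      - partialD 0 (Ψ β i j) x * (q β x j * partialD 1 (fun y => φ y i) x) with hT
  set R : Fin 2 → Fin N → Fin N → Plane → ℝ := fun β i j x =>
    Ψ β i j x * (partialD 1 (fun y => q β y j) x * partialD 0 (fun y => φ y i) x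
      - partialD 0 (fun y => q β y j) x * partialD 1 (fun y => φ y i) x) with hR
  have hbil : ∀ x, bil (fun α β => Matrix.of fun i j => fluxDefect A χ α β i j (ε⁻¹ • x))
        (fun β => q β x) (grad φ x) = ∑ β, ∑ i, ∑ j, ε * T β i j x := by
    intro x
    unfold bil
    rw [Fin.sum_univ_two, ← Finset.sum_add_distrib]
    refine Finset.sum_congr rfl fun β _ => ?_
    rw [← Finset.sum_add_distrib]
    refine Finset.sum_congr rfl fun i _ => ?_
    rw [← Finset.sum_add_distrib]
    refine Finset.sum_congr rfl fun j _ => ?_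
    simp only [hT, dΨ, dφ, hE1, hE0, Matrix.of_apply, grad]
    field_simp
    ring
  have hcq : ∀ β j, HasCompactSupport fun x => q β x j := fun β j =>
    (hqc β).comp_left (g := fun v : Vec N => v j) rfl
  have hTi : ∀ β i j, Integrable (T β i j) volume := by
    intro β i j
    have c0 : Continuous fun x => q β x j := (contDiff_entry (hq β) j).continuous
    -- `α.rev` is the other of the two indices.
    have c1 : ∀ α, Continuous fun x => partialD α (Ψ β i j) x *
        (q β x j * partialD α.rev (fun y => φ y i) x) := fun α =>
      (continuous_partialD (hΨ1 β i j) α).mul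
        (c0.mul (continuous_partialD (contDiff_entry hφ1 i) _))
    have s1 : ∀ α, HasCompactSupport fun x => partialD α (Ψ β i j) x *
        (q β x j * partialD α.rev (fun y => φ y i) x) := fun α => (hcq β j).mul_right.mul_left
    exact ((c1 1).integrable_of_hasCompactSupport (s1 1)).sub
      ((c1 0).integrable_of_hasCompactSupport (s1 0))
  have hRb : ∀ β i j, |∫ x, T β i j x| ≤ 2 * M * (l2Norm Ω (gradFamily q) * l2Norm Ω (grad φ)) := by
    intro β i j
    rw [integral_rotated_gradient (hΨ1 β i j) (contDiff_entry (hq β) j) (hcq β j)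
      (contDiff_entry hφ i), abs_neg]
    -- Integration by parts takes place on the whole plane and Cauchy–Schwarz on Ω; the two
    -- integrals agree because φ is supported in Ω.
    have hset : ∫ x in (Ω : Set Plane), R β i j x = ∫ x, R β i j x := by
      refine setIntegral_eq_integral_of_forall_compl_eq_zero fun x hx => ?_
      have h0 := fun α => grad_eq_zero_of_notMem (fun h => hx (hφs h)) α
      simp [hR, dφ, h0]
    have hRc : Continuous (R β i j) := by
      have c1 := fun α => continuous_partialD (contDiff_entry (hq β) j) α
      have c2 := fun α => continuous_partialD (contDiff_entry hφ1 i) α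
      exact (hΨ1 β i j).continuous.mul (((c1 1).mul (c2 0)).sub ((c1 0).mul (c2 1)))
    change |∫ x, R β i j x| ≤ _
    rw [← hset]
    refine (integrable_and_abs_integral_le hRc.aestronglyMeasurable (memL2_gradFamily hq hqc)
      (memL2_grad hφ1 hφc) (by positivity) fun x _ => ?_).2
    have hp : ∀ α γ, |partialD α (fun y => q β y j) x * partialD γ (fun y => φ y i) x|
        ≤ ‖gradFamily q x‖ * ‖grad φ x‖ := by
      intro α γ
      rw [abs_mul, dq, dφ]
      gcongr
      · exact abs_entry_gradFamily_le q x β α j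
      · exact abs_entry_le (grad φ x) γ i
    simp only [hR]
    rw [abs_mul, mul_comm 2 M, mul_assoc]
    refine mul_le_mul (hEM β i j _) ?_ (abs_nonneg _) hM
    refine (abs_sub _ _).trans ?_
    linarith [hp 1 0, hp 0 1]
  have hfull : ∫ x in (Ω : Set Plane),
      bil (fun α β => Matrix.of fun i j => fluxDefect A χ α β i j (ε⁻¹ • x))
        (fun β => q β x) (grad φ x) = ∑ β, ∑ i, ∑ j, ε * ∫ x, T β i j x := by
    rw [setIntegral_eq_integral_of_forall_compl_eq_zero]
    · simp_rw [hbil]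
      rw [integral_finsetSum _ fun β _ => integrable_finsetSum _ fun i _ =>
        integrable_finsetSum _ fun j _ => (hTi β i j).const_mul ε]
      refine Finset.sum_congr rfl fun β _ => ?_
      rw [integral_finsetSum _ fun i _ =>
        integrable_finsetSum _ fun j _ => (hTi β i j).const_mul ε]
      refine Finset.sum_congr rfl fun i _ => ?_
      rw [integral_finsetSum _ fun j _ => (hTi β i j).const_mul ε]
      simp_rw [integral_const_mul]
    · intro x hx
      have h0 : ∀ α, grad φ x α = 0 := fun α => grad_eq_zero_of_notMem (fun h => hx (hφs h)) α
      simp [bil, h0]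
  rw [hfull]
  calc _ ≤ ∑ β, ∑ i, ∑ j, |ε * ∫ x, T β i j x| := by
        refine (Finset.abs_sum_le_sum_abs _ _).trans (Finset.sum_le_sum fun β _ => ?_)
        refine (Finset.abs_sum_le_sum_abs _ _).trans (Finset.sum_le_sum fun i _ => ?_)
        exact Finset.abs_sum_le_sum_abs _ _
    _ ≤ ∑ _β : Fin 2, ∑ _i : Fin N, ∑ _j : Fin N,
          ε * (2 * M * (l2Norm Ω (gradFamily q) * l2Norm Ω (grad φ))) := by
        refine Finset.sum_le_sum fun β _ => Finset.sum_le_sum fun i _ =>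
          Finset.sum_le_sum fun j _ => ?_
        rw [abs_mul, abs_of_pos hε]
        gcongr
        exact hRb β i j
    _ = _ := by simp; ring

/-- `MemH10` measures closeness through the chosen weak derivative of the difference. By uniqueness
almost everywhere it can be computed from any weak derivatives of `u`, and each term of the sum of
squares is at most δ². -/
theorem MemH10.exists_approx {u : Plane → Vec N} (hu : MemH10 Ω u)
    {G : Fin 2 → Plane → Vec N} (hG : ∀ α, HasWeakPartial Ω α u (G α)) {δ : ℝ} (hδ : 0 < δ) :
    ∃ φ : 𝓓(Ω, Vec N), l2Norm Ω (fun x => u x - φ x) ≤ δ ∧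
      ∀ α, l2Norm Ω (fun x => G α x - partialD α φ x) ≤ δ := by
  obtain ⟨φ, hφ⟩ := hu.2 δ hδ
  have hφ1 : ContDiff ℝ 1 φ := φ.contDiff.of_le (by exact_mod_cast le_top)
  have h1 : ∀ α, l2Norm Ω (weakPartial Ω α fun x => u x - φ x)
      = l2Norm Ω fun x => G α x - partialD α φ x := fun α =>
    l2Norm_congr_ae (weakPartial_sub_ae_eq (hG α) (hasWeakPartial_of_contDiff hφ1))
  have h2 := (Real.sqrt_lt' hδ).1 hφ
  rw [Fin.sum_univ_two, h1, h1] at h2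
  have hn : 0 ≤ l2Norm Ω (fun x => u x - φ x) ^ 2 := sq_nonneg _
  have hn0 : 0 ≤ l2Norm Ω (fun x => G 0 x - partialD 0 φ x) ^ 2 := sq_nonneg _
  have hn1 : 0 ≤ l2Norm Ω (fun x => G 1 x - partialD 1 φ x) ^ 2 := sq_nonneg _
  refine ⟨φ, ?_, fun α => ?_⟩
  · exact (pow_le_pow_iff_left₀ (l2Norm_nonneg _ _) hδ.le two_ne_zero).1 (by linarith)
  · fin_cases α
    · exact (pow_le_pow_iff_left₀ (l2Norm_nonneg _ _) hδ.le two_ne_zero).1 (by simp only [Fin.zero_eta]; linarith)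
    · exact (pow_le_pow_iff_left₀ (l2Norm_nonneg _ _) hδ.le two_ne_zero).1 (by simp only [Fin.mk_one]; linarith)

end Estimates

/-! ### The energy estimate for the residual -/

section MainEstimate

variable {N : ℕ} {Ω : Opens Plane} {A : TensorField N}
  {χ : Fin 2 → Plane → Matrix (Fin N) (Fin N) ℝ}

theorem exists_common_bound {ι : Type*} [Fintype ι] {f : ι → Plane → ℝ}
    (h : ∀ i, ∃ M : ℝ, 0 ≤ M ∧ ∀ y, |f i y| ≤ M) : ∃ M : ℝ, 0 ≤ M ∧ ∀ i y, |f i y| ≤ M := by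
  choose M hM0 hM using h
  exact ⟨∑ i, M i, Finset.sum_nonneg fun i _ => hM0 i, fun i y =>
    (hM i y).trans (Finset.single_le_sum (f := M) (fun i _ => hM0 i) (Finset.mem_univ i))⟩

theorem IsAdmissible.exists_bound (hA : IsAdmissible A) :
    ∃ M : ℝ, 0 ≤ M ∧ ∀ α β i j y, |A α β y i j| ≤ M := by
  obtain ⟨M, hM0, hM⟩ := exists_common_bound
    (f := fun p : Fin 2 × Fin 2 × Fin N × Fin N => fun y => A p.1 p.2.1 y p.2.2.1 p.2.2.2)
    fun p => (hA.isPeriodic_entry _ _ _ _).exists_bound (hA.contDiff_one _ _ _ _).continuous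
  exact ⟨M, hM0, fun α β i j => hM (α, β, i, j)⟩

theorem IsCellSolution.exists_bound (hχ : IsCellSolution A χ) :
    ∃ M : ℝ, 0 ≤ M ∧ ∀ β j k y, |χ β y j k| ≤ M := by
  obtain ⟨M, hM0, hM⟩ := exists_common_bound
    (f := fun p : Fin 2 × Fin N × Fin N => fun y => χ p.1 y p.2.1 p.2.2)
    fun p => (hχ.isPeriodic_entry _ _ _).exists_bound (hχ.regular _ _ _).continuous
  exact ⟨M, hM0, fun β j k => hM (β, j, k)⟩

theorem exists_bound_homogenized (A : TensorField N)
    (χ : Fin 2 → Plane → Matrix (Fin N) (Fin N) ℝ) :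
    ∃ M : ℝ, 0 ≤ M ∧ ∀ α β i j y, |homogenized A χ α β y i j| ≤ M := by
  obtain ⟨M, hM0, hM⟩ := exists_common_bound
    (f := fun p : Fin 2 × Fin 2 × Fin N × Fin N => fun y =>
      homogenized A χ p.1 p.2.1 y p.2.2.1 p.2.2.2)
    fun p => ⟨_, abs_nonneg _, fun _ => le_rfl⟩
  exact ⟨M, hM0, fun α β i j => hM (α, β, i, j)⟩

theorem sq_norm_le_sum (ξ : Fin 2 → Vec N) : ‖ξ‖ ^ 2 ≤ ∑ α, ‖ξ α‖ ^ 2 := by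
  have h0 : 0 ≤ ∑ α, ‖ξ α‖ ^ 2 := Finset.sum_nonneg fun α _ => sq_nonneg _
  rw [← Real.sqrt_le_sqrt_iff h0, Real.sqrt_sq (norm_nonneg _)]
  refine (pi_norm_le_iff_of_nonneg (Real.sqrt_nonneg _)).2 fun α => Real.le_sqrt_of_sq_le ?_
  exact Finset.single_le_sum (f := fun α => ‖ξ α‖ ^ 2) (fun α _ => sq_nonneg _)
    (Finset.mem_univ α)

theorem continuous_oscillating (hA : IsAdmissible A) (ε : ℝ) (α β : Fin 2) (i j : Fin N) :
    Continuous fun x => oscillating A ε α β x i j :=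
  (hA.contDiff_one α β i j).continuous.comp (continuous_const_smul _)

theorem integral_sub_add_add_sub {μ : Measure Plane} {a b c d e : Plane → ℝ} (ha : Integrable a μ)
    (hb : Integrable b μ) (hc : Integrable c μ) (hd : Integrable d μ) (he : Integrable e μ) (t : ℝ) :
    ∫ x, ((a x - b x) + c x + d x - t * e x) ∂μ
      = (∫ x, a x ∂μ - ∫ x, b x ∂μ) + ∫ x, c x ∂μ + ∫ x, d x ∂μ - t * ∫ x, e x ∂μ := by
  have h1 : Integrable (fun x => a x - b x) μ := ha.sub hb
  have h2 : Integrable (fun x => a x - b x + c x) μ := h1.add hc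
  have h3 : Integrable (fun x => a x - b x + c x + d x) μ := h2.add hd
  rw [integral_sub h3 (he.const_mul t), integral_add h2 hd, integral_add h1 hc, integral_sub ha hb,
    integral_const_mul]

/-- The residual of the two-scale expansion, tested against a compactly supported function. -/
theorem abs_integral_residual_le (hA : IsAdmissible A) (hχ : IsCellSolution A χ)
    {M : ℝ} (hM : 0 ≤ M) (hAM : ∀ α β i j y, |A α β y i j| ≤ M)
    (hA0M : ∀ α β i j y, |homogenized A χ α β y i j| ≤ M) (hχM : ∀ β j k y, |χ β y j k| ≤ M)
    {E : Fin 2 → Fin N → Fin N → Plane → ℝ}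
    (hE : ∀ β i j, ContDiff ℝ 1 (E β i j)) (hEM : ∀ β i j y, |E β i j y| ≤ M)
    (hE1 : ∀ β i j y, partialD 1 (E β i j) y = fluxDefect A χ 0 β i j y)
    (hE0 : ∀ β i j y, partialD 0 (E β i j) y = - fluxDefect A χ 1 β i j y)
    {ε : ℝ} (hε : 0 < ε) {f : 𝓓(Ω, Vec N) →ₗ[ℝ] ℝ} {g uε u₀ : Plane → Vec N}
    (huε : IsWeakSolution Ω (oscillating A ε) f g uε)
    (hu₀ : IsWeakSolution Ω (homogenized A χ) f g u₀)
    {q : Fin 2 → Plane → Vec N} (hq : ∀ β, ContDiff ℝ 2 (q β))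
    (hqc : ∀ β, HasCompactSupport (q β)) {φ : Plane → Vec N} (hφ : ContDiff ℝ 2 φ)
    (hφc : HasCompactSupport φ) (hφs : tsupport φ ⊆ Ω) :
    |∫ x in (Ω : Set Plane), bil (fun α β => oscillating A ε α β x)
        (weakGrad Ω uε x - weakGrad Ω u₀ x - grad (corrector χ ε q) x) (grad φ x)|
      ≤ (8 * N ^ 2 * M * l2Norm Ω (fun x => weakGrad Ω u₀ x - fun β => q β x)
          + (4 * N ^ 2 * M + 8 * N ^ 4 * M ^ 2) * (ε * l2Norm Ω (gradFamily q)))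
        * l2Norm Ω (grad φ) := by
  have hq1 : ∀ β, ContDiff ℝ 1 (q β) := fun β => (hq β).of_le (by norm_num)
  have hφ1 : ContDiff ℝ 1 φ := hφ.of_le (by norm_num)
  have mξ := huε.memH1.memL2_weakGrad
  have mζ := hu₀.memH1.memL2_weakGrad
  have mq : MemL2 Ω (fun x β => q β x) := memL2_family hq1 hqc
  have mζq : MemL2 Ω (fun x => weakGrad Ω u₀ x - fun β => q β x) := mζ.sub mq
  have mφ : MemL2 Ω (grad φ) := memL2_grad hφ1 hφc
  have mr : MemL2 Ω (correctorRemainder χ ε q) := memL2_correctorRemainder hχ hM hχM ε hq1 hqc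
  have cA := continuous_oscillating hA ε
  have cA0 : ∀ α β i j, Continuous fun x => homogenized A χ α β x i j := fun _ _ _ _ =>
    continuous_const
  have bA : ∀ x α β i j, |oscillating A ε α β x i j| ≤ M := fun x α β i j => hAM α β i j _
  have bA0 : ∀ x α β i j, |homogenized A χ α β x i j| ≤ M := fun x α β i j => hA0M α β i j x
  have bD : ∀ x α β i j, |((fun α β => homogenized A χ α β x : Tensor N)
      - fun α β => oscillating A ε α β x) α β i j| ≤ 2 * M := fun x α β i j =>
    (abs_sub _ _).trans (by linarith [bA x α β i j, bA0 x α β i j])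
  have cD : ∀ α β i j, Continuous fun x => ((fun α β => homogenized A χ α β x : Tensor N)
      - fun α β => oscillating A ε α β x) α β i j := fun α β i j =>
    (cA0 α β i j).sub (cA α β i j)
  have hDc : ∀ α β i j, Continuous fun x => fluxDefect A χ α β i j (ε⁻¹ • x) := fun α β i j =>
    (contDiff_fluxDefect hA hχ α β i j).continuous.comp (continuous_const_smul _)
  have i1 := (bil_integrable_and_le hM cA bA mξ mφ).1
  have i2 := (bil_integrable_and_le hM cA0 bA0 mζ mφ).1
  have i3 := bil_integrable_and_le (by positivity : 0 ≤ 2 * M) cD bD mζq mφ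
  have i5 := bil_integrable_and_le hM cA bA mr mφ
  have i4 : IntegrableOn (fun x => bil (fun α β => Matrix.of fun i j =>
      fluxDefect A χ α β i j (ε⁻¹ • x)) (fun β => q β x) (grad φ x)) (Ω : Set Plane) := by
    obtain ⟨K, hK0, hK⟩ := exists_common_bound
      (f := fun p : Fin 2 × Fin 2 × Fin N × Fin N => fluxDefect A χ p.1 p.2.1 p.2.2.1 p.2.2.2)
      fun p => (isPeriodic_fluxDefect hA hχ _ _ _ _).exists_bound
        (contDiff_fluxDefect hA hχ _ _ _ _).continuous
    exact (bil_integrable_and_le hK0 hDc (fun x α β i j => hK (α, β, i, j) _) mq mφ).1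
  -- Both sides equal f on test functions. The extension to less regular φ is needed because φ will
  -- involve the corrector, which is only C² like χ.
  have h0 : ∫ x in (Ω : Set Plane), bil (fun α β => oscillating A ε α β x)
        (weakGrad Ω uε x) (grad φ x)
      = ∫ x in (Ω : Set Plane), bil (fun α β => homogenized A χ α β x)
        (weakGrad Ω u₀ x) (grad φ x) :=
    integral_bil_eq_of_testFunction hM cA bA cA0 bA0 mξ mζ
      (fun ψ => (huε.weak ψ).trans (hu₀.weak ψ).symm) hφ1 hφc hφs
  have hsplit : ∫ x in (Ω : Set Plane), bil (fun α β => oscillating A ε α β x)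
        (weakGrad Ω uε x - weakGrad Ω u₀ x - grad (corrector χ ε q) x) (grad φ x)
      = (∫ x in (Ω : Set Plane), bil ((fun α β => homogenized A χ α β x)
          - fun α β => oscillating A ε α β x)
            (weakGrad Ω u₀ x - fun β => q β x) (grad φ x))
        + (∫ x in (Ω : Set Plane), bil (fun α β => Matrix.of fun i j =>
            fluxDefect A χ α β i j (ε⁻¹ • x)) (fun β => q β x) (grad φ x))
        - ε * ∫ x in (Ω : Set Plane), bil (fun α β => oscillating A ε α β x)
            (correctorRemainder χ ε q x) (grad φ x) := by
    simp_rw [bil_two_scale hχ hε.ne' hq]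
    rw [integral_sub_add_add_sub i1 i2 i3.1 i4 i5.1, h0, sub_self, zero_add]
  -- The constants: 8N²M from A⁰ − A(x/ε), whose entries are at most 2M; 4N²M from the flux defect;
  -- 8N⁴M² = 4N²M · 2N²M from the remainder.
  have b4 := abs_integral_fluxDefect_le hM hE hEM hE1 hE0 hε hq1 hqc hφ hφc hφs
  have b3 := i3.2
  have b5 := i5.2
  have br : l2Norm Ω (correctorRemainder χ ε q) ≤ 2 * N ^ 2 * M * l2Norm Ω (gradFamily q) :=
    l2Norm_le_of_norm_le (memL2_gradFamily hq1 hqc) (by positivity)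
      fun x _ => norm_correctorRemainder_le hM hχM ε q x
  rw [hsplit]
  have hφ0 := l2Norm_nonneg Ω (grad φ)
  have b5' : 4 * N ^ 2 * M * (l2Norm Ω (correctorRemainder χ ε q) * l2Norm Ω (grad φ))
      ≤ 4 * N ^ 2 * M * ((2 * N ^ 2 * M * l2Norm Ω (gradFamily q)) * l2Norm Ω (grad φ)) := by
    gcongr
  refine (abs_sub _ _).trans ?_
  rw [abs_mul, abs_of_pos hε]
  have h6 := mul_le_mul_of_nonneg_left (b5.trans b5') hε.le
  have h7 := abs_add_le
    (∫ x in (Ω : Set Plane), bil ((fun α β => homogenized A χ α β x)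
          - fun α β => oscillating A ε α β x)
            (weakGrad Ω u₀ x - fun β => q β x) (grad φ x))
    (∫ x in (Ω : Set Plane), bil (fun α β => Matrix.of fun i j =>
            fluxDefect A χ α β i j (ε⁻¹ • x)) (fun β => q β x) (grad φ x))
  nlinarith [h6, h7, b3, b4]

/-- Coercivity and the Poincaré inequality turn a bound on the residual into an `L²` bound. -/
theorem l2Norm_sub_le_of_residual {B : TensorField N} {lam M : ℝ} (hlam : 0 < lam) (hM : 0 ≤ M)
    (hBc : ∀ α β i j, Continuous fun x => B α β x i j) (hBM : ∀ x α β i j, |B α β x i j| ≤ M)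
    (hell : ∀ (ξ : Fin 2 → Vec N) (x : Plane), lam * ‖ξ‖ ^ 2 ≤ bil (fun α β => B α β x) ξ ξ)
    {P : ℝ} (hP : 0 ≤ P)
    (hpoinc : ∀ u : Plane → Vec N, ContDiff ℝ 1 u → HasCompactSupport u → tsupport u ⊆ Ω →
      l2Norm Ω u ≤ P * l2Norm Ω (grad u))
    {g u₁ u₂ : Plane → Vec N} (hg : MemH1 Ω g) (h1 : MemH1 Ω u₁) (h2 : MemH1 Ω u₂)
    (h1g : MemH10 Ω fun x => u₁ x - g x) (h2g : MemH10 Ω fun x => u₂ x - g x)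
    {v : Plane → Vec N} (hv : ContDiff ℝ 2 v) (hvc : HasCompactSupport v) (hvs : tsupport v ⊆ Ω)
    {R : ℝ} (hR : 0 ≤ R)
    (hres : ∀ φ : Plane → Vec N, ContDiff ℝ 2 φ → HasCompactSupport φ → tsupport φ ⊆ Ω →
      |∫ x in (Ω : Set Plane), bil (fun α β => B α β x)
        (weakGrad Ω u₁ x - weakGrad Ω u₂ x - grad v x) (grad φ x)| ≤ R * l2Norm Ω (grad φ)) :
    l2Norm Ω (fun x => u₁ x - u₂ x) ≤ P * lam⁻¹ * R + l2Norm Ω v := by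
  have hv1 : ContDiff ℝ 1 v := hv.of_le (by norm_num)
  -- `K` collects the approximation errors: 2δ in L² and, after coercivity and Poincaré, 4N²M times
  -- 4δ from the gradients.
  set K := 2 + P * lam⁻¹ * (4 * N ^ 2 * M * 4) with hK
  have hK0 : 0 < K := by positivity
  refine le_of_forall_pos_le_add fun e he => ?_
  set δ := e / K with hδ
  have hδ0 : 0 < δ := by positivity
  obtain ⟨φ₁, a1, b1⟩ := h1g.exists_approx
    (fun α => (h1.hasWeakPartial α).sub (hg.hasWeakPartial α)) hδ0
  obtain ⟨φ₂, a2, b2⟩ := h2g.exists_approx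
    (fun α => (h2.hasWeakPartial α).sub (hg.hasWeakPartial α)) hδ0
  have c1 : ContDiff ℝ 2 φ₁ := φ₁.contDiff.of_le (WithTop.coe_le_coe.2 (le_top : (2 : ℕ∞) ≤ ⊤))
  have c2 : ContDiff ℝ 2 φ₂ := φ₂.contDiff.of_le (WithTop.coe_le_coe.2 (le_top : (2 : ℕ∞) ≤ ⊤))
  have c11 : ContDiff ℝ 1 φ₁ := c1.of_le (by norm_num)
  have c21 : ContDiff ℝ 1 φ₂ := c2.of_le (by norm_num)
  have m1 : MemL2 Ω φ₁ := memL2_of_hasCompactSupport φ₁.continuous φ₁.hasCompactSupport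
  have m2 : MemL2 Ω φ₂ := memL2_of_hasCompactSupport φ₂.continuous φ₂.hasCompactSupport
  have mv : MemL2 Ω v := memL2_of_hasCompactSupport hv.continuous hvc
  -- The boundary datum `g` cancels: φ₁ − φ₂ approximates (u₁ − g) − (u₂ − g) = u₁ − u₂ in H¹.
  set z : Plane → Vec N := fun x => φ₁ x - φ₂ x with hz
  have hz2 : ContDiff ℝ 2 z := c1.sub c2
  have hz1 : ContDiff ℝ 1 z := hz2.of_le (by norm_num)
  have hzc : HasCompactSupport z := φ₁.hasCompactSupport.sub φ₂.hasCompactSupport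
  have hzs : tsupport z ⊆ Ω := (tsupport_sub φ₁ φ₂).trans
    (union_subset φ₁.tsupport_subset φ₂.tsupport_subset)
  -- The natural test function u₁ − u₂ − v is only in H¹₀; `w` is its C², compactly supported
  -- substitute.
  set w : Plane → Vec N := fun x => z x - v x with hw
  have hw2 : ContDiff ℝ 2 w := hz2.sub hv
  have hw1 : ContDiff ℝ 1 w := hw2.of_le (by norm_num)
  have hwc : HasCompactSupport w := hzc.sub hvc
  have hws : tsupport w ⊆ Ω := (tsupport_sub z v).trans (union_subset hzs hvs)
  have mz : MemL2 Ω z := m1.sub m2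
  have mw : MemL2 Ω w := mz.sub mv
  have gz : ∀ x, grad z x = grad φ₁ x - grad φ₂ x := by
    intro x; funext α
    have := (c11.differentiable one_ne_zero x).hasFDerivAt.sub
      (c21.differentiable one_ne_zero x).hasFDerivAt
    have e : fderiv ℝ z x = fderiv ℝ φ₁ x - fderiv ℝ φ₂ x := this.fderiv
    simp [grad, partialD, e]
  have gw : ∀ x, grad w x = grad z x - grad v x := by
    intro x; funext α
    have := (hz1.differentiable one_ne_zero x).hasFDerivAt.sub
      (hv1.differentiable one_ne_zero x).hasFDerivAt
    have e : fderiv ℝ w x = fderiv ℝ z x - fderiv ℝ v x := this.fderiv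
    simp [grad, partialD, e]
  have mgz : MemL2 Ω (grad z) := memL2_grad hz1 hzc
  have mgw : MemL2 Ω (grad w) := memL2_grad hw1 hwc
  have mgv : MemL2 Ω (grad v) := memL2_grad hv1 hvc
  have mξ := h1.memL2_weakGrad
  have mζ := h2.memL2_weakGrad
  have mp : ∀ {u : Plane → Vec N}, MemH1 Ω u → ∀ φ : 𝓓(Ω, Vec N), ∀ α, MemL2 Ω fun x =>
      weakPartial Ω α u x - weakPartial Ω α g x - partialD α φ x := by
    intro u hu φ α
    have c : ContDiff ℝ 1 φ := φ.contDiff.of_le (by exact_mod_cast le_top)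
    exact ((hu.memL2_weakPartial α).sub (hg.memL2_weakPartial α)).sub
      (memL2_of_hasCompactSupport (continuous_partialD c α)
        (hasCompactSupport_partialD φ.hasCompactSupport α))
  have hgrad : l2Norm Ω (fun x => weakGrad Ω u₁ x - weakGrad Ω u₂ x - grad z x) ≤ 4 * δ := by
    refine (l2Norm_pi_le fun α => ?_).trans ?_
    · exact ((mξ.sub mζ).sub mgz).eval α
    · calc _ ≤ ∑ _α : Fin 2, (δ + δ) := by
            refine Finset.sum_le_sum fun α _ => ?_
            refine le_trans (le_trans (le_of_eq ?_) (l2Norm_sub_le (mp h1 φ₁ α) (mp h2 φ₂ α)))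
              (add_le_add (b1 α) (b2 α))
            congr 1
            funext x
            simp only [gz, Pi.sub_apply, weakGrad, grad]
            abel
        _ = _ := by simp; ring
  have hdiff : l2Norm Ω (fun x => u₁ x - u₂ x - z x) ≤ 2 * δ := by
    have := l2Norm_sub_le ((h1.1.sub hg.1).sub m1) ((h2.1.sub hg.1).sub m2)
    refine le_trans (le_of_eq ?_) (this.trans ((add_le_add a1 a2).trans (le_of_eq (by ring))))
    congr 1
    funext x
    simp only [hz]
    abel
  have i0 := bil_integrable_and_le hM hBc hBM mgw mgw
  have i1 := bil_integrable_and_le hM hBc hBM ((mξ.sub mζ).sub mgv) mgw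
  have i2 := bil_integrable_and_le hM hBc hBM ((mξ.sub mζ).sub mgz) mgw
  -- ∇w is the residual ∇u₁ − ∇u₂ − ∇v minus the approximation error ∇u₁ − ∇u₂ − ∇z: the first is
  -- bounded by `hres`, the second is small.
  have hid : ∫ x in (Ω : Set Plane), bil (fun α β => B α β x) (grad w x) (grad w x)
      = (∫ x in (Ω : Set Plane), bil (fun α β => B α β x)
          (weakGrad Ω u₁ x - weakGrad Ω u₂ x - grad v x) (grad w x))
        - ∫ x in (Ω : Set Plane), bil (fun α β => B α β x)
          (weakGrad Ω u₁ x - weakGrad Ω u₂ x - grad z x) (grad w x) := by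
    rw [← integral_sub i1.1 i2.1]
    refine integral_congr_ae (ae_of_all _ fun x => ?_)
    simp only
    rw [← bil_sub_left, gw]
    congr 1
    abel
  have hco : lam * l2Norm Ω (grad w) ^ 2
      ≤ ∫ x in (Ω : Set Plane), bil (fun α β => B α β x) (grad w x) (grad w x) := by
    rw [sq_l2Norm mgw, ← integral_const_mul]
    refine integral_mono ?_ i0.1 fun x => hell (grad w x) x
    exact (MemLp.integrable_norm_pow mgw two_ne_zero).const_mul lam
  have hr1 := (le_abs_self _).trans (hres w hw2 hwc hws)
  have hr2 := (neg_le_abs _).trans i2.2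
  set t := l2Norm Ω (grad w) with ht
  have ht0 : 0 ≤ t := l2Norm_nonneg _ _
  have hN : 0 ≤ 4 * (N : ℝ) ^ 2 * M := by positivity
  have hmain : lam * t ^ 2 ≤ (R + 4 * N ^ 2 * M * (4 * δ)) * t := by
    have h3 : 4 * N ^ 2 * M * (l2Norm Ω (fun x => weakGrad Ω u₁ x - weakGrad Ω u₂ x - grad z x) * t)
        ≤ 4 * N ^ 2 * M * (4 * δ * t) := by gcongr
    rw [hid] at hco
    linarith
  have ht1 : lam * t ≤ R + 4 * N ^ 2 * M * (4 * δ) := by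
    -- Dividing by `t` requires t > 0; for t = 0 the bound is trivial.
    rcases ht0.eq_or_lt with h0 | h0
    · rw [← h0]; simp only [mul_zero]; positivity
    · refine le_of_mul_le_mul_right ?_ h0
      linarith [hmain]
  have ht2 : t ≤ lam⁻¹ * (R + 4 * N ^ 2 * M * (4 * δ)) := by
    rw [le_inv_mul_iff₀ hlam]; exact ht1
  have hw3 : l2Norm Ω w ≤ P * (lam⁻¹ * (R + 4 * N ^ 2 * M * (4 * δ))) :=
    (hpoinc w hw1 hwc hws).trans (by gcongr)
  have hz3 : l2Norm Ω z ≤ l2Norm Ω w + l2Norm Ω v := by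
    refine l2Norm_le_add mw mv fun x _ => ?_
    have e1 : z x = w x + v x := by simp [hw]
    rw [e1]
    exact norm_add_le _ _
  have hfin : l2Norm Ω (fun x => u₁ x - u₂ x) ≤ l2Norm Ω (fun x => u₁ x - u₂ x - z x) + l2Norm Ω z := by
    refine l2Norm_le_add ((h1.1.sub h2.1).sub mz) mz fun x _ => ?_
    have e1 : u₁ x - u₂ x = (u₁ x - u₂ x - z x) + z x := by abel
    calc ‖u₁ x - u₂ x‖ = ‖(u₁ x - u₂ x - z x) + z x‖ := by rw [← e1]
      _ ≤ _ := norm_add_le _ _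
  calc _ ≤ 2 * δ + (P * (lam⁻¹ * (R + 4 * N ^ 2 * M * (4 * δ))) + l2Norm Ω v) :=
        hfin.trans (add_le_add hdiff (hz3.trans (by gcongr)))
    _ = P * lam⁻¹ * R + l2Norm Ω v + K * δ := by rw [hK]; ring
    _ = _ := by rw [hδ, mul_div_cancel₀ _ hK0.ne']

/-- Bookkeeping: the separate constants are merged into one by adding nonnegative terms. -/
theorem error_le_of_bounds {a b k D X Y Z ε s v : ℝ} (ha : 0 ≤ a) (hb : 0 ≤ b) (hk : 0 ≤ k)
    (hD : 0 ≤ D) (hX : 0 ≤ X) (hY : 0 ≤ Y) (hZ : 0 ≤ Z) (hε : 0 < ε)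
    (h : s ≤ D * (a * X + b * (ε * Y)) + v) (hv : v ≤ k * ε * Z) :
    s ≤ (D * a + D * b + k) * (X + ε * Y + ε * Z) := by
  have t1 : 0 ≤ D * a * (ε * Y + ε * Z) := by positivity
  have t2 : 0 ≤ D * b * (X + ε * Z) := by positivity
  have t3 : 0 ≤ k * (X + ε * Y) := by positivity
  linarith

theorem le_bil_oscillating {lam : ℝ} (hlam : 0 < lam)
    (hell : ∀ (ξ : Fin 2 → Vec N) (y : Plane), lam * ∑ α, ‖ξ α‖ ^ 2 ≤ quadForm A y ξ)
    (ε : ℝ) (ξ : Fin 2 → Vec N) (x : Plane) :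
    lam * ‖ξ‖ ^ 2 ≤ bil (fun α β => oscillating A ε α β x) ξ ξ :=
  (mul_le_mul_of_nonneg_left (sq_norm_le_sum ξ) hlam.le).trans (hell ξ (ε⁻¹ • x))

theorem exists_uniform_bound (hA : IsAdmissible A) (hχ : IsCellSolution A χ) :
    ∃ M : ℝ, 0 ≤ M ∧ (∀ α β i j y, |A α β y i j| ≤ M) ∧ (∀ β j k y, |χ β y j k| ≤ M) ∧
      (∀ α β i j y, |homogenized A χ α β y i j| ≤ M) ∧
      ∃ E : Fin 2 → Fin N → Fin N → Plane → ℝ, (∀ β i j, ContDiff ℝ 1 (E β i j)) ∧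
        (∀ β i j y, |E β i j y| ≤ M) ∧
        (∀ β i j y, partialD 1 (E β i j) y = fluxDefect A χ 0 β i j y) ∧
        ∀ β i j y, partialD 0 (E β i j) y = - fluxDefect A χ 1 β i j y := by
  obtain ⟨M₁, hM₁, hAM⟩ := hA.exists_bound
  obtain ⟨M₂, hM₂, hχM⟩ := hχ.exists_bound
  obtain ⟨M₃, hM₃, hA0M⟩ := exists_bound_homogenized A χ
  obtain ⟨E, M₄, hM₄, hE, hEM, hE1, hE0⟩ := exists_fluxCorrector hA hχ
  exact ⟨M₁ + M₂ + M₃ + M₄, by positivity,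
    fun α β i j y => (hAM α β i j y).trans (by linarith),
    fun β j k y => (hχM β j k y).trans (by linarith),
    fun α β i j y => (hA0M α β i j y).trans (by linarith), E, hE,
    fun β i j y => (hEM β i j y).trans (by linarith), hE1, hE0⟩

/-- The `L²` error is controlled by any smooth compactly supported approximation of `∇u₀`. -/
theorem exists_l2Norm_sub_le (hb : Bornology.IsBounded (Ω : Set Plane)) (hA : IsAdmissible A)
    (hχ : IsCellSolution A χ) :
    ∃ C : ℝ, 0 ≤ C ∧ ∀ ε : ℝ, 0 < ε → ∀ (f : 𝓓(Ω, Vec N) →ₗ[ℝ] ℝ) (g uε u₀ : Plane → Vec N),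
      MemH1 Ω g → IsWeakSolution Ω (oscillating A ε) f g uε →
      IsWeakSolution Ω (homogenized A χ) f g u₀ →
      ∀ q : Fin 2 → Plane → Vec N, (∀ β, ContDiff ℝ 2 (q β)) → (∀ β, HasCompactSupport (q β)) →
        (∀ β, tsupport (q β) ⊆ Ω) →
        l2Norm Ω (fun x => uε x - u₀ x)
          ≤ C * (l2Norm Ω (fun x => weakGrad Ω u₀ x - fun β => q β x)
            + ε * l2Norm Ω (gradFamily q) + ε * l2Norm Ω (fun x β => q β x)) := by
  obtain ⟨M, hM, hAM, hχM, hA0M, E, hE, hEM, hE1, hE0⟩ := exists_uniform_bound hA hχ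
  obtain ⟨lam, hlam, hell⟩ := hA.elliptic
  obtain ⟨P, hP⟩ := exists_eLpNorm_le_eLpNorm_grad (Vec N) hb
  have hpoinc : ∀ u : Plane → Vec N, ContDiff ℝ 1 u → HasCompactSupport u → tsupport u ⊆ Ω →
      l2Norm Ω u ≤ P * l2Norm Ω (grad u) := by
    intro u hu hc hs
    have h := ENNReal.toReal_mono
      (ENNReal.mul_ne_top ENNReal.coe_ne_top (memL2_grad (Ω := Ω) hu hc).2.ne) (hP u hu hc hs)
    rwa [ENNReal.toReal_mul, ENNReal.coe_toReal] at h
  have hD : 0 ≤ (P : ℝ) * lam⁻¹ := by positivity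
  have ha : 0 ≤ 8 * (N : ℝ) ^ 2 * M := by positivity
  have hb' : 0 ≤ 4 * (N : ℝ) ^ 2 * M + 8 * (N : ℝ) ^ 4 * M ^ 2 := by positivity
  have hk : 0 ≤ 2 * (N : ℝ) ^ 2 * M := by positivity
  -- The witness is read off from `error_le_of_bounds` as D a + D b + k with D = P lam⁻¹; it
  -- involves no quantity depending on ε or the data.
  refine ⟨_, by positivity, fun ε hε f g uε u₀ hg huε hu₀ q hq hqc hqs =>
    error_le_of_bounds ha hb' hk hD (l2Norm_nonneg _ _) (l2Norm_nonneg _ _) (l2Norm_nonneg _ _) hε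
      (l2Norm_sub_le_of_residual (B := oscillating A ε) hlam hM
        (continuous_oscillating hA ε) (fun x α β i j => hAM α β i j _)
        (le_bil_oscillating hlam (fun ξ y => (hell ξ y).1) ε) P.2 hpoinc hg huε.memH1 hu₀.memH1
        huε.boundary hu₀.boundary (contDiff_corrector hχ ε hq) (hasCompactSupport_corrector ε hqc)
        ((tsupport_corrector_subset ε q).trans (iUnion_subset hqs))
        (add_nonneg (mul_nonneg ha (l2Norm_nonneg _ _))
          (mul_nonneg hb' (mul_nonneg hε.le (l2Norm_nonneg _ _))))
        fun φ hφ hφc hφs => abs_integral_residual_le hA hχ hM hAM hA0M hχM hE hEM hE1 hE0 hε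
          huε hu₀ hq hqc hφ hφc hφs) ?_⟩
  exact l2Norm_le_of_norm_le (memL2_family (fun β => (hq β).of_le (by norm_num)) hqc)
    (by positivity) fun x _ => norm_corrector_le hχM hε q x

end MainEstimate

/-! ### L² norms of restrictions and families -/

section Indicator

variable {G : Type*} [NormedAddCommGroup G] {Ω : Opens Plane}

theorem MemL2.indicator {u : Plane → G} (hu : MemL2 Ω u) {S : Set Plane} (hS : MeasurableSet S) :
    MemL2 Ω (S.indicator u) := MemLp.indicator hS hu

theorem l2Norm_indicator (u : Plane → G) {S : Set Plane} (hS : MeasurableSet S) (hSΩ : S ⊆ Ω) :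
    l2Norm Ω (S.indicator u) = (eLpNorm u 2 (volume.restrict S)).toReal := by
  rw [l2Norm, eLpNorm_indicator_eq_eLpNorm_restrict hS, Measure.restrict_restrict hS,
    inter_eq_self_of_subset_left hSΩ]

theorem l2Norm_family_le {c : ℝ} {v : Plane → Fin 2 → G} (hv : ∀ β, MemL2 Ω fun x => v x β)
    (h : ∀ β, l2Norm Ω (fun x => v x β) ≤ c) : l2Norm Ω v ≤ 2 * c :=
  (l2Norm_pi_le hv).trans ((Finset.sum_le_sum fun β _ => h β).trans (by simp))

theorem l2Norm_const_smul [NormedSpace ℝ G] {c : ℝ} (hc : 0 ≤ c) (v : Plane → G) :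
    l2Norm Ω (fun x => c • v x) = c * l2Norm Ω v := by
  have := eLpNorm_const_smul (μ := volume.restrict (Ω : Set Plane)) (p := 2) c v
  rw [l2Norm, l2Norm, show (fun x => c • v x) = c • v from rfl, this, ENNReal.toReal_mul,
    toReal_enorm, Real.norm_of_nonneg hc]

end Indicator

/-! ### Cutting off and smoothing an H¹ function -/

section Rate

variable {F : Type*} [NormedAddCommGroup F] [NormedSpace ℝ F] {Ω : Opens Plane}

theorem MemH1.toReal_h1Sum [CompleteSpace F] {u : Plane → F} (hu : MemH1 Ω u) :
    (h1Sum Ω u).toReal = l2Norm Ω u + ∑ α, l2Norm Ω (weakPartial Ω α u) := by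
  rw [h1Sum, ENNReal.toReal_add hu.1.2.ne
    (ENNReal.sum_ne_top.2 fun α _ => (hu.memL2_weakPartial α).2.ne),
    ENNReal.toReal_sum fun α _ => (hu.memL2_weakPartial α).2.ne]
  rfl

theorem exists_l2Norm_boundaryLayer_le [CompleteSpace F]
    (hb : Bornology.IsBounded (Ω : Set Plane)) (hL : HasLipschitzBoundary (Ω : Set Plane)) :
    ∃ C : ℝ, 0 ≤ C ∧ ∀ u : Plane → F, MemH1 Ω u → ∀ δ : ℝ, 0 < δ →
      l2Norm Ω ((boundaryLayer Ω δ).indicator u)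
        ≤ C * δ ^ (1 / 2 : ℝ) * (l2Norm Ω u + ∑ α, l2Norm Ω (weakPartial Ω α u)) := by
  obtain ⟨C, hC⟩ := exists_eLpNorm_boundaryLayer_le (F := F) hb hL
  refine ⟨C, C.2, fun u hu δ hδ => ?_⟩
  have hfin : (C : ℝ≥0∞) * ENNReal.ofReal δ ^ (1 / 2 : ℝ) ≠ ⊤ :=
    ENNReal.mul_ne_top ENNReal.coe_ne_top
      (ENNReal.rpow_ne_top_of_nonneg (by norm_num) ENNReal.ofReal_ne_top)
  have h := ENNReal.toReal_mono (ENNReal.mul_ne_top hfin hu.h1Sum_ne_top) (hC u hu δ hδ)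
  rw [l2Norm_indicator u (measurableSet_boundaryLayer Ω δ) (boundaryLayer_subset Ω δ),
    ← hu.toReal_h1Sum]
  rwa [ENNReal.toReal_mul, ENNReal.toReal_mul, ENNReal.coe_toReal, ← ENNReal.toReal_rpow,
    ENNReal.toReal_ofReal hδ.le] at h

theorem MemH1.exists_contDiff_l2Norm_le [CompleteSpace F] {u : Plane → F} (hu : MemH1 Ω u)
    {K : Set Plane} (hK : IsCompact K) (hKΩ : K ⊆ Ω) {δ : ℝ} (hδ : 0 < δ) :
    ∃ ψ : Plane → F, ContDiff ℝ ∞ ψ ∧ MemL2 Ω (K.indicator fun x => u x - ψ x) ∧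
      (∀ α, MemL2 Ω (K.indicator fun x => weakPartial Ω α u x - partialD α ψ x)) ∧
      l2Norm Ω (K.indicator fun x => u x - ψ x) ≤ δ ∧
      ∀ α, l2Norm Ω (K.indicator fun x => weakPartial Ω α u x - partialD α ψ x) ≤ δ := by
  obtain ⟨ψ, hψ, h0, h1⟩ := hu.exists_contDiff_approx hK hKΩ (ENNReal.ofReal_pos.2 hδ)
  have hψ1 : ContDiff ℝ 1 ψ := hψ.of_le (by simp)
  have e : ∀ v : Plane → F, AEStronglyMeasurable v (volume.restrict K) →
      eLpNorm v 2 (volume.restrict K) ≤ ENNReal.ofReal δ →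
      MemL2 Ω (K.indicator v) ∧ l2Norm Ω (K.indicator v) ≤ δ := by
    intro v hv hle
    constructor
    · refine (memLp_indicator_iff_restrict hK.measurableSet).2 ?_
      rw [Measure.restrict_restrict hK.measurableSet, inter_eq_self_of_subset_left hKΩ]
      exact ⟨hv, hle.trans_lt ENNReal.ofReal_lt_top⟩
    · rw [l2Norm_indicator v hK.measurableSet hKΩ]
      exact ENNReal.toReal_le_of_le_ofReal hδ.le hle
  have m0 := (aestronglyMeasurable_restrict_of_subset hKΩ hu.1).sub
    hψ1.continuous.aestronglyMeasurable
  have m1 := fun α => (aestronglyMeasurable_restrict_of_subset hKΩ (hu.memL2_weakPartial α)).sub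
    (continuous_partialD hψ1 α).aestronglyMeasurable
  exact ⟨ψ, hψ, (e _ m0 h0).1, fun α => (e _ (m1 α) (h1 α)).1, (e _ m0 h0).2,
    fun α => (e _ (m1 α) (h1 α)).2⟩

theorem partialD_smul {η : Plane → ℝ} {ψ : Plane → F} {x : Plane} (hη : DifferentiableAt ℝ η x)
    (hψ : DifferentiableAt ℝ ψ x) (α : Fin 2) :
    partialD α (fun y => η y • ψ y) x = η x • partialD α ψ x + partialD α η x • ψ x := by
  have e : fderiv ℝ (fun y => η y • ψ y) x = _ := (hη.hasFDerivAt.smul hψ.hasFDerivAt).fderiv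
  rw [partialD, e]
  simp [partialD]

/-- A function in `H¹(Ω)` is approximated by smooth compactly supported functions, up to its mass in
the boundary layer of width of order `ε`. -/
theorem MemH1.exists_contDiff_compactSupport [CompleteSpace F]
    (hb : Bornology.IsBounded (Ω : Set Plane)) {u : Plane → F} (hu : MemH1 Ω u)
    {ε δ : ℝ} (hε : 0 < ε) (hδ : 0 < δ) :
    ∃ q : Plane → F, ContDiff ℝ 2 q ∧ HasCompactSupport q ∧ tsupport q ⊆ Ω ∧
      l2Norm Ω (fun x => u x - q x) ≤ l2Norm Ω ((boundaryLayer Ω (5 * ε)).indicator u) + δ ∧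
      ∀ α, ε * l2Norm Ω (partialD α q) ≤ l2Norm Ω ((boundaryLayer Ω (5 * ε)).indicator u) + δ
        + ε * (l2Norm Ω (weakPartial Ω α u) + δ) := by
  obtain ⟨η, hη, hηc, hηs, hη0, hη1, hηd, hη2⟩ := exists_cutoff (Ω := Ω) hb hε
  obtain ⟨ψ, hψ, m0, m1, h0, h1⟩ := hu.exists_contDiff_l2Norm_le hηc hηs hδ
  have mL := hu.1.indicator (measurableSet_boundaryLayer Ω (5 * ε))
  have hηx : ∀ x, x ∉ tsupport η → η x = 0 := fun x hx => image_eq_zero_of_notMem_tsupport hx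
  -- ψ need only be close to `u` on the support of η, a compact subset of Ω, so no extension of `u`
  -- across ∂Ω is required.
  refine ⟨fun x => η x • ψ x, (hη.smul hψ).of_le (WithTop.coe_le_coe.2 le_top), hηc.smul_right,
    (tsupport_smul_subset_left η ψ).trans hηs, ?_, fun α => ?_⟩
  · refine (l2Norm_le_add mL m0 fun x hx => ?_).trans (add_le_add le_rfl h0)
    -- The first term lives in the boundary layer, where η may differ from 1; the second lives on
    -- the support of η, where ψ is close to `u`.
    have e1 : u x - η x • ψ x = (1 - η x) • u x + η x • (u x - ψ x) := by module
    rw [e1]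
    refine (norm_add_le _ _).trans (add_le_add ?_ ?_)
    · by_cases hl : x ∈ boundaryLayer Ω (5 * ε)
      · rw [indicator_of_mem hl, norm_smul, Real.norm_of_nonneg (by linarith [hη1 x])]
        exact mul_le_of_le_one_left (norm_nonneg _) (by linarith [hη0 x])
      · simp [(hη2 x hx hl).1]
    · by_cases hk : x ∈ tsupport η
      · rw [indicator_of_mem hk, norm_smul, Real.norm_of_nonneg (hη0 x)]
        exact mul_le_of_le_one_left (norm_nonneg _) (hη1 x)
      · simp [hηx x hk]
  · have mw := hu.memL2_weakPartial α
    have mA := mL.norm.add m0.norm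
    have mB := mw.norm.add (m1 α).norm
    have hbd : l2Norm Ω (fun x => ε • partialD α (fun y => η y • ψ y) x)
        ≤ l2Norm Ω (fun x => ‖(boundaryLayer Ω (5 * ε)).indicator u x‖
            + ‖(tsupport η).indicator (fun x => u x - ψ x) x‖)
          + l2Norm Ω (fun x => ε • (‖weakPartial Ω α u x‖
            + ‖(tsupport η).indicator (fun x => weakPartial Ω α u x - partialD α ψ x) x‖)) := by
      refine l2Norm_le_add mA (MemLp.const_smul mB ε) fun x hx => ?_
      rw [partialD_smul (hη.differentiable (by simp) x) (hψ.differentiable (by simp) x), smul_add,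
        add_comm, norm_smul_of_nonneg hε.le,
        Real.norm_of_nonneg (add_nonneg (norm_nonneg _) (norm_nonneg _)),
        Real.norm_of_nonneg (add_nonneg (norm_nonneg _) (norm_nonneg _))]
      refine (norm_add_le _ _).trans (add_le_add ?_ ?_)
      · by_cases hl : x ∈ boundaryLayer Ω (5 * ε)
        · by_cases hk : x ∈ tsupport η
          · rw [indicator_of_mem hl, indicator_of_mem hk, norm_smul_of_nonneg hε.le, norm_smul,
              ← mul_assoc]
            -- The slope of η exactly absorbs ε, so ε ∂η ψ is bounded by ψ = u − (u − ψ) on the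
            -- layer, outside of which ∂η vanishes.
            have h2 : ε * ‖partialD α η x‖ ≤ 1 := by
              rw [Real.norm_eq_abs, ← mul_inv_cancel₀ hε.ne']
              exact mul_le_mul_of_nonneg_left (hηd α x) hε.le
            calc _ ≤ 1 * ‖ψ x‖ := by gcongr
              _ = ‖u x - (u x - ψ x)‖ := by simp
              _ ≤ _ := norm_sub_le _ _
          · rw [grad_eq_zero_of_notMem hk]
            simp only [zero_smul, smul_zero, norm_zero]
            positivity
        · rw [(hη2 x hx hl).2 α]
          simp only [zero_smul, smul_zero, norm_zero]
          positivity
      · rw [norm_smul_of_nonneg hε.le]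
        refine mul_le_mul_of_nonneg_left ?_ hε.le
        by_cases hk : x ∈ tsupport η
        · rw [indicator_of_mem hk, norm_smul, Real.norm_of_nonneg (hη0 x)]
          calc _ ≤ 1 * ‖partialD α ψ x‖ := by gcongr; exact hη1 x
            _ = ‖weakPartial Ω α u x - (weakPartial Ω α u x - partialD α ψ x)‖ := by simp
            _ ≤ _ := norm_sub_le _ _
        · rw [hηx x hk]
          simp only [zero_smul, norm_zero]
          positivity
    rw [l2Norm_const_smul hε.le, l2Norm_const_smul hε.le] at hbd
    have a1 := l2Norm_add_le mL.norm m0.norm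
    have a2 := l2Norm_add_le mw.norm (m1 α).norm
    rw [l2Norm_norm, l2Norm_norm] at a1 a2
    exact hbd.trans (add_le_add (a1.trans (add_le_add le_rfl h0))
      (mul_le_mul_of_nonneg_left (a2.trans (add_le_add le_rfl (h1 α))) hε.le))

theorem h2Norm_nonneg (Ω : Opens Plane) (u : Plane → F) : 0 ≤ h2Norm Ω u := Real.sqrt_nonneg _

theorem le_sum_sq (a : Fin 2 → ℝ) (α : Fin 2) : a α ^ 2 ≤ ∑ γ, a γ ^ 2 :=
  Finset.single_le_sum (f := fun γ => a γ ^ 2) (fun _ _ => sq_nonneg _) (Finset.mem_univ α)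

theorem l2Norm_weakPartial_le_h2Norm (Ω : Opens Plane) (u : Plane → F) (α : Fin 2) :
    l2Norm Ω (weakPartial Ω α u) ≤ h2Norm Ω u := by
  rw [h2Norm]
  refine Real.le_sqrt_of_sq_le ((le_sum_sq (fun γ => l2Norm Ω (weakPartial Ω γ u)) α).trans ?_)
  rw [add_assoc, add_left_comm]
  exact le_add_of_nonneg_right (add_nonneg (sq_nonneg _)
    (Finset.sum_nonneg fun _ _ => Finset.sum_nonneg fun _ _ => sq_nonneg _))

theorem l2Norm_weakPartial_weakPartial_le_h2Norm (Ω : Opens Plane) (u : Plane → F) (α β : Fin 2) :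
    l2Norm Ω (weakPartial Ω β (weakPartial Ω α u)) ≤ h2Norm Ω u := by
  rw [h2Norm]
  refine Real.le_sqrt_of_sq_le
    ((le_sum_sq (fun γ => l2Norm Ω (weakPartial Ω γ (weakPartial Ω α u))) β).trans ?_)
  refine (Finset.single_le_sum
    (f := fun δ => ∑ γ, l2Norm Ω (weakPartial Ω γ (weakPartial Ω δ u)) ^ 2)
    (fun _ _ => Finset.sum_nonneg fun _ _ => sq_nonneg _) (Finset.mem_univ α)).trans ?_
  exact le_add_of_nonneg_left (add_nonneg (sq_nonneg _) (Finset.sum_nonneg fun _ _ => sq_nonneg _))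

end Rate

/-! ### The rate ε^{1/2} -/

section Corollary

variable {N : ℕ} {Ω : Opens Plane}

theorem l2Norm_weakGrad_le_h2Norm {u : Plane → Vec N} (hu : MemH1 Ω u) :
    l2Norm Ω (weakGrad Ω u) ≤ 2 * h2Norm Ω u :=
  l2Norm_family_le (v := weakGrad Ω u) (fun β => hu.memL2_weakPartial β)
    fun β => l2Norm_weakPartial_le_h2Norm Ω u β

/-- The gradient of an `H²` function is approximated by smooth compactly supported families, at the
rate `ε^{1/2}` for the quantity that controls the homogenization error. -/
theorem exists_family_le (hb : Bornology.IsBounded (Ω : Set Plane))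
    (hL : HasLipschitzBoundary (Ω : Set Plane)) (N : ℕ) :
    ∃ C : ℝ, 0 ≤ C ∧ ∀ ε : ℝ, 0 < ε → ∀ u : Plane → Vec N, MemH2 Ω u → ∀ δ : ℝ, 0 < δ →
      ∃ q : Fin 2 → Plane → Vec N, (∀ β, ContDiff ℝ 2 (q β)) ∧ (∀ β, HasCompactSupport (q β)) ∧
        (∀ β, tsupport (q β) ⊆ Ω) ∧
        l2Norm Ω (fun x => weakGrad Ω u x - fun β => q β x)
            + ε * l2Norm Ω (gradFamily q) + ε * l2Norm Ω (fun x β => q β x)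
          ≤ C * ε ^ (1 / 2 : ℝ) * h2Norm Ω u + δ := by
  obtain ⟨C, hC, hlayer⟩ := exists_l2Norm_boundaryLayer_le (F := Vec N) hb hL
  have s5 : 0 ≤ (5 : ℝ) ^ (1 / 2 : ℝ) := by positivity
  -- With ℓ the bound on the layer norm, the three quantities contribute 2ℓ + 4ℓ + 2ℓ, and ℓ
  -- contains a factor 3: hence 24. The 6 is 4 from the second derivatives in ε∇q plus 2 from the
  -- gradient in εq.
  refine ⟨24 * C * 5 ^ (1 / 2 : ℝ) + 6, by positivity, fun ε hε u hu d hd => ?_⟩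
  have hh := h2Norm_nonneg Ω u
  have h1 := l2Norm_weakGrad_le_h2Norm hu.1
  -- For ε ≥ 1 there is nothing to gain: q = 0 works, since ‖∇u‖ is at most 2 ε^{1/2} times the H²
  -- norm.
  rcases le_or_gt 1 ε with h1ε | hε1
  · refine ⟨fun _ _ => 0, fun _ => contDiff_const, fun _ => HasCompactSupport.zero, fun _ => ?_, ?_⟩
    · simp [tsupport]
    · have e1 : (fun x => weakGrad Ω u x - fun _ => 0) = weakGrad Ω u := by
        funext x β; simp
      have e2 : gradFamily (fun _ _ => 0 : Fin 2 → Plane → Vec N) = fun _ => 0 := by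
        funext x β α; simp [gradFamily, grad, partialD]
      have e3 : (fun (_ : Plane) (_ : Fin 2) => (0 : Vec N)) = fun _ => 0 := rfl
      have e4 : ∀ (G : Type) [NormedAddCommGroup G], l2Norm Ω (fun _ => (0 : G)) = 0 := by
        intro G _; simp [l2Norm]
      rw [e1, e2, e3, e4, e4]
      have hs : 1 ≤ ε ^ (1 / 2 : ℝ) := Real.one_le_rpow h1ε (by norm_num)
      have t1 : 0 ≤ 24 * C * 5 ^ (1 / 2 : ℝ) * ε ^ (1 / 2 : ℝ) * h2Norm Ω u := by positivity
      have t2 := mul_le_mul_of_nonneg_right hs hh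
      linarith
  -- Twelve copies of the tolerance at most are spent: 2 for ∇u − q, 4 + 4 for ε∇q and 2 for εq,
  -- using ε < 1.
  · have hδ : 0 < d / 12 := by positivity
    choose q hq hqc hqs hX hY using fun β =>
      (hu.2 β).exists_contDiff_compactSupport hb hε hδ
    refine ⟨q, hq, hqc, hqs, ?_⟩
    have hs : ε ≤ ε ^ (1 / 2 : ℝ) := by
      conv_lhs => rw [← Real.rpow_one ε]
      exact Real.rpow_le_rpow_of_exponent_ge hε hε1.le (by norm_num)
    have hlay : ∀ β, l2Norm Ω ((boundaryLayer Ω (5 * ε)).indicator (weakPartial Ω β u))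
        ≤ C * (5 ^ (1 / 2 : ℝ) * ε ^ (1 / 2 : ℝ)) * (3 * h2Norm Ω u) := by
      intro β
      refine (hlayer _ (hu.2 β) (5 * ε) (by positivity)).trans ?_
      rw [Real.mul_rpow (by norm_num) hε.le]
      gcongr
      rw [Fin.sum_univ_two]
      linarith [l2Norm_weakPartial_le_h2Norm Ω u β,
        l2Norm_weakPartial_weakPartial_le_h2Norm Ω u β 0,
        l2Norm_weakPartial_weakPartial_le_h2Norm Ω u β 1]
    obtain ⟨ℓ, hℓ⟩ : ∃ ℓ, ℓ = C * (5 ^ (1 / 2 : ℝ) * ε ^ (1 / 2 : ℝ)) * (3 * h2Norm Ω u) := ⟨_, rfl⟩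
    rw [← hℓ] at hlay
    have hℓ0 : 0 ≤ ℓ := by rw [hℓ]; positivity
    have hq1 : ∀ β, ContDiff ℝ 1 (q β) := fun β => (hq β).of_le (by norm_num)
    have mq : ∀ β, MemL2 Ω (q β) := fun β =>
      memL2_of_hasCompactSupport (hq β).continuous (hqc β)
    have mp := fun β => hu.1.memL2_weakPartial β
    have bX : l2Norm Ω (fun x => weakGrad Ω u x - fun β => q β x) ≤ 2 * (ℓ + d / 12) :=
      l2Norm_family_le (v := fun x => weakGrad Ω u x - fun β => q β x)
        (fun β => (mp β).sub (mq β)) fun β => (hX β).trans (by linarith [hlay β])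
    have bZ : l2Norm Ω (fun x β => q β x) ≤ 2 * h2Norm Ω u + 2 * (ℓ + d / 12) := by
      refine (l2Norm_le_add hu.1.memL2_weakGrad (hu.1.memL2_weakGrad.sub (memL2_family hq1 hqc))
        fun x _ => ?_).trans (add_le_add h1 bX)
      exact norm_le_norm_add_norm_sub (weakGrad Ω u x) fun β => q β x
    have bY : ε * l2Norm Ω (gradFamily q) ≤ 4 * (ℓ + d / 12 + ε * (h2Norm Ω u + d / 12)) := by
      have b : ∀ β γ, l2Norm Ω (partialD γ (q β))
          ≤ ε⁻¹ * (ℓ + d / 12 + ε * (h2Norm Ω u + d / 12)) := by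
        intro β γ
        rw [le_inv_mul_iff₀ hε]
        refine (hY β γ).trans (add_le_add (by linarith [hlay β]) ?_)
        gcongr
        exact l2Norm_weakPartial_weakPartial_le_h2Norm Ω u β γ
      have b2 : l2Norm Ω (gradFamily q)
          ≤ 2 * (2 * (ε⁻¹ * (ℓ + d / 12 + ε * (h2Norm Ω u + d / 12)))) :=
        l2Norm_family_le (v := gradFamily q) (fun β => memL2_grad (hq1 β) (hqc β)) fun β =>
          l2Norm_family_le (v := grad (q β)) (fun γ => memL2_of_hasCompactSupport
            (continuous_partialD (hq1 β) γ) (hasCompactSupport_partialD (hqc β) γ)) (b β)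
      refine (mul_le_mul_of_nonneg_left b2 hε.le).trans (le_of_eq ?_)
      field_simp
      ring
    have bZ' := mul_le_mul_of_nonneg_left bZ hε.le
    have t1 := mul_le_mul_of_nonneg_right hs hh
    have t2 : ε * ℓ ≤ ℓ := mul_le_of_le_one_left hℓ0 hε1.le
    have t3 : ε * d ≤ d := mul_le_of_le_one_left hd.le hε1.le
    have e8 : (24 * C * 5 ^ (1 / 2 : ℝ) + 6) * ε ^ (1 / 2 : ℝ) * h2Norm Ω u
        = 8 * ℓ + 6 * (ε ^ (1 / 2 : ℝ) * h2Norm Ω u) := by rw [hℓ]; ring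
    rw [e8]
    linarith

end Corollary

end Homog

/-! ### The homogenization error estimate -/

theorem corollary2p3 {N : ℕ} (Ω : Opens Homog.Plane)
    (hΩb : Bornology.IsBounded (Ω : Set Homog.Plane))
    (hΩL : Homog.HasLipschitzBoundary (Ω : Set Homog.Plane))
    (A : Homog.TensorField N) (hA : Homog.IsAdmissible A)
    (χ : Fin 2 → Homog.Plane → Matrix (Fin N) (Fin N) ℝ) (hχ : Homog.IsCellSolution A χ) :
    ∃ C : ℝ, 0 < C ∧ ∀ ε : ℝ, 0 < ε →
      ∀ (f : 𝓓(Ω, Homog.Vec N) →ₗ[ℝ] ℝ) (g uε u₀ : Homog.Plane → Homog.Vec N),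
        Homog.MemHNegOne Ω f → Homog.MemH1 Ω g →
        Homog.IsWeakSolution Ω (Homog.oscillating A ε) f g uε →
        Homog.IsWeakSolution Ω (Homog.homogenized A χ) f g u₀ →
        Homog.MemH2 Ω u₀ →
        Homog.l2Norm Ω (fun x => uε x - u₀ x) ≤ C * ε ^ (1 / 2 : ℝ) * Homog.h2Norm Ω u₀ := by
  obtain ⟨C₁, hC₁, h₁⟩ := Homog.exists_l2Norm_sub_le hΩb hA hχ
  obtain ⟨C₂, hC₂, h₂⟩ := Homog.exists_family_le hΩb hΩL N
  -- The added 1 only makes the constant strictly positive.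
  refine ⟨C₁ * C₂ + 1, by positivity, fun ε hε f g uε u₀ _ hg huε hu₀ hu => ?_⟩
  have hh := Homog.h2Norm_nonneg Ω u₀
  have hs : 0 ≤ ε ^ (1 / 2 : ℝ) * Homog.h2Norm Ω u₀ := by positivity
  suffices h : Homog.l2Norm Ω (fun x => uε x - u₀ x)
      ≤ C₁ * (C₂ * ε ^ (1 / 2 : ℝ) * Homog.h2Norm Ω u₀) by linarith
  refine le_of_forall_pos_le_add fun e he => ?_
  -- The tolerance is chosen so that, multiplied by `C₁`, it stays below `e`, also when `C₁` is
  -- zero.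
  obtain ⟨q, hq, hqc, hqs, hle⟩ := h₂ ε hε u₀ hu (e / (C₁ + 1)) (by positivity)
  refine (h₁ ε hε f g uε u₀ hg huε hu₀ q hq hqc hqs).trans
    ((mul_le_mul_of_nonneg_left hle hC₁).trans ?_)
  rw [mul_add]
  gcongr
  rw [mul_div_assoc', div_le_iff₀ (by positivity)]
  linarith
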